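/- **Proposition 5.1 (xy-model: exponentially local spectral flow).** Fix a dimension $\nu$, a number $N\ge 0$ and $g>0$. There are constants $C,\mu'>0$, depending only on $g$ and $N$ (and on the fixed lattice dimension $\nu$), such that the following holds. Let $L\ge 1$ and let $\Lambda=\mathbb Z_L^\nu$ be the cube with periodic boundary conditions and nearest-neighbour graph distance $d$. At every site there is a spin $1/2$ with Hilbert space $\mathcal H_x=\mathbb C^2$ and spin matrices $S^i_x$ (with eigenvalues $\pm\frac12$). Let $k\in\Lambda$. The site $k$ carries in addition an impurity of $N$ spins, with Hilbert space $\mathcal I=(\mathbb C^2)^{\otimes N}$, so that the single-site space at $k$ becomes $\mathcal H_k\otimes\mathcal I$. Let $u:\Lambda\to\mathbb R$ satisfy $u\ge\gamma$ for some $\gamma>0$, and let $$H=-\sum_{d(x,y)=1}\bigl(S_x^1S_y^1+S_x^2S_y^2\bigr)+\sum_x\bigl(u(x)+2\nu\bigr)\bigl(\tfrac12+S_x^3\bigr),$$ where the first sum is over ordered pairs and $H$ acts trivially on $\mathcal I$. Let $W(s)$, $s\in[0,1]$, be a smooth path of self-adjoint operators on $\mathcal H_k\otimes\mathcal I$ with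 $W(0)=0$ which commute with the third component of the total spin, and put $H(s)=H+W(s)$. Assume that for every $s\in[0,1]$ the spectrum of $H(s)$ has a low-lying part $\sigma_{\rm in}(s)$ with $a+g\le b$ for all $a\in\sigma_{\rm in}(s)$ and all $b$ in the rest of the spectrum, and that the spectral projection $P(s)$ of $H(s)$ onto $\sigma_{\rm in}(s)$ has rank $2^N$. Then for every $l\in[0,\infty]$ there are smooth paths, $s\in[0,1]$, of self-adjoint operators $G_l(s)$ and of unitary operators $U_l(s)$, both with support in $K_l=\{x\in\Lambda: d(x,k)\le l\}$ (where the impurity spins belong to the site $k$), such that $$-i\,\partial_sU_l(s)=G_l(s)U_l(s),\qquad U_l(0)=1,$$ and $$\bigl\|P(s)-U_l(s)P(0)U_l(s)^*\bigr\|\le C\,e^{-\mu' l}\qquad\text{for all } s\in[0,1],$$ where $e^{-\mu'\infty}=0$. -/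

import Mathlib

open scoped Matrix.Norms.L2Operator ContDiff ENNReal

namespace XYImpurity

/-! ## Spin systems

A spin-1/2 at every site of a finite set `V`.  The tensor product of the spaces `ℂ²` over `V` has
the product basis indexed by the configurations `V → Fin 2` (`0` is spin up, `1` is spin down), and
operators on it are square matrices indexed by configurations.  Their norm is the operator norm. -/

/-- Operators on the Hilbert space `⨂_{v ∈ V} ℂ²`. -/
abbrev SpinOp (V : Type) : Type := Matrix (V → Fin 2) (V → Fin 2) ℂ

/-- The operator `B ⊗ 1`, where `B` acts on the spins in `X` and `1` on the spins outside of `X`. -/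
noncomputable def embed {V : Type} (X : Set V) (B : SpinOp X) : SpinOp V :=
  open Classical in
  Matrix.of fun σ τ =>
    if ∀ v, v ∉ X → σ v = τ v then B (fun v => σ v) (fun v => τ v) else 0

/-- `A` has support in `X`: it is of the form `B ⊗ 1`. -/
def IsSupportedIn {V : Type} (X : Set V) (A : SpinOp V) : Prop :=
  ∃ B : SpinOp X, A = embed X B

/-- The spin matrix `S¹ = σ¹/2`. -/
noncomputable def spin1 : Matrix (Fin 2) (Fin 2) ℂ := !![0, 1 / 2; 1 / 2, 0]

/-- The spin matrix `S² = σ²/2`. -/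
noncomputable def spin2 : Matrix (Fin 2) (Fin 2) ℂ := !![0, -Complex.I / 2; Complex.I / 2, 0]

/-- The spin matrix `S³ = σ³/2`, with eigenvalue `1/2` on spin up and `-1/2` on spin down. -/
noncomputable def spin3 : Matrix (Fin 2) (Fin 2) ℂ := !![1 / 2, 0; 0, -1 / 2]

/-- The one-spin operator `M` acting on the spin at the site `v`. -/
noncomputable def siteOp {V : Type} (v : V) (M : Matrix (Fin 2) (Fin 2) ℂ) : SpinOp V :=
  embed {v} (Matrix.of fun σ τ => M (σ ⟨v, rfl⟩) (τ ⟨v, rfl⟩))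

/-- The third component `∑_v S³_v` of the total spin. -/
noncomputable def totalSpin (V : Type) [Fintype V] : SpinOp V :=
  ∑ v, siteOp v spin3

/-! ## The lattice and the impurity -/

/-- The sites of the cube `ℤ_L^ν` with periodic boundary conditions. -/
abbrev Torus (ν L : ℕ) : Type := Fin ν → ZMod L

/-- The graph distance on `ℤ_L^ν`, nearest neighbours being joined by an edge: the sum over the
coordinates of the distances on the cycle `ℤ_L`. -/
def torusDist {ν L : ℕ} (x y : Torus ν L) : ℕ :=
  ∑ i, (x i - y i).valMinAbs.natAbs

/-- All spins of the system: one at each lattice site, and the `N` spins of the impurity. -/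
abbrev Spins (ν L N : ℕ) : Type := Torus ν L ⊕ Fin N

/-- The spins in the `l`-fattening of the impurity site `k`: those at the lattice sites at distance
at most `l` from `k`, and the impurity spins (which belong to the site `k`). -/
def fattening {ν L N : ℕ} (k : Torus ν L) (l : ℝ≥0∞) : Set (Spins ν L N) :=
  {v | match v with
    | Sum.inl x => (torusDist x k : ℝ≥0∞) ≤ l
    | Sum.inr _ => True}

/-- The spins at the impurity site `k`: the lattice spin at `k` and the `N` impurity spins. -/
def impuritySpins {ν L N : ℕ} (k : Torus ν L) : Set (Spins ν L N) :=
  {v | match v with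
    | Sum.inl x => x = k
    | Sum.inr _ => True}

/-- The xy-Hamiltonian with on-site field `u`,
`-∑_{d(x,y)=1} (S¹_x S¹_y + S²_x S²_y) + ∑_x (u(x) + 2ν) (1/2 + S³_x)`,
the first sum being over ordered pairs.  It acts trivially on the impurity spins. -/
noncomputable def xyHamiltonian {ν L N : ℕ} [NeZero L] (u : Torus ν L → ℝ) :
    SpinOp (Spins ν L N) :=
  -(∑ x : Torus ν L, ∑ y : Torus ν L, if torusDist x y = 1 then
      siteOp (Sum.inl x) spin1 * siteOp (Sum.inl y) spin1
        + siteOp (Sum.inl x) spin2 * siteOp (Sum.inl y) spin2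
    else 0)
  + ∑ x : Torus ν L, (u x + 2 * (ν : ℝ)) • ((1 / 2 : ℝ) • 1 + siteOp (Sum.inl x) spin3)

/-- `W(s)`, `s ∈ [0,1]`, is an admissible coupling of the impurity at `k`: a smooth path, starting
at `0`, of self-adjoint operators supported at the impurity site that conserve the spin. -/
structure IsCoupling {ν L N : ℕ} [NeZero L] (k : Torus ν L)
    (W : ℝ → SpinOp (Spins ν L N)) : Prop where
  smooth : ContDiffOn ℝ ∞ W (Set.Icc 0 1)
  start : W 0 = 0
  selfAdjoint : ∀ s ∈ Set.Icc (0 : ℝ) 1, IsSelfAdjoint (W s)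
  support : ∀ s ∈ Set.Icc (0 : ℝ) 1, IsSupportedIn (impuritySpins k) (W s)
  conserving : ∀ s ∈ Set.Icc (0 : ℝ) 1, Commute (W s) (totalSpin (Spins ν L N))

/-! ## Gapped low-lying sectors -/

/-- `σin` is a low-lying part of the spectrum of `A`, separated by a gap of at least `g` from the
rest of the spectrum. -/
def IsGappedLowSector {ι : Type} [Fintype ι] [DecidableEq ι] (A : Matrix ι ι ℂ) (g : ℝ)
    (σin : Set ℝ) : Prop :=
  σin ⊆ spectrum ℝ A ∧ ∀ a ∈ σin, ∀ b ∈ spectrum ℝ A \ σin, a + g ≤ b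

/-- `P` is the spectral projection of the self-adjoint matrix `A` for the set `σin`: the orthogonal
projection onto the sum of the eigenspaces of `A` with eigenvalues in `σin`. -/
structure IsSpectralProjection {ι : Type} [Fintype ι] [DecidableEq ι] (A : Matrix ι ι ℂ)
    (σin : Set ℝ) (P : Matrix ι ι ℂ) : Prop where
  selfAdjoint : IsSelfAdjoint P
  idempotent : P * P = P
  range_eq : LinearMap.range (Matrix.toLin' P) =
    ⨆ a ∈ σin, Module.End.eigenspace (Matrix.toLin' A) (a : ℂ)

/-- `e^{-μ l}` for `l ∈ [0,∞]`, with value `0` at `l = ∞`. -/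
noncomputable def expDecay (μ : ℝ) (l : ℝ≥0∞) : ℝ :=
  open Classical in if l = ⊤ then 0 else Real.exp (-(μ * l.toReal))

end XYImpurity

namespace XYImpurity

open Matrix

set_option linter.unusedSectionVars false

/-! ## Quadratic forms and eigenbases -/

section Forms

variable {Ω : Type} [Fintype Ω]

/-! Call a lattice spin that is up a particle. The proof has two halves: the range of `P s` contains
particles far from `k` only with exponentially small amplitude (`exists_localization`), and a smooth
path of projections with this property is followed by a flow generated near `k`
(`exists_local_spectralFlow`).

Localization. The Hamiltonian `H` is nonnegative and annihilates the `2^N` vacuum configurations, so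
the rank condition forces `P 0` to be the vacuum projection, and particles cost at least `g` at `s =
0`. The coupling need not be small, so the escape of particles at later times is excluded by
counting dimensions and by continuity. Let `m s` be the top of the low-lying part and `ε s` the
lowest energy among configurations with at most `N` spins up. An IMS localization yields states of
energy near `ε s` that live in a fixed ball and leave its boundary sphere empty
(`exists_near_groundState`). Suppose that in each of `2^N + 1` separated annuli some state had
`H`-energy below `m - ε + 3g/4` at some time. At the time among these where `m - ε` is largest, the
products of all these states with the near ground state would span too many dimensions below `m +
g`. Hence one annulus is forbidden for all `s` simultaneously (`exists_forbidden_annulus`).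

Pick a radius `l` in that annulus, and let `e s` be the lowest energy of states with a particle
beyond `l` (or with more than `N` spins up). Then `e 0 ≥ m 0 + g`. If `e s` reached `m s + g/2`, the
part of its eigenvector in the annulus would be small, since the annulus is forbidden, and so would
the part beyond, since a cutoff makes it an approximate eigenvector of `H(s)` in the middle of the
gap (`no_crossing`). So `e s ≥ m s + g/2` throughout (`barrier`), and an Agmon estimate gives
exponential decay (`nsq_farProj_vec_le`).

Uniformity has two sources. All cutoffs commute with `W s`, so the size of the coupling never
enters. The hopping errors are bounded by the number of particles, which is at most `N` wherever the
cutoffs vary: configurations with more spins up are declared far, and the cutoffs are constant on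
them.

Flow. Compressing `P s` to the spins in `K_l`, with all other spins down, gives a nearly idempotent
matrix. Its spectral projection above `1/2` is smooth by the implicit function theorem
(`contDiffOn_proj`) and is carried along by Kato's generator `[p', p]` (`exists_spectralFlow`).
Tensoring this flow with the identity gives `U`; it acts correctly on `P 0` because the vacuum has
no spin up outside `K_l`. -/

/-- The squared Euclidean norm of a vector. -/
noncomputable def nsq (v : Ω → ℂ) : ℝ := ∑ σ, ‖v σ‖ ^ 2

/-- The quadratic form of a matrix. -/
noncomputable def form (A : Matrix Ω Ω ℂ) (v : Ω → ℂ) : ℝ := (star v ⬝ᵥ A *ᵥ v).re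

lemma nsq_nonneg (v : Ω → ℂ) : 0 ≤ nsq v := Finset.sum_nonneg fun _ _ => by positivity

lemma nsq_eq_norm (v : Ω → ℂ) : nsq v = ‖WithLp.toLp 2 v‖ ^ 2 := by
  rw [EuclideanSpace.norm_sq_eq]; rfl

lemma star_dotProduct_self (v : Ω → ℂ) : star v ⬝ᵥ v = (nsq v : ℂ) := by
  simp only [dotProduct, nsq, Pi.star_apply, Complex.ofReal_sum]
  refine Finset.sum_congr rfl fun σ _ => ?_
  rw [Complex.star_def, Complex.conj_mul']; push_cast; rfl

lemma nsq_eq_zero {v : Ω → ℂ} : nsq v = 0 ↔ v = 0 := by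
  rw [nsq_eq_norm, sq_eq_zero_iff, norm_eq_zero]
  constructor
  · intro h
    exact (WithLp.toLp_eq_zero 2).1 h
  · rintro rfl; rfl

lemma nsq_pos {v : Ω → ℂ} (hv : v ≠ 0) : 0 < nsq v :=
  lt_of_le_of_ne (nsq_nonneg v) fun h => hv (nsq_eq_zero.1 h.symm)

lemma nsq_smul (c : ℂ) (v : Ω → ℂ) : nsq (c • v) = ‖c‖ ^ 2 * nsq v := by
  simp [nsq, Finset.mul_sum, mul_pow]

lemma norm_dotProduct_le (v w : Ω → ℂ) : ‖star v ⬝ᵥ w‖ ≤ √(nsq v) * √(nsq w) := by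
  have := norm_inner_le_norm (𝕜 := ℂ) (WithLp.toLp 2 v) (WithLp.toLp 2 w)
  rw [EuclideanSpace.inner_eq_star_dotProduct, dotProduct_comm] at this
  simpa [nsq_eq_norm] using this

lemma sqrt_nsq_add_le (v w : Ω → ℂ) : √(nsq (v + w)) ≤ √(nsq v) + √(nsq w) := by
  have := norm_add_le (WithLp.toLp 2 v) (WithLp.toLp 2 w)
  simpa [nsq_eq_norm] using this

lemma form_add (A B : Matrix Ω Ω ℂ) (v : Ω → ℂ) : form (A + B) v = form A v + form B v := by
  simp [form, add_mulVec, dotProduct_add]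

lemma form_sub (A B : Matrix Ω Ω ℂ) (v : Ω → ℂ) : form (A - B) v = form A v - form B v := by
  simp [form, sub_mulVec, dotProduct_sub]

lemma form_eq_sum (A : Matrix Ω Ω ℂ) (v : Ω → ℂ) :
    form A v = ∑ σ, ∑ τ, (star (v σ) * A σ τ * v τ).re := by
  simp only [form, dotProduct, mulVec, Complex.re_sum, Finset.mul_sum, Pi.star_apply, mul_assoc]

variable [DecidableEq Ω]

lemma nsq_mulVec_le (A : Matrix Ω Ω ℂ) (v : Ω → ℂ) : nsq (A *ᵥ v) ≤ ‖A‖ ^ 2 * nsq v := by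
  have := l2_opNorm_mulVec A (WithLp.toLp 2 v)
  rw [nsq_eq_norm, nsq_eq_norm, ← mul_pow]
  exact pow_le_pow_left₀ (norm_nonneg _) this 2

lemma abs_form_le (A : Matrix Ω Ω ℂ) (v : Ω → ℂ) : |form A v| ≤ ‖A‖ * nsq v := by
  calc |form A v| ≤ ‖star v ⬝ᵥ A *ᵥ v‖ := Complex.abs_re_le_norm _
    _ ≤ √(nsq v) * √(nsq (A *ᵥ v)) := norm_dotProduct_le _ _
    _ ≤ √(nsq v) * (‖A‖ * √(nsq v)) := by
        gcongr
        rw [← Real.sqrt_sq (norm_nonneg A), ← Real.sqrt_mul (by positivity)]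
        exact Real.sqrt_le_sqrt (nsq_mulVec_le A v)
    _ = ‖A‖ * nsq v := by
        rw [mul_left_comm, Real.mul_self_sqrt (nsq_nonneg v)]

lemma opNorm_le_of_nsq (A : Matrix Ω Ω ℂ) {c : ℝ} (hc : 0 ≤ c)
    (h : ∀ v, nsq (A *ᵥ v) ≤ c ^ 2 * nsq v) : ‖A‖ ≤ c := by
  rw [l2_opNorm_def]
  refine ContinuousLinearMap.opNorm_le_bound _ hc fun x => ?_
  have := h (WithLp.ofLp x)
  rw [nsq_eq_norm, nsq_eq_norm, ← mul_pow] at this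
  exact le_of_sq_le_sq₀ this (by positivity)
where
  le_of_sq_le_sq₀ {a b : ℝ} (h : a ^ 2 ≤ b ^ 2) (hb : 0 ≤ b) : a ≤ b :=
    abs_le_of_sq_le_sq' h hb |>.2

/-- An orthonormal basis of eigenvectors of `A` with their eigenvalues. -/
structure EigenBasis (A : Matrix Ω Ω ℂ) where
  /-- the eigenvectors -/
  vec : Ω → Ω → ℂ
  /-- the eigenvalues -/
  val : Ω → ℝ
  orth : ∀ i j, star (vec i) ⬝ᵥ vec j = if i = j then 1 else 0
  expand : ∀ v, v = ∑ i, (star (vec i) ⬝ᵥ v) • vec i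
  eig : ∀ i, A *ᵥ vec i = (val i : ℂ) • vec i

/-- The eigenbasis of a Hermitian matrix. -/
noncomputable def EigenBasis.ofHermitian {A : Matrix Ω Ω ℂ} (hA : A.IsHermitian) :
    EigenBasis A where
  vec i := WithLp.ofLp (hA.eigenvectorBasis i)
  val := hA.eigenvalues
  orth i j := by
    have := orthonormal_iff_ite.1 hA.eigenvectorBasis.orthonormal i j
    rw [EuclideanSpace.inner_eq_star_dotProduct, dotProduct_comm] at this
    exact this
  expand v := by
    have := congrArg WithLp.ofLp (hA.eigenvectorBasis.sum_repr' (WithLp.toLp 2 v))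
    simp only [EuclideanSpace.inner_eq_star_dotProduct] at this
    rw [WithLp.ofLp_sum] at this
    conv_lhs => rw [← WithLp.ofLp_toLp 2 v, ← this]
    refine Finset.sum_congr rfl fun i _ => ?_
    rw [WithLp.ofLp_smul, dotProduct_comm]
  eig i := by
    rw [hA.mulVec_eigenvectorBasis i]
    ext; simp

namespace EigenBasis

variable {A : Matrix Ω Ω ℂ} (E : EigenBasis A)

/-- The coefficients of a vector in the eigenbasis. -/
noncomputable def coef (v : Ω → ℂ) (i : Ω) : ℂ := star (E.vec i) ⬝ᵥ v

lemma star_dot_vec (v : Ω → ℂ) (i : Ω) : star v ⬝ᵥ E.vec i = star (E.coef v i) := by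
  rw [coef, star_dotProduct, dotProduct_comm]

lemma dot_sum (v : Ω → ℂ) (c : Ω → ℂ) :
    star v ⬝ᵥ ∑ i, c i • E.vec i = ∑ i, c i * star (E.coef v i) := by
  rw [dotProduct_sum]
  refine Finset.sum_congr rfl fun i _ => ?_
  rw [dotProduct_smul, E.star_dot_vec, smul_eq_mul]

lemma coef_sum (c : Ω → ℂ) (j : Ω) : E.coef (∑ i, c i • E.vec i) j = c j := by
  rw [coef, dotProduct_sum]
  simp [dotProduct_smul, E.orth]

lemma nsq_eq (v : Ω → ℂ) : nsq v = ∑ i, ‖E.coef v i‖ ^ 2 := by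
  have h := star_dotProduct_self v
  conv_lhs at h => rw [E.expand v]
  have h2 := E.dot_sum v (E.coef v)
  have h3 : star v ⬝ᵥ v = ∑ i, E.coef v i * star (E.coef v i) := by
    rw [← h2]; congr 1; exact E.expand v
  rw [star_dotProduct_self] at h3
  have h4 : ((nsq v : ℝ) : ℂ) = ((∑ i, ‖E.coef v i‖ ^ 2 : ℝ) : ℂ) := by
    rw [h3]; push_cast
    refine Finset.sum_congr rfl fun i _ => ?_
    rw [Complex.star_def, Complex.mul_conj']
  exact_mod_cast h4

lemma mulVec_eq (v : Ω → ℂ) : A *ᵥ v = ∑ i, ((E.val i : ℂ) * E.coef v i) • E.vec i := by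
  conv_lhs => rw [E.expand v]
  rw [mulVec_sum]
  refine Finset.sum_congr rfl fun i _ => ?_
  rw [mulVec_smul, E.eig, smul_smul, mul_comm]; rfl

lemma coef_mulVec (v : Ω → ℂ) (i : Ω) : E.coef (A *ᵥ v) i = E.val i * E.coef v i := by
  rw [E.mulVec_eq, E.coef_sum]

lemma form_eq (v : Ω → ℂ) : form A v = ∑ i, E.val i * ‖E.coef v i‖ ^ 2 := by
  have h : star v ⬝ᵥ A *ᵥ v = ((∑ i, E.val i * ‖E.coef v i‖ ^ 2 : ℝ) : ℂ) := by
    rw [E.mulVec_eq, E.dot_sum]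
    push_cast
    refine Finset.sum_congr rfl fun i _ => ?_
    rw [mul_assoc, Complex.star_def, Complex.mul_conj']
  rw [form, h, Complex.ofReal_re]

lemma coef_add (v w : Ω → ℂ) (i : Ω) : E.coef (v + w) i = E.coef v i + E.coef w i :=
  dotProduct_add _ _ _

lemma coef_sub (v w : Ω → ℂ) (i : Ω) : E.coef (v - w) i = E.coef v i - E.coef w i :=
  dotProduct_sub _ _ _

lemma coef_smul (c : ℂ) (v : Ω → ℂ) (i : Ω) : E.coef (c • v) i = c * E.coef v i :=
  dotProduct_smul _ _ _

lemma nsq_vec (i : Ω) : nsq (E.vec i) = 1 := by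
  have := star_dotProduct_self (E.vec i)
  rw [E.orth, if_pos rfl] at this
  exact_mod_cast this.symm

lemma ext_coef {v w : Ω → ℂ} (h : ∀ i, E.coef v i = E.coef w i) : v = w := by
  rw [E.expand v, E.expand w]
  exact Finset.sum_congr rfl fun i _ => congrArg (· • E.vec i) (h i)

/-- A linear family larger than a set of coefficients has a member where these vanish. -/
lemma exists_combination {ι : Type} [Fintype ι] (Φ : ι → Ω → ℂ) (K : Finset Ω)
    (hK : K.card < Fintype.card ι) :
    ∃ z : ι → ℂ, z ≠ 0 ∧ ∀ k ∈ K, E.coef (∑ i, z i • Φ i) k = 0 := by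
  let f : (ι → ℂ) →ₗ[ℂ] (K → ℂ) :=
    { toFun := fun z k => E.coef (∑ i, z i • Φ i) k
      map_add' := fun z w => by
        ext k; simp [add_smul, Finset.sum_add_distrib, coef_add]
      map_smul' := fun c z => by
        ext k; simp [mul_smul, ← Finset.smul_sum, coef_smul] }
  have hker : LinearMap.ker f ≠ ⊥ := by
    apply LinearMap.ker_ne_bot_of_finrank_lt
    simpa using hK
  obtain ⟨z, hz, hz0⟩ := Submodule.exists_mem_ne_zero_of_ne_bot hker
  refine ⟨z, hz0, fun k hk => ?_⟩
  exact congrFun (LinearMap.mem_ker.1 hz) ⟨k, hk⟩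

end EigenBasis

/-- A Hermitian matrix has a ground state among the vectors supported in a nonempty set. -/
lemma exists_groundState {A : Matrix Ω Ω ℂ} (hA : A.IsHermitian) (S : Set Ω) (hS : S.Nonempty) :
    ∃ (e : ℝ) (ψ : Ω → ℂ), (∀ σ ∉ S, ψ σ = 0) ∧ nsq ψ = 1 ∧
      (∀ σ ∈ S, (A *ᵥ ψ) σ = e * ψ σ) ∧
      ∀ φ : Ω → ℂ, (∀ σ ∉ S, φ σ = 0) → e * nsq φ ≤ form A φ := by
  classical
  -- The lowest eigenvector of the compression to `S`, extended by zero, satisfies the eigenvalue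
  -- equation on `S` only. Off `S` nothing is known, and the cutoffs used later have to respect
  -- this.
  let B : Matrix S S ℂ := A.submatrix (↑) (↑)
  have hB : B.IsHermitian := hA.submatrix _
  let E := EigenBasis.ofHermitian hB
  have : Nonempty S := hS.to_subtype
  obtain ⟨i, hi⟩ := Finite.exists_min E.val
  let ext : (S → ℂ) → Ω → ℂ := fun v σ => if h : σ ∈ S then v ⟨σ, h⟩ else 0
  have hsum : ∀ f : Ω → ℂ, (∀ σ ∉ S, f σ = 0) → ∑ σ, f σ = ∑ σ : S, f σ := by
    intro f hf
    rw [← Finset.sum_subtype (Finset.univ.filter (· ∈ S)) (by simp) f]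
    exact (Finset.sum_filter_of_ne fun σ _ hσ => by by_contra h; exact hσ (hf σ h)).symm
  have hmul : ∀ (φ : Ω → ℂ), (∀ σ ∉ S, φ σ = 0) → ∀ σ : S,
      (A *ᵥ φ) σ = (B *ᵥ fun τ : S => φ τ) σ := by
    intro φ hφ σ
    simp only [mulVec, dotProduct]
    rw [hsum _ fun τ hτ => by rw [hφ τ hτ, mul_zero]]
    rfl
  have hn : ∀ (φ : Ω → ℂ), (∀ σ ∉ S, φ σ = 0) → nsq φ = nsq fun τ : S => φ τ := by
    intro φ hφ
    have := hsum (fun σ => (‖φ σ‖ ^ 2 : ℝ)) fun σ hσ => by simp [hφ σ hσ]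
    exact_mod_cast this
  have hf : ∀ (φ : Ω → ℂ), (∀ σ ∉ S, φ σ = 0) → form A φ = form B fun τ : S => φ τ := by
    intro φ hφ
    simp only [form, dotProduct]
    rw [hsum _ fun τ hτ => by simp [hφ τ hτ]]
    congr 1
    refine Finset.sum_congr rfl fun σ _ => ?_
    rw [hmul φ hφ σ]; rfl
  have h0 : ∀ v : S → ℂ, ∀ σ ∉ S, ext v σ = 0 := fun v σ hσ => by simp [ext, hσ]
  have hr : ∀ v : S → ℂ, (fun τ : S => ext v τ) = v := fun v => by
    funext τ; simp [ext]
  refine ⟨E.val i, ext (E.vec i), h0 _, ?_, ?_, ?_⟩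
  · rw [hn _ (h0 _), hr, E.nsq_vec]
  · intro σ hσ
    have := hmul _ (h0 (E.vec i)) ⟨σ, hσ⟩
    rw [hr, E.eig] at this
    rw [this]; simp [ext, hσ]
  · intro φ hφ
    rw [hn φ hφ, hf φ hφ, E.form_eq, E.nsq_eq, Finset.mul_sum]
    exact Finset.sum_le_sum fun j _ => by gcongr; exact hi j

end Forms

/-! ## Gapped low-lying sectors -/

section LowSector

variable {Ω : Type} [Fintype Ω] [DecidableEq Ω]

/-- `P` projects onto the eigenvectors with index in `idx`; their eigenvalues have maximum `m`, and
all other eigenvalues are at least `m + g`. -/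
structure LowSector (A P : Matrix Ω Ω ℂ) (m g : ℝ) extends EigenBasis A where
  /-- the indices of the low-lying eigenvectors -/
  idx : Finset Ω
  proj_mem : ∀ i ∈ idx, P *ᵥ vec i = vec i
  proj_not_mem : ∀ i ∉ idx, P *ᵥ vec i = 0
  val_le : ∀ i ∈ idx, val i ≤ m
  le_val : ∀ i ∉ idx, m + g ≤ val i
  attained : ∃ i ∈ idx, val i = m
  card_idx : idx.card = P.rank

/-- The low-lying sector of a Hermitian matrix determined by a spectral projection. -/
lemma exists_lowSector {A P : Matrix Ω Ω ℂ} {g : ℝ} {σin : Set ℝ} (hA : A.IsHermitian)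
    (hσ : IsGappedLowSector A g σin) (hP : IsSpectralProjection A σin P) (h0 : 0 < P.rank) :
    ∃ m : ℝ, Nonempty (LowSector A P m g) := by
  classical
  let E := EigenBasis.ofHermitian hA
  have hspec : ∀ i, E.val i ∈ spectrum ℝ A := fun i => hA.eigenvalues_mem_spectrum_real i
  let I : Finset Ω := Finset.univ.filter fun i => E.val i ∈ σin
  have hmem : ∀ i ∈ I, P *ᵥ E.vec i = E.vec i := by
    intro i hi
    have h1 : E.vec i ∈ LinearMap.range (Matrix.toLin' P) := by
      rw [hP.range_eq]
      refine Submodule.mem_iSup_of_mem (E.val i) (Submodule.mem_iSup_of_mem (by simpa [I] using hi) ?_)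
      rw [Module.End.mem_eigenspace_iff, Matrix.toLin'_apply, E.eig]
    obtain ⟨w, hw⟩ := h1
    rw [Matrix.toLin'_apply] at hw
    rw [← hw, mulVec_mulVec, hP.idempotent]
  have hPs : Pᴴ = P := hP.selfAdjoint
  have hnot : ∀ i ∉ I, P *ᵥ E.vec i = 0 := by
    intro i hi
    have hi' : E.val i ∉ σin := by simpa [I] using hi
    -- Eigenvectors of a Hermitian matrix for different eigenvalues are orthogonal.
    have key : ∀ w ∈ LinearMap.range (Matrix.toLin' P), star (E.vec i) ⬝ᵥ w = 0 := by
      intro w hw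
      rw [hP.range_eq] at hw
      let K : Submodule ℂ (Ω → ℂ) :=
        { carrier := {w | star (E.vec i) ⬝ᵥ w = 0}
          add_mem' := fun {a b} ha hb => by
            simp only [Set.mem_ofPred_eq] at *; rw [dotProduct_add, ha, hb, add_zero]
          zero_mem' := by simp
          smul_mem' := fun c x hx => by
            simp only [Set.mem_ofPred_eq] at *; rw [dotProduct_smul, hx, smul_zero] }
      have : (⨆ a ∈ σin, Module.End.eigenspace (Matrix.toLin' A) (a : ℂ)) ≤ K := by
        refine iSup₂_le fun a ha x hx => ?_
        rw [Module.End.mem_eigenspace_iff, Matrix.toLin'_apply] at hx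
        have h1 := E.coef_mulVec x i
        rw [hx, E.coef_smul] at h1
        have h2 : ((a : ℂ) - E.val i) * E.coef x i = 0 := by rw [sub_mul, h1, sub_self]
        rcases mul_eq_zero.1 h2 with h3 | h3
        · exfalso
          apply hi'
          have : a = E.val i := by exact_mod_cast sub_eq_zero.1 h3
          rwa [← this]
        · exact h3
      exact this hw
    have h1 := key (P *ᵥ (P *ᵥ E.vec i)) ⟨P *ᵥ E.vec i, rfl⟩
    have h2 : star (P *ᵥ E.vec i) ⬝ᵥ (P *ᵥ E.vec i) = 0 := by
      rw [star_mulVec, ← dotProduct_mulVec, hPs]; exact h1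
    rw [star_dotProduct_self] at h2
    exact nsq_eq_zero.1 (by exact_mod_cast h2)
  have hcard : I.card = P.rank := by
    have hr : LinearMap.range (Matrix.toLin' P) = Submodule.span ℂ (Set.range fun i : I => E.vec i) := by
      apply le_antisymm
      · rintro _ ⟨w, rfl⟩
        rw [Matrix.toLin'_apply]
        rw [E.expand w, mulVec_sum]
        refine Submodule.sum_mem _ fun i _ => ?_
        rw [mulVec_smul]
        refine Submodule.smul_mem _ _ ?_
        by_cases hi : i ∈ I
        · rw [hmem i hi]; exact Submodule.subset_span ⟨⟨i, hi⟩, rfl⟩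
        · rw [hnot i hi]; exact Submodule.zero_mem _
      · rw [Submodule.span_le]
        rintro _ ⟨i, rfl⟩
        exact ⟨E.vec i, by rw [Matrix.toLin'_apply]; exact hmem i i.2⟩
    have hli : LinearIndependent ℂ fun i : I => E.vec i := by
      rw [Fintype.linearIndependent_iff]
      intro c hc i
      have := congrArg (fun v => star (E.vec i) ⬝ᵥ v) hc
      simp only [dotProduct_sum, dotProduct_smul, E.orth, dotProduct_zero] at this
      simpa [Subtype.coe_inj] using this
    rw [Matrix.rank, ← Matrix.toLin'_apply', hr, finrank_span_eq_card hli, Fintype.card_coe]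
  have hne : I.Nonempty := by
    rw [← Finset.card_pos, hcard]; exact h0
  obtain ⟨i, hi, him⟩ := I.exists_max_image E.val hne
  refine ⟨E.val i, ⟨{ E with
    idx := I
    proj_mem := hmem
    proj_not_mem := hnot
    val_le := fun j hj => him j hj
    le_val := fun j hj => hσ.2 _ (by simpa [I] using hi) _ ⟨hspec j, by simpa [I] using hj⟩
    attained := ⟨i, hi, rfl⟩
    card_idx := hcard }⟩⟩

namespace LowSector

variable {A P : Matrix Ω Ω ℂ} {m g : ℝ}

lemma proj_eq (E : LowSector A P m g) (v : Ω → ℂ) : P *ᵥ v = ∑ i ∈ E.idx, E.coef v i • E.vec i := by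
  conv_lhs => rw [E.expand v, mulVec_sum]
  rw [← Finset.sum_subset (Finset.subset_univ E.idx)]
  · refine Finset.sum_congr rfl fun i hi => ?_
    rw [mulVec_smul, E.proj_mem i hi]; rfl
  · intro i _ hi
    rw [mulVec_smul, E.proj_not_mem i hi, smul_zero]

lemma coef_proj (E : LowSector A P m g) (v : Ω → ℂ) (i : Ω) : E.coef (P *ᵥ v) i = if i ∈ E.idx then E.coef v i else 0 := by
  have : P *ᵥ v = ∑ j, (if j ∈ E.idx then E.coef v j else 0) • E.vec j := by
    rw [E.proj_eq]
    simp [ite_smul, Finset.sum_ite_mem]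
  rw [this, E.coef_sum]

lemma coef_eq_zero_of_proj_eq_self (E : LowSector A P m g) {v : Ω → ℂ} (hv : P *ᵥ v = v) {i : Ω} (hi : i ∉ E.idx) :
    E.coef v i = 0 := by
  rw [← hv, E.coef_proj, if_neg hi]

lemma form_le (E : LowSector A P m g) {v : Ω → ℂ} (hv : P *ᵥ v = v) : form A v ≤ m * nsq v := by
  rw [E.form_eq, E.nsq_eq, Finset.mul_sum]
  refine Finset.sum_le_sum fun i _ => ?_
  by_cases hi : i ∈ E.idx
  · gcongr; exact E.val_le i hi
  · rw [E.coef_eq_zero_of_proj_eq_self hv hi]; simp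

lemma le_form (E : LowSector A P m g) {v : Ω → ℂ} (hv : ∀ i ∈ E.idx, E.coef v i = 0) : (m + g) * nsq v ≤ form A v := by
  rw [E.form_eq, E.nsq_eq, Finset.mul_sum]
  refine Finset.sum_le_sum fun i _ => ?_
  by_cases hi : i ∈ E.idx
  · rw [hv i hi]; simp
  · gcongr; exact E.le_val i hi

lemma coef_eq_zero_of_proj_eq_zero (E : LowSector A P m g) {v : Ω → ℂ} (hv : P *ᵥ v = 0) {i : Ω} (hi : i ∈ E.idx) :
    E.coef v i = 0 := by
  have := E.coef_proj v i
  rw [hv, if_pos hi] at this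
  rw [← this]; exact dotProduct_zero _

lemma le_form' (E : LowSector A P m g) {v : Ω → ℂ} (hv : P *ᵥ v = 0) : (m + g) * nsq v ≤ form A v :=
  E.le_form fun _ hi => E.coef_eq_zero_of_proj_eq_zero hv hi

lemma comm (E : LowSector A P m g) : A * P = P * A := by
  refine Matrix.toLin'.injective (LinearMap.ext fun v => ?_)
  simp only [Matrix.toLin'_apply, ← mulVec_mulVec]
  refine E.ext_coef fun i => ?_
  rw [E.coef_mulVec, E.coef_proj, E.coef_proj, E.coef_mulVec]
  split_ifs <;> simp

/-- In the middle of the gap, `A - e` is bounded below by half of the gap. -/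
lemma gap_le_residual (E : LowSector A P m g) {e : ℝ} (he : e = m + g / 2) (hg : 0 ≤ g) (v : Ω → ℂ) :
    (g / 2) ^ 2 * nsq v ≤ nsq (A *ᵥ v - (e : ℂ) • v) := by
  rw [E.nsq_eq, E.nsq_eq, Finset.mul_sum]
  refine Finset.sum_le_sum fun i _ => ?_
  have : E.coef (A *ᵥ v - (e : ℂ) • v) i = ((E.val i - e : ℝ) : ℂ) * E.coef v i := by
    rw [E.coef_sub, E.coef_mulVec, E.coef_smul]; push_cast; ring
  rw [this, norm_mul, mul_pow, Complex.norm_real, Real.norm_eq_abs, sq_abs]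
  gcongr 1
  rw [← sq_abs (E.val i - e)]
  refine pow_le_pow_left₀ (by positivity) ?_ 2
  by_cases hi : i ∈ E.idx
  · have := E.val_le i hi
    rw [abs_of_nonpos (by linarith)]; linarith
  · have := E.le_val i hi
    rw [abs_of_nonneg (by linarith)]; linarith

/-- Weyl's inequality for the top of the low-lying sector. -/
lemma top_le (E : LowSector A P m g) {A' P' : Matrix Ω Ω ℂ} {m' : ℝ} (E' : LowSector A' P' m' g) (hg : 0 ≤ g)
    (hr : P.rank = P'.rank) : m' ≤ m + ‖A' - A‖ := by
  obtain ⟨i₀, hi₀, hm⟩ := E'.attained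
  -- By equality of ranks the low space of `A` has one dimension more than the low eigenvectors of
  -- `A'` other than a top one. A vector of the former orthogonal to the latter has `A`-energy at
  -- most `m` and `A'`-energy at least `m'`.
  have hc : (E'.idx.erase i₀).card < Fintype.card E.idx := by
    rw [Fintype.card_coe, E.card_idx, hr, ← E'.card_idx]
    exact Finset.card_erase_lt_of_mem hi₀
  obtain ⟨z, hz, hk⟩ := E'.exists_combination (fun i : E.idx => E.vec i) _ hc
  set v := ∑ i : E.idx, z i • E.vec i with hv
  have hcoef : ∀ i : E.idx, E.coef v i = z i := by
    intro i
    rw [EigenBasis.coef, hv, dotProduct_sum]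
    simp [dotProduct_smul, E.orth]
  have hv0 : v ≠ 0 := by
    intro h
    apply hz
    ext i
    rw [← hcoef i, h]; exact dotProduct_zero _
  have hPv : P *ᵥ v = v := by
    rw [hv, mulVec_sum]
    exact Finset.sum_congr rfl fun i _ => by rw [mulVec_smul, E.proj_mem i i.2]
  have h1 := E.form_le hPv
  have h2 : m' * nsq v ≤ form A' v := by
    rw [E'.form_eq, E'.nsq_eq, Finset.mul_sum]
    refine Finset.sum_le_sum fun i _ => ?_
    by_cases hi : i ∈ E'.idx
    · by_cases hi' : i = i₀
      · rw [hi', hm]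
      · rw [hk i (Finset.mem_erase.2 ⟨hi', hi⟩)]; simp
    · gcongr
      linarith [E'.le_val i hi]
  have h3 := abs_form_le (A' - A) v
  rw [form_sub] at h3
  have h4 := (abs_le.1 h3).2
  have h5 := nsq_pos hv0
  nlinarith

end LowSector

end LowSector

/-! ## Smoothness of gapped spectral projections -/

section SpectralFlow

variable {Ω : Type} [Fintype Ω] [DecidableEq Ω]

/-- The orthogonal projection `P` commutes with `A`, and splits its spectrum at `t` with a gap of
size `g` around `t`. -/
structure SplitsAt (A P : Matrix Ω Ω ℂ) (t g : ℝ) : Prop where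
  proj_herm : Pᴴ = P
  idem : P * P = P
  comm : A * P = P * A
  herm : Aᴴ = A
  form_le : ∀ v, P *ᵥ v = v → form A v ≤ (t - g / 2) * nsq v
  le_form : ∀ v, P *ᵥ v = 0 → (t + g / 2) * nsq v ≤ form A v

/-- The squared Frobenius norm. -/
noncomputable def frob (X : Matrix Ω Ω ℂ) : ℝ := ∑ j, nsq (X.col j)

lemma frob_nonneg (X : Matrix Ω Ω ℂ) : 0 ≤ frob X := Finset.sum_nonneg fun _ _ => nsq_nonneg _

lemma frob_conjTranspose (X : Matrix Ω Ω ℂ) : frob Xᴴ = frob X := by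
  simp only [frob, nsq, Matrix.col_apply, conjTranspose_apply, norm_star]
  exact Finset.sum_comm

lemma frob_le (X : Matrix Ω Ω ℂ) : frob X ≤ Fintype.card Ω * ‖X‖ ^ 2 := by
  have h : ∀ j, nsq (X.col j) ≤ ‖X‖ ^ 2 := fun j => by
    have := nsq_mulVec_le X (Pi.single j 1)
    rw [mulVec_single_one] at this
    have h1 : nsq (Pi.single j 1 : Ω → ℂ) = 1 := by
      simp [nsq, Pi.single_apply, apply_ite]
    rwa [h1, mul_one] at this
  calc frob X ≤ ∑ _j : Ω, ‖X‖ ^ 2 := Finset.sum_le_sum fun j _ => h j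
    _ = _ := by simp

lemma sq_norm_le_frob (X : Matrix Ω Ω ℂ) : ‖X‖ ^ 2 ≤ frob X := by
  have h : ‖X‖ ≤ √(frob X) := by
    refine opNorm_le_of_nsq X (Real.sqrt_nonneg _) fun v => ?_
    rw [Real.sq_sqrt (frob_nonneg X), ← frob_conjTranspose, frob, Finset.sum_mul]
    refine Finset.sum_le_sum fun i _ => ?_
    have h1 : (X *ᵥ v) i = star (Xᴴ.col i) ⬝ᵥ v := by
      simp [mulVec, dotProduct]
    rw [h1]
    have h2 := norm_dotProduct_le (Xᴴ.col i) v
    calc _ ≤ (√(nsq (Xᴴ.col i)) * √(nsq v)) ^ 2 := by gcongr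
      _ = _ := by rw [mul_pow, Real.sq_sqrt (nsq_nonneg _), Real.sq_sqrt (nsq_nonneg _)]
  calc ‖X‖ ^ 2 ≤ √(frob X) ^ 2 := by gcongr
    _ = _ := Real.sq_sqrt (frob_nonneg X)

lemma trace_form (A X : Matrix Ω Ω ℂ) : (trace (Xᴴ * (A * X))).re = ∑ j, form A (X.col j) := by
  simp only [trace, form, diag_apply, Complex.re_sum]
  rfl

lemma abs_trace_le (X Y : Matrix Ω Ω ℂ) : |(trace (Xᴴ * Y)).re| ≤ √(frob X) * √(frob Y) := by
  have h1 : (trace (Xᴴ * Y)) = ∑ j, star (X.col j) ⬝ᵥ Y.col j := by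
    simp only [trace, diag_apply]; rfl
  calc |(trace (Xᴴ * Y)).re| ≤ ‖trace (Xᴴ * Y)‖ := Complex.abs_re_le_norm _
    _ ≤ ∑ j, ‖star (X.col j) ⬝ᵥ Y.col j‖ := by rw [h1]; exact norm_sum_le _ _
    _ ≤ ∑ j, √(nsq (X.col j)) * √(nsq (Y.col j)) :=
        Finset.sum_le_sum fun j _ => norm_dotProduct_le _ _
    _ ≤ √(∑ j, nsq (X.col j)) * √(∑ j, nsq (Y.col j)) :=
        Real.sum_sqrt_mul_sqrt_le _ (fun _ => nsq_nonneg _) (fun _ => nsq_nonneg _)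

lemma nsq_proj_le {P : Matrix Ω Ω ℂ} (hP : Pᴴ = P) (hi : P * P = P) (v : Ω → ℂ) :
    nsq (P *ᵥ v) ≤ nsq v := by
  have h1 : star (P *ᵥ v) ⬝ᵥ (P *ᵥ v) = star v ⬝ᵥ (P *ᵥ v) := by
    rw [star_mulVec, ← dotProduct_mulVec, hP, mulVec_mulVec, hi]
  have h2 := norm_dotProduct_le v (P *ᵥ v)
  rw [← h1, star_dotProduct_self, Complex.norm_real, Real.norm_of_nonneg (nsq_nonneg _)] at h2
  by_contra! h
  have h3 : 0 < √(nsq (P *ᵥ v)) := Real.sqrt_pos.2 (lt_of_le_of_lt (nsq_nonneg v) h)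
  have h4 : √(nsq v) < √(nsq (P *ᵥ v)) := Real.sqrt_lt_sqrt (nsq_nonneg v) h
  have h5 := Real.mul_self_sqrt (nsq_nonneg (P *ᵥ v))
  nlinarith

lemma frob_proj_mul_le {P : Matrix Ω Ω ℂ} (hP : Pᴴ = P) (hi : P * P = P) (X : Matrix Ω Ω ℂ) :
    frob (P * X) ≤ frob X :=
  Finset.sum_le_sum fun j _ => nsq_proj_le hP hi (X.col j)

lemma frob_mul_proj_le {P : Matrix Ω Ω ℂ} (hP : Pᴴ = P) (hi : P * P = P) (X : Matrix Ω Ω ℂ) :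
    frob (X * P) ≤ frob X := by
  rw [← frob_conjTranspose, conjTranspose_mul, hP, ← frob_conjTranspose X]
  exact frob_proj_mul_le hP hi _

namespace SplitsAt

variable {A P A' P' : Matrix Ω Ω ℂ} {t t' g : ℝ}

/-- Coercivity of the Sylvester operator between the upper part of `A'` and the lower part of
`A`. -/
lemma sylvester (h : SplitsAt A P t g) (h' : SplitsAt A' P' t' g) {X : Matrix Ω Ω ℂ}
    (h0 : P' * X = 0) (h1 : X * P = X) :
    (g + t' - t) * frob X ≤ (trace (Xᴴ * (A' * X - X * A))).re := by
  have e1 : (t' + g / 2) * frob X ≤ (trace (Xᴴ * (A' * X))).re := by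
    rw [trace_form, frob, Finset.mul_sum]
    refine Finset.sum_le_sum fun j _ => h'.le_form _ ?_
    ext i; exact congrFun (congrFun h0 i) j
  -- Here `P` acts from the right, so the upper bound is applied to the columns of `Xᴴ`.
  have e2 : (trace (Xᴴ * (X * A))).re ≤ (t - g / 2) * frob X := by
    have h2 : trace (Xᴴ * (X * A)) = trace (Xᴴᴴ * (A * Xᴴ)) := by
      rw [trace_mul_comm, conjTranspose_conjTranspose, Matrix.mul_assoc]
    rw [h2, trace_form, ← frob_conjTranspose, frob, Finset.mul_sum]
    refine Finset.sum_le_sum fun j _ => h.form_le _ ?_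
    have h3 : P * Xᴴ = Xᴴ := by
      rw [← h.proj_herm, ← conjTranspose_mul, h1]
    ext i; exact congrFun (congrFun h3 i) j
  rw [Matrix.mul_sub, trace_sub, Complex.sub_re]
  linarith

/-- A bound of Davis–Kahan type: for `X = (1 - P') * P` the Sylvester expression `A' * X - X * A` is
the compressed difference `(1 - P') * (A' - A) * P`, and coercivity turns its size into a bound on
`X`. The Frobenius norm makes the trace pairing available. The dimension factor it costs is
harmless, as only continuity is inferred from it. -/
lemma frob_le (h : SplitsAt A P t g) (h' : SplitsAt A' P' t' g)
    (ht : t - t' ≤ g / 2) : (g / 2) * √(frob ((1 - P') * P)) ≤ √(frob (A' - A)) := by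
  set X := (1 - P') * P with hX
  have h0 : P' * X = 0 := by
    rw [hX, ← Matrix.mul_assoc, Matrix.mul_sub, h'.idem, Matrix.mul_one, sub_self, Matrix.zero_mul]
  have h1 : X * P = X := by rw [hX, Matrix.mul_assoc, h.idem]
  have h2 := sylvester h h' h0 h1
  have h3 : A' * X - X * A = (1 - P') * (A' - A) * P := by
    have e1 : A' * X = (1 - P') * A' * P := by
      rw [hX, ← Matrix.mul_assoc, Matrix.mul_sub, Matrix.sub_mul 1 P' A', h'.comm,
        Matrix.mul_one, Matrix.one_mul]
    have e2 : X * A = (1 - P') * A * P := by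
      rw [hX, Matrix.mul_assoc, ← h.comm, ← Matrix.mul_assoc]
    rw [e1, e2, ← Matrix.sub_mul, ← Matrix.mul_sub]
  have hq : (1 - P')ᴴ = 1 - P' := by rw [conjTranspose_sub, h'.proj_herm, conjTranspose_one]
  have hqi : (1 - P') * (1 - P') = 1 - P' := by
    rw [Matrix.mul_sub, Matrix.mul_one, Matrix.sub_mul, h'.idem, Matrix.one_mul, sub_self, sub_zero]
  have h4 : frob (A' * X - X * A) ≤ frob (A' - A) := by
    rw [h3]
    exact (frob_mul_proj_le h.proj_herm h.idem _).trans (frob_proj_mul_le hq hqi _)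
  have h5 := (abs_le.1 (abs_trace_le X (A' * X - X * A))).2
  have h6 := Real.sqrt_le_sqrt h4
  have h7 := frob_nonneg X
  have h8 := Real.mul_self_sqrt h7
  rcases eq_or_lt_of_le (Real.sqrt_nonneg (frob X)) with h9 | h9
  · rw [← h9, mul_zero]; exact Real.sqrt_nonneg _
  · have : g / 2 * frob X ≤ √(frob X) * √(frob (A' - A)) := by
      calc g / 2 * frob X ≤ (g + t' - t) * frob X := by gcongr; linarith
        _ ≤ √(frob X) * √(frob (A' * X - X * A)) := h2.trans h5
        _ ≤ _ := by gcongr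
    refine le_of_mul_le_mul_left ?_ h9
    calc √(frob X) * (g / 2 * √(frob X)) = g / 2 * frob X := by rw [mul_left_comm, h8]
      _ ≤ _ := this

/-- Spectral projections depend continuously on the matrix. -/
lemma dist_le (h : SplitsAt A P t g) (h' : SplitsAt A' P' t' g) (hg : 0 < g)
    (ht : |t' - t| ≤ g / 2) : ‖P' - P‖ ≤ 4 / g * √(Fintype.card Ω) * ‖A' - A‖ := by
  have ht' := abs_le.1 ht
  have h1 := frob_le h h' (by linarith)
  have h2 := frob_le h' h (by linarith)
  have h3 : ∀ B : Matrix Ω Ω ℂ, √(frob B) ≤ √(Fintype.card Ω) * ‖B‖ := fun B => by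
    rw [← Real.sqrt_sq (norm_nonneg B), ← Real.sqrt_mul (by positivity)]
    exact Real.sqrt_le_sqrt (XYImpurity.frob_le B)
  have h4 : ∀ B : Matrix Ω Ω ℂ, ‖B‖ ≤ √(frob B) := fun B =>
    Real.le_sqrt_of_sq_le (sq_norm_le_frob B)
  have h5 := h3 (A' - A)
  have h6 := h3 (A - A')
  rw [norm_sub_rev] at h6
  -- The difference of two projections is made of the two mixed blocks, each bounded by `frob_le`.
  have e : P' - P = ((1 - P) * P')ᴴ - (1 - P') * P := by
    rw [conjTranspose_mul, conjTranspose_sub, h.proj_herm, h'.proj_herm, conjTranspose_one]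
    noncomm_ring
  have h7 : ‖P' - P‖ ≤ √(frob ((1 - P) * P')) + √(frob ((1 - P') * P)) := by
    rw [e]
    refine (norm_sub_le _ _).trans (add_le_add ?_ (h4 _))
    rw [l2_opNorm_conjTranspose]; exact h4 _
  rw [div_mul_eq_mul_div, div_mul_eq_mul_div, le_div_iff₀ hg]
  nlinarith

/-- Coercivity with both matrices equal gives injectivity of the Sylvester operator on off-diagonal
blocks. -/
lemma comm_eq_zero (h : SplitsAt A P t g) (hg : 0 < g) {X : Matrix Ω Ω ℂ}
    (h0 : P * X = 0) (h1 : X * P = X) (hc : A * X = X * A) : X = 0 := by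
  have h2 := sylvester h h h0 h1
  rw [hc, sub_self, Matrix.mul_zero, trace_zero, Complex.zero_re] at h2
  have h3 : frob X ≤ 0 := by
    have := frob_nonneg X
    by_contra! hh
    nlinarith
  have h4 := sq_norm_le_frob X
  have : ‖X‖ = 0 := by nlinarith [norm_nonneg X]
  exact norm_eq_zero.1 this

end SplitsAt

/-- The equation that determines the spectral projections of matrices near a given one. -/
noncomputable def projEq (P : Matrix Ω Ω ℂ) (u : Matrix Ω Ω ℂ × Matrix Ω Ω ℂ) : Matrix Ω Ω ℂ :=
  P * (u.1 * u.2 - u.2 * u.1) * (1 - P) + (1 - P) * (u.1 * u.2 - u.2 * u.1) * P +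
    P * (u.2 - u.2 * u.2) * P + (1 - P) * (u.2 - u.2 * u.2) * (1 - P)

lemma contDiff_projEq (P : Matrix Ω Ω ℂ) : ContDiff ℝ ∞ (projEq P) := by
  unfold projEq
  fun_prop

/-- The partial derivative of `projEq`. -/
noncomputable def projEqDeriv (A P Y : Matrix Ω Ω ℂ) : Matrix Ω Ω ℂ :=
  P * (A * Y - Y * A) * (1 - P) + (1 - P) * (A * Y - Y * A) * P +
    P * (Y - (P * Y + Y * P)) * P + (1 - P) * (Y - (P * Y + Y * P)) * (1 - P)

lemma fderiv_projEq (A P Y : Matrix Ω Ω ℂ) :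
    fderiv ℝ (projEq P) (A, P) (0, Y) = projEqDeriv A P Y := by
  have h1 : HasFDerivAt (projEq P) (fderiv ℝ (projEq P) (A, P)) (A, P) :=
    ((contDiff_projEq P).differentiable (by simp) _).hasFDerivAt
  have h2 : HasDerivAt (fun r : ℝ => (A, P + r • Y)) ((0 : Matrix Ω Ω ℂ), Y) 0 := by
    refine (hasDerivAt_const _ _).prodMk ?_
    simpa using ((hasDerivAt_id (0 : ℝ)).smul_const Y).const_add P
  have h3 : HasDerivAt (fun r : ℝ => projEq P (A, P + r • Y)) (fderiv ℝ (projEq P) (A, P) (0, Y)) 0 := by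
    have h1' : HasFDerivAt (projEq P) (fderiv ℝ (projEq P) (A, P))
        ((fun r : ℝ => (A, P + r • Y)) 0) := by simpa using h1
    exact h1'.comp_hasDerivAt (0 : ℝ) h2
  -- Along a line in the second variable `projEq` is a quadratic polynomial, so its derivative is
  -- the linear coefficient.
  have h4 : (fun r : ℝ => projEq P (A, P + r • Y)) = fun r : ℝ =>
      projEq P (A, P) + (r • projEqDeriv A P Y +
        (r * r) • (- (P * (Y * Y) * P) - (1 - P) * (Y * Y) * (1 - P))) := by
    funext r
    simp only [projEq, projEqDeriv, mul_smul, Matrix.mul_add, Matrix.add_mul, Matrix.mul_sub, Matrix.sub_mul,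
      Matrix.smul_mul, Matrix.mul_smul, smul_add, smul_sub, smul_neg]
    abel
  have h5 : HasDerivAt (fun r : ℝ => projEq P (A, P + r • Y)) (projEqDeriv A P Y) 0 := by
    rw [h4]
    have e1 := (hasDerivAt_id (0 : ℝ)).smul_const (projEqDeriv A P Y)
    have e2 := ((hasDerivAt_id (0 : ℝ)).mul (hasDerivAt_id (0 : ℝ))).smul_const
      (- (P * (Y * Y) * P) - (1 - P) * (Y * Y) * (1 - P))
    simpa using! (e1.add e2).const_add (projEq P (A, P))
  exact h3.unique h5

/-- The four blocks decouple. The off-diagonal ones see the Sylvester operator, which is injective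
by the gap; on the diagonal ones the linearization of `p - p * p` at `P` is `-1` on the range of `P`
and `+1` on its complement. -/
lemma SplitsAt.projEqDeriv_injective {A P : Matrix Ω Ω ℂ} {t g : ℝ} (h : SplitsAt A P t g)
    (hg : 0 < g) {Y : Matrix Ω Ω ℂ} (hY : projEqDeriv A P Y = 0) : Y = 0 := by
  obtain ⟨Q, hQ⟩ : ∃ Q, Q = 1 - P := ⟨_, rfl⟩
  have hPP := h.idem
  have hPQ : P * Q = 0 := by rw [hQ, mul_sub, mul_one, hPP, sub_self]
  have hQP : Q * P = 0 := by rw [hQ, sub_mul, one_mul, hPP, sub_self]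
  have hQQ : Q * Q = Q := by rw [hQ, mul_sub, mul_one, ← hQ, hQP, sub_zero]
  have hc := h.comm
  have hcQ : A * Q = Q * A := by rw [hQ, mul_sub, sub_mul, hc, mul_one, one_mul]
  have hQh : Qᴴ = Q := by rw [hQ, conjTranspose_sub, h.proj_herm, conjTranspose_one]
  have expand : ∀ S T : Matrix Ω Ω ℂ, S * projEqDeriv A P Y * T =
      (S * P) * (A * Y - Y * A) * (Q * T) + (S * Q) * (A * Y - Y * A) * (P * T) +
      (S * P) * (Y - (P * Y + Y * P)) * (P * T) +
      (S * Q) * (Y - (P * Y + Y * P)) * (Q * T) := by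
    intro S T
    rw [projEqDeriv, ← hQ]
    simp only [Matrix.mul_add, Matrix.add_mul, Matrix.mul_assoc]
  have d1 : P * (A * Y - Y * A) * Q = 0 := by
    have := expand P Q
    simpa [hY, hPP, hPQ, hQQ] using this.symm
  have d2 : Q * (A * Y - Y * A) * P = 0 := by
    have := expand Q P
    simpa [hY, hPP, hQP, hQQ] using this.symm
  have d3 : P * Y * P = 0 := by
    have := expand P P
    simp only [hY, hPP, hPQ, hQP, Matrix.mul_zero, Matrix.zero_mul, add_zero, mul_sub, sub_mul,
      mul_add, add_mul, ← mul_assoc] at this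
    rw [mul_assoc (P * Y) P P, hPP] at this
    simpa using this.symm
  have d4 : Q * Y * Q = 0 := by
    have := expand Q Q
    simp only [hY, hQQ, hPQ, hQP, Matrix.mul_zero, Matrix.zero_mul, add_zero, zero_add, mul_sub,
      sub_mul, mul_add, ← mul_assoc] at this
    rw [mul_assoc (Q * Y) P Q, hPQ] at this
    simpa using this.symm
  have d5 : Q * Y * P = 0 := by
    refine h.comm_eq_zero hg (by rw [← mul_assoc, ← mul_assoc, hPQ, zero_mul, zero_mul])
      (by rw [mul_assoc, hPP]) ?_
    rw [mul_sub, sub_mul, sub_eq_zero] at d2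
    calc A * (Q * Y * P) = Q * (A * Y) * P := by
          rw [← mul_assoc, ← mul_assoc, hcQ, mul_assoc Q A Y]
      _ = Q * (Y * A) * P := d2
      _ = Q * Y * P * A := by
          rw [mul_assoc (Q * Y), ← hc, ← mul_assoc, ← mul_assoc]
  -- `Y` is not assumed Hermitian; taking adjoints moves this block to the position treated by
  -- `comm_eq_zero`.
  have d6 : (P * Y * Q)ᴴ = 0 := by
    have e : (P * Y * Q)ᴴ = Q * Yᴴ * P := by
      rw [conjTranspose_mul, conjTranspose_mul, h.proj_herm, hQh, mul_assoc]
    rw [e]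
    refine h.comm_eq_zero hg (by rw [← mul_assoc, ← mul_assoc, hPQ, zero_mul, zero_mul])
      (by rw [mul_assoc, hPP]) ?_
    have d7 := congrArg conjTranspose d1
    rw [conjTranspose_mul, conjTranspose_mul, h.proj_herm, hQh, conjTranspose_sub,
      conjTranspose_mul, conjTranspose_mul, h.herm, conjTranspose_zero, sub_mul, mul_sub,
      sub_eq_zero] at d7
    calc A * (Q * Yᴴ * P) = Q * ((A * Yᴴ) * P) := by
          rw [← mul_assoc, ← mul_assoc, hcQ, mul_assoc Q A, mul_assoc Q]
      _ = Q * ((Yᴴ * A) * P) := d7.symm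
      _ = Q * Yᴴ * P * A := by
          rw [mul_assoc (Q * Yᴴ), ← hc, ← mul_assoc, ← mul_assoc, ← mul_assoc]
  have d8 : P * Y * Q = 0 := by
    rw [← conjTranspose_conjTranspose (P * Y * Q), d6, conjTranspose_zero]
  have hPQ1 : P + Q = 1 := by rw [hQ]; abel
  calc Y = (P + Q) * Y * (P + Q) := by rw [hPQ1, one_mul, mul_one]
    _ = P * Y * P + Q * Y * P + (P * Y * Q + Q * Y * Q) := by
      simp only [Matrix.mul_add, Matrix.add_mul]
    _ = 0 := by rw [d3, d4, d5, d8]; simp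

lemma fderiv_projEq_isInvertible {A P : Matrix Ω Ω ℂ} {t g : ℝ} (h : SplitsAt A P t g)
    (hg : 0 < g) :
    (fderiv ℝ (projEq P) (A, P) ∘L .inr ℝ (Matrix Ω Ω ℂ) (Matrix Ω Ω ℂ)).IsInvertible := by
  set D := fderiv ℝ (projEq P) (A, P) ∘L .inr ℝ (Matrix Ω Ω ℂ) (Matrix Ω Ω ℂ) with hD
  have hinj : Function.Injective D := by
    rw [injective_iff_map_eq_zero]
    intro Y hY
    refine h.projEqDeriv_injective hg ?_
    rw [← fderiv_projEq]
    exact hY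
  let e := (LinearEquiv.ofInjectiveEndo (D : Matrix Ω Ω ℂ →ₗ[ℝ] Matrix Ω Ω ℂ) hinj).toContinuousLinearEquiv
  refine ⟨e, ?_⟩
  ext1 Y
  rfl

/-- Spectral projections of a smooth path of matrices with a gap are smooth. -/
theorem contDiffOn_proj {A P : ℝ → Matrix Ω Ω ℂ} {t : ℝ → ℝ} {g : ℝ} {I : Set ℝ} (hg : 0 < g)
    (hA : ContDiffOn ℝ ∞ A I) (ht : ContinuousOn t I)
    (h : ∀ s ∈ I, SplitsAt (A s) (P s) (t s) g) : ContDiffOn ℝ ∞ P I := by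
  intro s hs
  have : CompleteSpace (Matrix Ω Ω ℂ) := FiniteDimensional.complete ℝ _
  -- Continuity comes first: the implicit function theorem identifies solutions only near `(A s, P
  -- s)`.
  have hPc : ContinuousWithinAt P I s := by
    rw [ContinuousWithinAt, tendsto_iff_norm_sub_tendsto_zero]
    have h1 : Filter.Tendsto (fun s' => 4 / g * √(Fintype.card Ω) * ‖A s' - A s‖)
        (nhdsWithin s I) (nhds 0) := by
      have := (tendsto_iff_norm_sub_tendsto_zero.1 (hA.continuousOn s hs)).const_mul
        (4 / g * √(Fintype.card Ω))
      simpa using this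
    refine squeeze_zero' (Filter.Eventually.of_forall fun _ => norm_nonneg _) ?_ h1
    have h2 : ∀ᶠ s' in nhdsWithin s I, |t s' - t s| < g / 2 := by
      have := Metric.tendsto_nhds.1 (ht s hs) (g / 2) (by positivity)
      simpa [Real.dist_eq] using this
    filter_upwards [h2, self_mem_nhdsWithin] with s' hs' hsI
    exact (h s hs).dist_le (h s' hsI) hg hs'.le
  have cdf : ContDiffAt ℝ ∞ (projEq (P s)) (A s, P s) := (contDiff_projEq (P s)).contDiffAt
  have hinv := fderiv_projEq_isInvertible (h s hs) hg
  have hn : (∞ : WithTop ℕ∞) ≠ 0 := by simp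
  have hiff := cdf.eventually_apply_eq_iff_implicitFunction hn hinv
  have htend : Filter.Tendsto (fun s' => (A s', P s')) (nhdsWithin s I) (nhds (A s, P s)) :=
    (hA.continuousOn s hs).prodMk_nhds hPc
  -- The nearby projections solve the equation attached to `s`, because they commute with their
  -- matrix and are idempotent. They are therefore the implicit function composed with the smooth
  -- path `A`.
  have hz : ∀ s' ∈ I, projEq (P s) (A s', P s') = 0 := fun s' hs' => by
    simp [projEq, (h s' hs').comm, (h s' hs').idem]
  have heq : P =ᶠ[nhdsWithin s I] fun s' => cdf.implicitFunction hn hinv (A s') := by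
    filter_upwards [htend.eventually hiff, self_mem_nhdsWithin] with s' h1 hs'
    exact (h1.1 (by rw [hz s' hs', hz s hs])).symm
  refine ContDiffWithinAt.congr_of_eventuallyEq ?_ heq ?_
  · exact (cdf.contDiffAt_implicitFunction hn hinv).comp_contDiffWithinAt s (hA s hs)
  · exact (cdf.implicitFunction_apply_self hn hinv).symm

end SpectralFlow

/-! ## The flow of a smooth path of projections -/

section Flow

variable {Ω : Type} [Fintype Ω] [DecidableEq Ω]

/-- Truncating a linear vector field with this map makes it bounded and globally Lipschitz, so that
Picard–Lindelöf applies on the whole interval at once. -/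
lemma radial_lipschitz {E : Type*} [NormedAddCommGroup E] [NormedSpace ℝ E] (x y : E) :
    ‖(max 1 ‖x‖)⁻¹ • x - (max 1 ‖y‖)⁻¹ • y‖ ≤ 2 * ‖x - y‖ := by
  set a := max 1 ‖x‖ with ha
  set b := max 1 ‖y‖ with hb
  have ha1 : 1 ≤ a := le_max_left _ _
  have hb1 : 1 ≤ b := le_max_left _ _
  have hyb : ‖y‖ ≤ b := le_max_right _ _
  have hab : |b - a| ≤ ‖x - y‖ := by
    rw [norm_sub_rev]
    calc |b - a| ≤ |‖y‖ - ‖x‖| := by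
          have := abs_max_sub_max_le_max 1 ‖y‖ 1 ‖x‖
          simpa using this
      _ ≤ _ := abs_norm_sub_norm_le _ _
  have e : a⁻¹ • x - b⁻¹ • y = a⁻¹ • (x - y) + (a⁻¹ - b⁻¹) • y := by module
  have h1 : ‖a⁻¹ • (x - y)‖ ≤ ‖x - y‖ := by
    rw [norm_smul, Real.norm_of_nonneg (by positivity)]
    exact mul_le_of_le_one_left (norm_nonneg _) (inv_le_one_of_one_le₀ ha1)
  have h2 : ‖(a⁻¹ - b⁻¹) • y‖ ≤ ‖x - y‖ := by
    have h3 : a⁻¹ - b⁻¹ = (b - a) / (a * b) := by field_simp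
    rw [norm_smul, h3, Real.norm_eq_abs, abs_div, abs_of_pos (by positivity : 0 < a * b),
      div_mul_eq_mul_div, div_le_iff₀ (by positivity)]
    have : |b - a| * ‖y‖ ≤ ‖x - y‖ * b := by gcongr
    have h4 : 0 ≤ ‖x - y‖ * b := by positivity
    nlinarith
  rw [e]
  linarith [norm_add_le (a⁻¹ • (x - y)) ((a⁻¹ - b⁻¹) • y)]

/-- A smooth path of anti-Hermitian matrices generates a smooth path of unitaries. -/
theorem exists_unitary_path [Nonempty Ω] {K : ℝ → Matrix Ω Ω ℂ}
    (hK : ContDiffOn ℝ ∞ K (Set.Icc 0 1)) (hanti : ∀ s ∈ Set.Icc (0 : ℝ) 1, star (K s) = -K s) :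
    ∃ U : ℝ → Matrix Ω Ω ℂ, ContDiffOn ℝ ∞ U (Set.Icc 0 1) ∧ U 0 = 1 ∧
      (∀ s ∈ Set.Icc (0 : ℝ) 1, U s ∈ unitary (Matrix Ω Ω ℂ)) ∧
      ∀ s ∈ Set.Icc (0 : ℝ) 1, HasDerivWithinAt U (K s * U s) (Set.Icc 0 1) s := by
  have : CompleteSpace (Matrix Ω Ω ℂ) := FiniteDimensional.complete ℝ _
  obtain ⟨M, hM⟩ := isCompact_Icc.exists_bound_of_continuousOn hK.continuousOn
  have h01 : (0 : ℝ) ∈ Set.Icc (0 : ℝ) 1 := by simp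
  have hM0 : 0 ≤ M := (norm_nonneg _).trans (hM 0 h01)
  -- The truncation is inactive on the unit ball, where the solution will turn out to stay.
  let f : ℝ → Matrix Ω Ω ℂ → Matrix Ω Ω ℂ := fun s x => K s * ((max 1 ‖x‖)⁻¹ • x)
  obtain ⟨M', hM'⟩ : ∃ M' : NNReal, (M' : ℝ) = M := ⟨⟨M, hM0⟩, rfl⟩
  have hrad : ∀ x : Matrix Ω Ω ℂ, ‖(max 1 ‖x‖)⁻¹ • x‖ ≤ 1 := fun x => by
    rw [norm_smul, Real.norm_of_nonneg (by positivity), inv_mul_le_iff₀ (by positivity), mul_one]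
    exact le_max_right _ _
  have hPL : IsPicardLindelof f (⟨0, h01⟩ : Set.Icc (0 : ℝ) 1) 1 M' 0 M' (2 * M') := by
    refine ⟨fun s hs => ?_, fun x _ => ?_, fun s hs x _ => ?_, ?_⟩
    · refine (LipschitzWith.of_dist_le_mul fun x y => ?_).lipschitzOnWith
      rw [dist_eq_norm, dist_eq_norm, ← mul_sub]
      calc _ ≤ ‖K s‖ * ‖(max 1 ‖x‖)⁻¹ • x - (max 1 ‖y‖)⁻¹ • y‖ := norm_mul_le _ _
        _ ≤ M * (2 * ‖x - y‖) := by
            gcongr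
            · exact hM s hs
            · exact radial_lipschitz x y
        _ = _ := by rw [← hM']; push_cast; ring
    · exact hK.continuousOn.mul continuousOn_const
    · calc _ ≤ ‖K s‖ * ‖(max 1 ‖x‖)⁻¹ • x‖ := norm_mul_le _ _
        _ ≤ M * 1 := by gcongr; exacts [hM s hs, hrad x]
        _ = _ := by rw [hM', mul_one]
    · simp
  obtain ⟨U, hU0, hU⟩ := hPL.exists_eq_forall_mem_Icc_hasDerivWithinAt₀
  simp only at hU0
  -- The truncation only multiplies by a real scalar, so the generator is still anti-Hermitian and
  -- the solution is unitary. Its norm is then `1`, and it solves the untruncated equation.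
  have hstar : ∀ s ∈ Set.Icc (0 : ℝ) 1, star (U s) * U s = 1 := by
    have hd : ∀ s ∈ Set.Icc (0 : ℝ) 1,
        HasDerivWithinAt (fun s => star (U s) * U s) 0 (Set.Icc 0 1) s := by
      intro s hs
      have h1 := (hU s hs).star.mul (hU s hs)
      have e0 : (0 : Matrix Ω Ω ℂ) = star (f s (U s)) * U s + star (U s) * f s (U s) := by
        simp only [f, star_mul, star_smul, hanti s hs, star_trivial]
        simp [mul_assoc]
      rw [e0]
      exact h1
    have hc := constant_of_derivWithin_zero (f := fun s => star (U s) * U s) (a := 0) (b := 1)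
      (fun s hs => (hd s hs).differentiableWithinAt)
      (fun s hs => (hd s ⟨hs.1, hs.2.le⟩).derivWithin
        (uniqueDiffOn_Icc one_pos s ⟨hs.1, hs.2.le⟩))
    intro s hs
    have := hc s hs
    simpa [hU0] using this
  have hunit : ∀ s ∈ Set.Icc (0 : ℝ) 1, U s ∈ unitary (Matrix Ω Ω ℂ) := fun s hs =>
    Unitary.mem_iff.2 ⟨hstar s hs, mul_eq_one_comm.1 (hstar s hs)⟩
  have hder : ∀ s ∈ Set.Icc (0 : ℝ) 1, HasDerivWithinAt U (K s * U s) (Set.Icc 0 1) s := by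
    intro s hs
    have h1 := hU s hs
    have h2 : ‖U s‖ = 1 := CStarRing.norm_of_mem_unitary (hunit s hs)
    simpa [f, h2] using h1
  refine ⟨U, ?_, hU0, hunit, hder⟩
  refine ODE.contDiffOn_enat_Icc_of_hasDerivWithinAt (f := fun s x => K s * x) (u := Set.univ)
    (n := ⊤) ?_ hder (fun _ _ => Set.mem_univ _)
  exact (hK.comp contDiff_fst.contDiffOn (fun x hx => hx.1)).mul contDiff_snd.contDiffOn

/-- Spectral flow of a smooth path of projections. -/
theorem exists_spectralFlow [Nonempty Ω] {P : ℝ → Matrix Ω Ω ℂ}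
    (hP : ContDiffOn ℝ ∞ P (Set.Icc 0 1)) (hh : ∀ s ∈ Set.Icc (0 : ℝ) 1, star (P s) = P s)
    (hi : ∀ s ∈ Set.Icc (0 : ℝ) 1, P s * P s = P s) :
    ∃ G U : ℝ → Matrix Ω Ω ℂ,
      ContDiffOn ℝ ∞ G (Set.Icc 0 1) ∧ ContDiffOn ℝ ∞ U (Set.Icc 0 1) ∧ U 0 = 1 ∧
      ∀ s ∈ Set.Icc (0 : ℝ) 1, IsSelfAdjoint (G s) ∧ U s ∈ unitary (Matrix Ω Ω ℂ) ∧
        HasDerivWithinAt U (Complex.I • (G s * U s)) (Set.Icc 0 1) s ∧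
        P s = U s * P 0 * star (U s) := by
  have hud := uniqueDiffOn_Icc (zero_lt_one (α := ℝ))
  let P' : ℝ → Matrix Ω Ω ℂ := derivWithin P (Set.Icc 0 1)
  have hP' : ContDiffOn ℝ ∞ P' (Set.Icc 0 1) := hP.derivWithin hud (by simp)
  have hd : ∀ s ∈ Set.Icc (0 : ℝ) 1, HasDerivWithinAt P (P' s) (Set.Icc 0 1) s := fun s hs =>
    (hP.differentiableOn (by simp) s hs).hasDerivWithinAt
  have hP's : ∀ s ∈ Set.Icc (0 : ℝ) 1, star (P' s) = P' s := by
    intro s hs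
    have h1 := ((hd s hs).star).congr (f₁ := P) (fun x hx => (hh x hx).symm) (hh s hs).symm
    exact (hud s hs).eq_deriv _ h1 (hd s hs)
  have hsum : ∀ s ∈ Set.Icc (0 : ℝ) 1, P' s * P s + P s * P' s = P' s := by
    intro s hs
    have h1 := ((hd s hs).mul (hd s hs)).congr (f₁ := P) (fun x hx => (hi x hx).symm) (hi s hs).symm
    exact (hud s hs).eq_deriv _ h1 (hd s hs)
  -- Kato's generator `[P', P]`; it satisfies `[K, P] = P'`, which is what makes `star U * P * U`
  -- constant.
  let K : ℝ → Matrix Ω Ω ℂ := fun s => P' s * P s - P s * P' s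
  have hK : ContDiffOn ℝ ∞ K (Set.Icc 0 1) := (hP'.mul hP).sub (hP.mul hP')
  have hanti : ∀ s ∈ Set.Icc (0 : ℝ) 1, star (K s) = -K s := by
    intro s hs
    simp [K, star_sub, star_mul, hP's s hs, hh s hs]
  obtain ⟨U, hU, hU0, hunit, hder⟩ := exists_unitary_path hK hanti
  refine ⟨fun s => (-Complex.I) • K s, U, hK.const_smul _, hU, hU0, fun s hs =>
    ⟨?_, hunit s hs, ?_, ?_⟩⟩
  · rw [IsSelfAdjoint, star_smul, hanti s hs]
    simp
  · have := hder s hs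
    rw [smul_mul_assoc, smul_smul]
    simpa using this
  · have hc : star (U s) * P s * U s = P 0 := by
      have hd' : ∀ s ∈ Set.Icc (0 : ℝ) 1,
          HasDerivWithinAt (fun s => star (U s) * P s * U s) 0 (Set.Icc 0 1) s := by
        intro s hs
        have h1 := ((hder s hs).star.mul (hd s hs)).mul (hder s hs)
        -- The derivative of a path of projections is off-diagonal.
        have h2 : P s * P' s * P s = 0 := by
          have h3 := congrArg (fun X => P s * X) (hsum s hs)
          simp only [mul_add, ← mul_assoc, hi s hs] at h3
          simpa using h3
        have h4 : -(K s) * P s + P' s + P s * K s = 0 := by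
          have e1 : K s * P s = P' s * P s := by
            simp only [K, sub_mul]; rw [h2, mul_assoc, hi s hs, sub_zero]
          have e2 : P s * K s = - (P s * P' s) := by
            simp only [K, mul_sub]; rw [← mul_assoc, h2, ← mul_assoc, hi s hs, zero_sub]
          rw [neg_mul, e1, e2]
          nth_rewrite 2 [← hsum s hs]
          abel
        have h5 : (star (K s * U s) * P s + star (U s) * P' s) * U s + star (U s) * P s * (K s * U s)
            = star (U s) * (-(K s) * P s + P' s + P s * K s) * U s := by
          rw [star_mul, hanti s hs]; noncomm_ring
        have e0 : (0 : Matrix Ω Ω ℂ) =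
            (star (K s * U s) * P s + star (U s) * P' s) * U s + star (U s) * P s * (K s * U s) := by
          rw [h5, h4]; simp
        rw [e0]
        exact h1
      have hc := constant_of_derivWithin_zero (f := fun s => star (U s) * P s * U s) (a := 0)
        (b := 1) (fun s hs => (hd' s hs).differentiableWithinAt)
        (fun s hs => (hd' s ⟨hs.1, hs.2.le⟩).derivWithin (hud s ⟨hs.1, hs.2.le⟩)) s hs
      simpa [hU0] using hc
    have h2 := (Unitary.mem_iff.1 (hunit s hs)).2
    calc P s = (U s * star (U s)) * P s * (U s * star (U s)) := by rw [h2, one_mul, mul_one]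
      _ = U s * (star (U s) * P s * U s) * star (U s) := by noncomm_ring
      _ = _ := by rw [hc]

end Flow

/-! ## The hopping operators -/

section Hop

variable {V : Type} [Fintype V] [DecidableEq V]

/-- The exchange of the spins at `x` and `y` if they are different, with amplitude `1/2`. -/
noncomputable def hop (x y : V) : SpinOp V :=
  Matrix.of fun σ τ => if σ x ≠ σ y ∧ τ = σ ∘ Equiv.swap x y then 1 / 2 else 0

lemma siteOp_apply (v : V) (M : Matrix (Fin 2) (Fin 2) ℂ) (σ τ : V → Fin 2) :
    siteOp v M σ τ = if ∀ w, w ≠ v → σ w = τ w then M (σ v) (τ v) else 0 := by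
  simp [siteOp, embed]

lemma siteOp_mul_siteOp_apply {x y : V} (hxy : x ≠ y) (A B : Matrix (Fin 2) (Fin 2) ℂ)
    (σ τ : V → Fin 2) :
    (siteOp x A * siteOp y B) σ τ =
      if ∀ w, w ≠ x → w ≠ y → σ w = τ w then A (σ x) (τ x) * B (σ y) (τ y) else 0 := by
  rw [Matrix.mul_apply, Finset.sum_eq_single (Function.update σ x (τ x))]
  · rw [siteOp_apply, siteOp_apply, if_pos (fun w hw => by simp [hw])]
    by_cases h : ∀ w, w ≠ x → w ≠ y → σ w = τ w
    · rw [if_pos h, if_pos]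
      · simp [hxy.symm]
      · intro w hw
        by_cases hwx : w = x
        · subst hwx; simp
        · simpa [hwx] using h w hwx hw
    · rw [if_neg h, if_neg, mul_zero]
      intro h'
      apply h
      intro w hwx hwy
      simpa [hwx] using h' w hwy
  · intro ρ _ hρ
    rw [siteOp_apply, siteOp_apply]
    by_cases h1 : ∀ w, w ≠ x → σ w = ρ w
    · by_cases h2 : ∀ w, w ≠ y → ρ w = τ w
      · exfalso
        apply hρ
        funext w
        by_cases hwx : w = x
        · subst hwx; simpa using h2 w hxy
        · simpa [hwx] using (h1 w hwx).symm
      · rw [if_neg h2, mul_zero]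
    · rw [if_neg h1, zero_mul]
  · simp

lemma eq_comp_swap_iff {x y : V} (σ τ : V → Fin 2) :
    τ = σ ∘ Equiv.swap x y ↔ (∀ w, w ≠ x → w ≠ y → σ w = τ w) ∧ τ x = σ y ∧ τ y = σ x := by
  constructor
  · rintro rfl
    refine ⟨fun w hx hy => by simp [Equiv.swap_apply_of_ne_of_ne hx hy], by simp, by simp⟩
  · rintro ⟨h1, h2, h3⟩
    funext w
    by_cases hx : w = x
    · subst hx; simpa using h2
    · by_cases hy : w = y
      · subst hy; simpa using h3
      · simp [Equiv.swap_apply_of_ne_of_ne hx hy, h1 w hx hy]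

/-- In terms of ladder operators the left side is `(S⁺S⁻ + S⁻S⁺)/2`, which exchanges opposite spins
and kills equal ones. -/
lemma spin_exchange {x y : V} (hxy : x ≠ y) :
    siteOp x spin1 * siteOp y spin1 + siteOp x spin2 * siteOp y spin2 = hop x y := by
  ext σ τ
  rw [Matrix.add_apply, siteOp_mul_siteOp_apply hxy, siteOp_mul_siteOp_apply hxy]
  simp only [hop, of_apply, eq_comp_swap_iff]
  by_cases h : ∀ w, w ≠ x → w ≠ y → σ w = τ w
  · rw [if_pos h, if_pos h]
    have h' : (σ x ≠ σ y ∧ (∀ w, w ≠ x → w ≠ y → σ w = τ w) ∧ τ x = σ y ∧ τ y = σ x) ↔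
        (σ x ≠ σ y ∧ τ x = σ y ∧ τ y = σ x) := by tauto
    rw [if_congr h' rfl rfl]
    generalize σ x = a, σ y = b, τ x = c, τ y = d
    have hI : Complex.I * Complex.I = -1 := Complex.I_mul_I
    fin_cases a <;> fin_cases b <;> fin_cases c <;> fin_cases d <;>
      simp [spin1, spin2] <;> first
        | linear_combination (1 / 4 : ℂ) * hI
        | linear_combination (-1 / 4 : ℂ) * hI
  · rw [if_neg h, if_neg h]
    rw [if_neg fun h' => h h'.2.1, add_zero]

lemma hop_apply_comm (x y : V) (σ τ : V → Fin 2) : hop x y σ τ = hop x y τ σ := by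
  simp only [hop, of_apply]
  congr 1
  apply propext
  have key : ∀ σ τ : V → Fin 2, (σ x ≠ σ y ∧ τ = σ ∘ Equiv.swap x y) →
      (τ x ≠ τ y ∧ σ = τ ∘ Equiv.swap x y) := by
    rintro σ τ ⟨h1, rfl⟩
    refine ⟨by simpa using h1.symm, ?_⟩
    funext w; simp
  exact ⟨key σ τ, key τ σ⟩

lemma form_hop_eq_zero {x y : V} {w : (V → Fin 2) → ℂ}
    (h : ∀ σ, w σ ≠ 0 → w (σ ∘ Equiv.swap x y) ≠ 0 → σ x = σ y) : form (hop x y) w = 0 := by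
  rw [form_eq_sum]
  refine Finset.sum_eq_zero fun σ _ => Finset.sum_eq_zero fun τ _ => ?_
  simp only [hop, of_apply]
  split_ifs with h1
  · by_cases h2 : w σ = 0
    · simp [h2]
    · by_cases h3 : w τ = 0
      · simp [h3]
      · exact absurd (h σ h2 (h1.2 ▸ h3)) h1.1
  · simp

end Hop

/-! ### Geometry of the discrete torus -/

section Torus

variable {ν L : ℕ}

lemma torusDist_self (x : Torus ν L) : torusDist x x = 0 := by simp [torusDist]

lemma torusDist_comm (x y : Torus ν L) : torusDist x y = torusDist y x := by
  refine Finset.sum_congr rfl fun i _ => ?_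
  rw [← neg_sub, ZMod.natAbs_valMinAbs_neg]

lemma torusDist_triangle (x y z : Torus ν L) : torusDist x z ≤ torusDist x y + torusDist y z := by
  rw [torusDist, torusDist, torusDist, ← Finset.sum_add_distrib]
  refine Finset.sum_le_sum fun i _ => ?_
  have := ZMod.natAbs_valMinAbs_add_le (x i - y i) (y i - z i)
  rw [sub_add_sub_cancel] at this
  exact this.trans (Int.natAbs_add_le _ _)

lemma torusDist_le_of_adj {x y k : Torus ν L} (h : torusDist x y = 1) :
    torusDist x k ≤ torusDist y k + 1 := by
  have := torusDist_triangle x y k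
  omega

/-- A site has at most `2ν` nearest neighbours. -/
lemma card_neighbours_le [NeZero L] (x : Torus ν L) :
    (Finset.univ.filter fun y : Torus ν L => torusDist x y = 1).card ≤ 2 * ν := by
  classical
  let f : Fin ν × Bool → Torus ν L := fun p => x - Pi.single p.1 (if p.2 then 1 else -1)
  have hsub : (Finset.univ.filter fun y : Torus ν L => torusDist x y = 1) ⊆
      Finset.univ.image f := by
    intro y hy
    have hy : ∑ i, (x i - y i).valMinAbs.natAbs = 1 := (Finset.mem_filter.1 hy).2
    obtain ⟨i, hi⟩ : ∃ i, (x i - y i).valMinAbs.natAbs ≠ 0 := by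
      by_contra! h
      simp [h] at hy
    have h1 := Finset.add_sum_erase Finset.univ (fun i => (x i - y i).valMinAbs.natAbs)
      (Finset.mem_univ i)
    simp only [hy] at h1
    have h2 : ∑ j ∈ Finset.univ.erase i, (x j - y j).valMinAbs.natAbs = 0 := by omega
    have h3 : ∀ j, j ≠ i → x j - y j = 0 := fun j hj => by
      have := Finset.sum_eq_zero_iff.1 h2 j (Finset.mem_erase.2 ⟨hj, Finset.mem_univ _⟩)
      rwa [Int.natAbs_eq_zero, ZMod.valMinAbs_eq_zero] at this
    have h4 : (x i - y i).valMinAbs.natAbs = 1 := by omega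
    have h5 := ZMod.coe_valMinAbs (x i - y i)
    rw [Finset.mem_image]
    rcases Int.natAbs_eq_iff.1 h4 with h6 | h6
    · refine ⟨(i, true), Finset.mem_univ _, ?_⟩
      funext j
      by_cases hj : j = i
      · subst hj
        rw [h6] at h5
        simp only [f, Pi.sub_apply, Pi.single_eq_same, if_true]
        rw [sub_eq_iff_eq_add, ← sub_eq_iff_eq_add', ← h5]; simp
      · simpa [f, hj, sub_eq_zero] using h3 j hj
    · refine ⟨(i, false), Finset.mem_univ _, ?_⟩
      funext j
      by_cases hj : j = i
      · subst hj
        rw [h6] at h5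
        simp only [f, Pi.sub_apply, Pi.single_eq_same]
        rw [sub_eq_iff_eq_add, ← sub_eq_iff_eq_add', ← h5]; simp
      · simpa [f, hj, sub_eq_zero] using h3 j hj
  calc _ ≤ (Finset.univ.image f).card := Finset.card_le_card hsub
    _ ≤ (Finset.univ : Finset (Fin ν × Bool)).card := Finset.card_image_le
    _ = 2 * ν := by simp [mul_comm]

end Torus

/-! ## Localization formulas -/

section Localization

variable {Ω : Type} [Fintype Ω]

/-- Multiplication of a vector by a real function. -/
noncomputable def mulFn (f : Ω → ℝ) (v : Ω → ℂ) : Ω → ℂ := fun σ => (f σ : ℂ) * v σ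

lemma nsq_mulFn (f : Ω → ℝ) (v : Ω → ℂ) : nsq (mulFn f v) = ∑ σ, f σ ^ 2 * ‖v σ‖ ^ 2 := by
  simp [nsq, mulFn, mul_pow]

/-- The localization formula for a vector that satisfies the eigenvalue equation on the support
of `f`. -/
lemma form_mulFn {H : Matrix Ω Ω ℂ} (hH : H.IsHermitian) {f : Ω → ℝ} {v : Ω → ℂ} {e : ℝ}
    (hv : ∀ σ, f σ ≠ 0 → v σ ≠ 0 → (H *ᵥ v) σ = e * v σ) :
    form H (mulFn f v) = e * nsq (mulFn f v) -
      (1 / 2) * ∑ σ, ∑ τ, (f σ - f τ) ^ 2 * (star (v σ) * H σ τ * v τ).re := by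
  set h : Ω → Ω → ℝ := fun σ τ => (star (v σ) * H σ τ * v τ).re with hh
  have hsymm : ∀ σ τ, h σ τ = h τ σ := by
    intro σ τ
    have h1 : star (star (v σ) * H σ τ * v τ) = star (v τ) * H τ σ * v σ := by
      rw [star_mul', star_mul', star_star, ← hH.apply τ σ]; ring
    simp only [hh]
    rw [← h1, Complex.star_def, Complex.conj_re]
  have e1 : form H (mulFn f v) = ∑ σ, ∑ τ, f σ * f τ * h σ τ := by
    rw [form_eq_sum]
    refine Finset.sum_congr rfl fun σ _ => Finset.sum_congr rfl fun τ _ => ?_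
    have : star (mulFn f v σ) * H σ τ * mulFn f v τ =
        ((f σ * f τ : ℝ) : ℂ) * (star (v σ) * H σ τ * v τ) := by
      simp only [mulFn, star_mul', Complex.star_def, Complex.conj_ofReal]; push_cast; ring
    rw [this, Complex.re_ofReal_mul]
  have e2 : ∑ σ, ∑ τ, f σ ^ 2 * h σ τ = e * nsq (mulFn f v) := by
    rw [nsq_mulFn, Finset.mul_sum]
    refine Finset.sum_congr rfl fun σ _ => ?_
    rw [← Finset.mul_sum]
    by_cases hσ : f σ = 0
    · simp [hσ]
    · by_cases hvσ : v σ = 0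
      · simp [hh, hvσ]
      have h2 := hv σ hσ hvσ
      have h3 : ∑ τ, h σ τ = (star (v σ) * (H *ᵥ v) σ).re := by
        simp only [hh, mulVec, dotProduct, Finset.mul_sum, Complex.re_sum, mul_assoc]
      have h4 : star (v σ) * ((e : ℂ) * v σ) = ((e * ‖v σ‖ ^ 2 : ℝ) : ℂ) := by
        rw [mul_left_comm, Complex.star_def, Complex.conj_mul']; push_cast; ring
      rw [h3, h2, h4, Complex.ofReal_re]; ring
  have e3 : ∑ σ, ∑ τ, f τ ^ 2 * h σ τ = e * nsq (mulFn f v) := by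
    rw [← e2, Finset.sum_comm]
    exact Finset.sum_congr rfl fun σ _ => Finset.sum_congr rfl fun τ _ => by rw [hsymm]
  -- The IMS formula: the square terms are given by the eigenvalue equation, and the mixed term is
  -- the energy of the localized vector.
  have e4 : ∑ σ, ∑ τ, (f σ - f τ) ^ 2 * h σ τ =
      ∑ σ, ∑ τ, f σ ^ 2 * h σ τ + ∑ σ, ∑ τ, f τ ^ 2 * h σ τ - 2 * ∑ σ, ∑ τ, f σ * f τ * h σ τ := by
    simp only [Finset.mul_sum, ← Finset.sum_add_distrib, ← Finset.sum_sub_distrib]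
    exact Finset.sum_congr rfl fun σ _ => Finset.sum_congr rfl fun τ _ => by ring
  rw [e4, e2, e3, e1]; ring

/-- The localization error is controlled by the row sums of the hopping rates. -/
lemma form_mulFn_le {H : Matrix Ω Ω ℂ} (hH : H.IsHermitian) {T : Ω → Ω → ℝ}
    (hT0 : ∀ σ τ, 0 ≤ T σ τ) (hTs : ∀ σ τ, T σ τ = T τ σ) {f : Ω → ℝ} {v : Ω → ℂ} {e : ℝ}
    (hHT : ∀ σ τ, f σ ≠ f τ → ‖H σ τ‖ ≤ T σ τ)
    (hv : ∀ σ, f σ ≠ 0 → v σ ≠ 0 → (H *ᵥ v) σ = e * v σ) :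
    form H (mulFn f v) ≤ e * nsq (mulFn f v) +
      (1 / 2) * ∑ σ, (∑ τ, T σ τ * (f σ - f τ) ^ 2) * ‖v σ‖ ^ 2 := by
  rw [form_mulFn hH hv]
  have h1 : ∀ σ τ, -((f σ - f τ) ^ 2 * (star (v σ) * H σ τ * v τ).re) ≤
      (1 / 2) * (T σ τ * (f σ - f τ) ^ 2 * ‖v σ‖ ^ 2) +
      (1 / 2) * (T τ σ * (f τ - f σ) ^ 2 * ‖v τ‖ ^ 2) := by
    intro σ τ
    by_cases hf : f σ = f τ
    · simp [hf]
    · have h2 : |(star (v σ) * H σ τ * v τ).re| ≤ T σ τ * (‖v σ‖ * ‖v τ‖) := by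
        calc _ ≤ ‖star (v σ) * H σ τ * v τ‖ := Complex.abs_re_le_norm _
          _ = ‖H σ τ‖ * (‖v σ‖ * ‖v τ‖) := by rw [norm_mul, norm_mul, norm_star]; ring
          _ ≤ _ := by gcongr; exact hHT σ τ hf
      have h3 : ‖v σ‖ * ‖v τ‖ ≤ (1 / 2) * ‖v σ‖ ^ 2 + (1 / 2) * ‖v τ‖ ^ 2 := by
        nlinarith [sq_nonneg (‖v σ‖ - ‖v τ‖)]
      have h4 := neg_le_of_abs_le h2
      have h5 := hT0 σ τ
      rw [← hTs σ τ]
      have h6 : -(star (v σ) * H σ τ * v τ).re ≤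
          T σ τ * ((1 / 2) * ‖v σ‖ ^ 2 + (1 / 2) * ‖v τ‖ ^ 2) := by nlinarith
      have h7 := mul_le_mul_of_nonneg_left h6 (sq_nonneg (f σ - f τ))
      linarith [h7]
  have h2 : -(∑ σ, ∑ τ, (f σ - f τ) ^ 2 * (star (v σ) * H σ τ * v τ).re) ≤
      ∑ σ, (∑ τ, T σ τ * (f σ - f τ) ^ 2) * ‖v σ‖ ^ 2 := by
    calc -(∑ σ, ∑ τ, (f σ - f τ) ^ 2 * (star (v σ) * H σ τ * v τ).re)
        = ∑ σ, ∑ τ, -((f σ - f τ) ^ 2 * (star (v σ) * H σ τ * v τ).re) := by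
          simp only [Finset.sum_neg_distrib]
      _ ≤ ∑ σ, ∑ τ, ((1 / 2) * (T σ τ * (f σ - f τ) ^ 2 * ‖v σ‖ ^ 2) +
            (1 / 2) * (T τ σ * (f τ - f σ) ^ 2 * ‖v τ‖ ^ 2)) :=
          Finset.sum_le_sum fun σ _ => Finset.sum_le_sum fun τ _ => h1 σ τ
      _ = _ := by
          simp only [Finset.sum_add_distrib]
          rw [Finset.sum_comm (f := fun σ τ => (1 / 2) * (T τ σ * (f τ - f σ) ^ 2 * ‖v τ‖ ^ 2)),
            ← Finset.sum_add_distrib]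
          refine Finset.sum_congr rfl fun σ _ => ?_
          rw [← Finset.sum_add_distrib, Finset.sum_mul]
          exact Finset.sum_congr rfl fun τ _ => by ring
  linarith

/-- The residual of a localized eigenvector. -/
lemma nsq_residual_le {H : Matrix Ω Ω ℂ} {T : Ω → Ω → ℝ}
    (hT0 : ∀ σ τ, 0 ≤ T σ τ) (hTs : ∀ σ τ, T σ τ = T τ σ) {f : Ω → ℝ} {v : Ω → ℂ} {e K : ℝ}
    (hHT : ∀ σ τ, f σ ≠ f τ → ‖H σ τ‖ ≤ T σ τ)
    (hv : ∀ σ, f σ ≠ 0 → (H *ᵥ v) σ = e * v σ)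
    (hK : ∀ σ, ∑ τ, T σ τ * |f σ - f τ| ≤ K) :
    nsq (H *ᵥ mulFn f v - (e : ℂ) • mulFn f v) ≤ K ^ 2 * nsq v := by
  set a : Ω → Ω → ℝ := fun σ τ => T σ τ * |f σ - f τ| with ha
  have ha0 : ∀ σ τ, 0 ≤ a σ τ := fun σ τ => mul_nonneg (hT0 σ τ) (abs_nonneg _)
  have has : ∀ σ τ, a σ τ = a τ σ := fun σ τ => by simp only [ha]; rw [hTs, abs_sub_comm]
  have h1 : ∀ σ, ‖(H *ᵥ mulFn f v - (e : ℂ) • mulFn f v) σ‖ ≤ ∑ τ, a σ τ * ‖v τ‖ := by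
    intro σ
    -- By the eigenvalue equation the residual is the commutator of `H` with `f`, applied to `v`.
    have e1 : (H *ᵥ mulFn f v - (e : ℂ) • mulFn f v) σ =
        ∑ τ, H σ τ * ((f τ - f σ : ℝ) : ℂ) * v τ := by
      have e2 : (e : ℂ) * mulFn f v σ = f σ * (H *ᵥ v) σ := by
        by_cases hσ : f σ = 0
        · simp [mulFn, hσ]
        · rw [hv σ hσ]; simp only [mulFn]; ring
      simp only [Pi.sub_apply, Pi.smul_apply, smul_eq_mul, e2]
      simp only [mulVec, dotProduct, mulFn, Finset.mul_sum, ← Finset.sum_sub_distrib]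
      refine Finset.sum_congr rfl fun τ _ => ?_
      push_cast; ring
    rw [e1]
    refine (norm_sum_le _ _).trans (Finset.sum_le_sum fun τ _ => ?_)
    rw [norm_mul, norm_mul, Complex.norm_real, Real.norm_eq_abs, abs_sub_comm]
    by_cases hf : f σ = f τ
    · simp [hf, ha]
    · have := hHT σ τ hf
      simp only [ha]; gcongr
  -- Schur test: Cauchy–Schwarz in each row, then the symmetry of `a` turns the row sums into column
  -- sums.
  have h2 : ∀ σ, (∑ τ, a σ τ * ‖v τ‖) ^ 2 ≤ K * ∑ τ, a σ τ * ‖v τ‖ ^ 2 := by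
    intro σ
    have h3 := Finset.sum_sq_le_sum_mul_sum_of_sq_le_mul Finset.univ
      (r := fun τ => a σ τ * ‖v τ‖) (f := fun τ => a σ τ) (g := fun τ => a σ τ * ‖v τ‖ ^ 2)
      (fun τ _ => ha0 σ τ) (fun τ _ => mul_nonneg (ha0 σ τ) (sq_nonneg _)) (fun τ _ => (by ring : _ = _).le)
    refine h3.trans ?_
    gcongr
    · exact Finset.sum_nonneg fun τ _ => mul_nonneg (ha0 σ τ) (sq_nonneg _)
    · exact hK σ
  calc nsq (H *ᵥ mulFn f v - (e : ℂ) • mulFn f v)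
      ≤ ∑ σ, K * ∑ τ, a σ τ * ‖v τ‖ ^ 2 := by
        refine Finset.sum_le_sum fun σ _ => le_trans ?_ (h2 σ)
        gcongr; exact h1 σ
    _ = ∑ τ, K * (∑ σ, a τ σ) * ‖v τ‖ ^ 2 := by
        simp only [Finset.mul_sum, Finset.sum_mul]
        rw [Finset.sum_comm]
        refine Finset.sum_congr rfl fun τ _ => Finset.sum_congr rfl fun σ _ => ?_
        rw [has σ τ]; ring
    _ ≤ ∑ τ, K ^ 2 * ‖v τ‖ ^ 2 := by
        refine Finset.sum_le_sum fun τ _ => ?_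
        have h5 : 0 ≤ ∑ σ, a τ σ := Finset.sum_nonneg fun σ _ => ha0 τ σ
        have h6 := hK τ
        gcongr
        nlinarith
    _ = K ^ 2 * nsq v := by rw [nsq, Finset.mul_sum]

end Localization

/-! ## Splitting the spins into two parts -/

section Split

variable {V : Type} [Fintype V] [DecidableEq V]

/-- The configuration `σ` on `X`, with all spins down outside of `X`. -/
noncomputable def res (X : Set V) (σ : V → Fin 2) : V → Fin 2 :=
  open Classical in fun v => if v ∈ X then σ v else 1

/-- The configuration that agrees with `a` on `X` and with `b` outside of `X`. -/
noncomputable def comb (X : Set V) (a b : V → Fin 2) : V → Fin 2 :=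
  open Classical in fun v => if v ∈ X then a v else b v

/-- The configurations with all spins down outside of `X`. -/
noncomputable def inside (X : Set V) : Finset (V → Fin 2) :=
  open Classical in Finset.univ.filter fun σ => ∀ v, v ∉ X → σ v = 1

lemma mem_inside {X : Set V} {σ : V → Fin 2} : σ ∈ inside X ↔ ∀ v, v ∉ X → σ v = 1 := by
  simp [inside]

lemma comb_of_mem {X : Set V} {a b : V → Fin 2} {v : V} (h : v ∈ X) : comb X a b v = a v := by
  simp [comb, h]

lemma comb_of_not_mem {X : Set V} {a b : V → Fin 2} {v : V} (h : v ∉ X) : comb X a b v = b v := by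
  simp [comb, h]

lemma res_of_mem {X : Set V} {a : V → Fin 2} {v : V} (h : v ∈ X) : res X a v = a v := by
  simp [res, h]

lemma res_of_not_mem {X : Set V} {a : V → Fin 2} {v : V} (h : v ∉ X) : res X a v = 1 := by
  simp [res, h]

lemma res_mem (X : Set V) (σ : V → Fin 2) : res X σ ∈ inside X :=
  mem_inside.2 fun _ hv => res_of_not_mem hv

lemma comb_compl (X : Set V) (a b : V → Fin 2) : comb Xᶜ b a = comb X a b := by
  funext v; by_cases h : v ∈ X <;> simp [comb, h]

lemma comb_res (X : Set V) (σ : V → Fin 2) : comb X (res X σ) (res Xᶜ σ) = σ := by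
  funext v; by_cases h : v ∈ X <;> simp [comb, res, h]

lemma res_comb {X : Set V} {a b : V → Fin 2} (ha : a ∈ inside X) : res X (comb X a b) = a := by
  funext v
  by_cases h : v ∈ X
  · simp [comb, res, h]
  · simp [res, h, mem_inside.1 ha v h]

lemma res_compl_comb {X : Set V} {a b : V → Fin 2} (hb : b ∈ inside Xᶜ) :
    res Xᶜ (comb X a b) = b := by
  rw [← comb_compl, res_comb hb]

lemma sum_comb {M : Type*} [AddCommMonoid M] (X : Set V) (f : (V → Fin 2) → M) :
    ∑ σ, f σ = ∑ b ∈ inside Xᶜ, ∑ a ∈ inside X, f (comb X a b) := by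
  rw [← Finset.sum_product']
  refine Finset.sum_bij' (fun σ _ => (res Xᶜ σ, res X σ)) (fun p _ => comb X p.2 p.1) ?_ ?_ ?_ ?_ ?_
  · intro σ _; exact Finset.mem_product.2 ⟨res_mem _ _, res_mem _ _⟩
  · intro p _; exact Finset.mem_univ _
  · intro σ _; exact comb_res X σ
  · rintro ⟨b, a⟩ hp
    obtain ⟨hb, ha⟩ := Finset.mem_product.1 hp
    exact Prod.ext (res_compl_comb hb) (res_comb ha)
  · intro σ _; rw [comb_res]

/-- The slice of a vector at a configuration outside of `X`, as a vector supported on `inside X`. -/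
noncomputable def slice (X : Set V) (v : (V → Fin 2) → ℂ) (b : V → Fin 2) : (V → Fin 2) → ℂ :=
  open Classical in fun a => if a ∈ inside X then v (comb X a b) else 0

lemma slice_of_mem {X : Set V} {v : (V → Fin 2) → ℂ} {a b : V → Fin 2} (ha : a ∈ inside X) :
    slice X v b a = v (comb X a b) := if_pos ha

lemma slice_of_not_mem {X : Set V} {v : (V → Fin 2) → ℂ} {a b : V → Fin 2} (ha : a ∉ inside X) :
    slice X v b a = 0 := if_neg ha

lemma mem_inside_of_slice_ne_zero {X : Set V} {v : (V → Fin 2) → ℂ} {a b : V → Fin 2}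
    (h : slice X v b a ≠ 0) : a ∈ inside X := by
  by_contra h'; exact h (slice_of_not_mem h')

lemma sum_inside {M : Type*} [AddCommMonoid M] (X : Set V) (f : (V → Fin 2) → M)
    (hf : ∀ a ∉ inside X, f a = 0) : ∑ a ∈ inside X, f a = ∑ a, f a :=
  Finset.sum_subset (Finset.subset_univ _) fun a _ ha => hf a ha

lemma sum_nsq_slice (X : Set V) (v : (V → Fin 2) → ℂ) :
    ∑ b ∈ inside Xᶜ, nsq (slice X v b) = nsq v := by
  rw [nsq, sum_comb X]
  refine Finset.sum_congr rfl fun b _ => ?_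
  rw [nsq, ← sum_inside X _ fun a ha => by rw [slice_of_not_mem ha]; simp]
  exact Finset.sum_congr rfl fun a ha => by rw [slice_of_mem ha]

/-- `M` acts as the identity outside of `X`. -/
def IsLocal (X : Set V) (M : SpinOp V) : Prop :=
  ∀ σ τ, M σ τ = open Classical in if ∀ v, v ∉ X → σ v = τ v then M (res X σ) (res X τ) else 0

/-- Such an operator is block diagonal over the configurations outside of `X`, with the same block
for each of them. -/
lemma IsLocal.form_eq {X : Set V} {M : SpinOp V} (hM : IsLocal X M) (v : (V → Fin 2) → ℂ) :
    form M v = ∑ b ∈ inside Xᶜ, form M (slice X v b) := by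
  classical
  rw [form_eq_sum, sum_comb X]
  refine Finset.sum_congr rfl fun b hb => ?_
  rw [form_eq_sum, ← sum_inside X _ fun a ha => by
    exact Finset.sum_eq_zero fun τ _ => by rw [slice_of_not_mem ha]; simp]
  refine Finset.sum_congr rfl fun a ha => ?_
  rw [sum_comb X, Finset.sum_eq_single b]
  · rw [← sum_inside X _ fun τ hτ => by rw [slice_of_not_mem hτ]; simp]
    refine Finset.sum_congr rfl fun a' ha' => ?_
    rw [slice_of_mem ha, slice_of_mem ha', hM (comb X a b), if_pos, res_comb ha, res_comb ha']
    intro w hw; rw [comb_of_not_mem hw, comb_of_not_mem hw]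
  · intro b' hb' hne
    refine Finset.sum_eq_zero fun a' _ => ?_
    rw [hM (comb X a b), if_neg]
    · simp
    · intro h
      apply hne
      funext w
      by_cases hw : w ∈ X
      · rw [mem_inside.1 hb w (by simpa using hw), mem_inside.1 hb' w (by simpa using hw)]
      · have := h w hw
        rwa [comb_of_not_mem hw, comb_of_not_mem hw, eq_comm] at this
  · intro h; exact absurd hb h

lemma IsLocal.add {X : Set V} {M M' : SpinOp V} (h : IsLocal X M) (h' : IsLocal X M') :
    IsLocal X (M + M') := by
  intro σ τ
  rw [Matrix.add_apply, h σ τ, h' σ τ]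
  split_ifs <;> simp

lemma IsLocal.neg {X : Set V} {M : SpinOp V} (h : IsLocal X M) : IsLocal X (-M) := by
  intro σ τ
  rw [Matrix.neg_apply, h σ τ]
  split_ifs <;> simp

lemma isLocal_zero (X : Set V) : IsLocal X (0 : SpinOp V) := by
  intro σ τ; simp

lemma IsLocal.sum {X : Set V} {ι : Type*} (s : Finset ι) {M : ι → SpinOp V}
    (h : ∀ i ∈ s, IsLocal X (M i)) : IsLocal X (∑ i ∈ s, M i) := by
  classical
  induction s using Finset.induction_on with
  | empty => simpa using isLocal_zero X
  | insert i s hi ih =>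
    rw [Finset.sum_insert hi]
    exact (h i (by simp)).add (ih fun j hj => h j (by simp [hj]))

lemma IsSupportedIn.isLocal {X Y : Set V} {M : SpinOp V} (h : IsSupportedIn Y M) (hXY : Y ⊆ X) :
    IsLocal X M := by
  classical
  obtain ⟨B, rfl⟩ := h
  intro σ τ
  have hr : ∀ σ : V → Fin 2, (fun v : Y => res X σ v) = fun v : Y => σ v := fun σ => by
    funext v; exact res_of_mem (hXY v.2)
  simp only [embed, of_apply, hr]
  by_cases h1 : ∀ v, v ∉ X → σ v = τ v
  · rw [if_pos h1]
    congr 1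
    apply propext
    refine forall_congr' fun v => imp_congr_right fun hv => ?_
    by_cases hX : v ∈ X
    · rw [res_of_mem hX, res_of_mem hX]
    · simp [res_of_not_mem hX, h1 v hX]
  · rw [if_neg h1, if_neg]
    exact fun h2 => h1 fun v hv => h2 v fun hY => hv (hXY hY)

lemma isLocal_hop {X : Set V} {x y : V} (hx : x ∈ X) (hy : y ∈ X) : IsLocal X (hop x y) := by
  classical
  intro σ τ
  simp only [hop, of_apply, eq_comp_swap_iff, res_of_mem hx, res_of_mem hy]
  by_cases h1 : ∀ v, v ∉ X → σ v = τ v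
  · rw [if_pos h1]
    congr 1
    apply propext
    refine and_congr_right fun _ => and_congr_left fun _ => ?_
    refine forall_congr' fun v => imp_congr_right fun _ => imp_congr_right fun _ => ?_
    by_cases hX : v ∈ X
    · rw [res_of_mem hX, res_of_mem hX]
    · simp [res_of_not_mem hX, h1 v hX]
  · rw [if_neg h1, if_neg]
    rintro ⟨_, h2, _⟩
    exact h1 fun v hv => h2 v (fun h => hv (h ▸ hx)) (fun h => hv (h ▸ hy))

lemma isLocal_diagonal {X : Set V} {d : (V → Fin 2) → ℂ} (hd : ∀ σ, d σ = d (res X σ)) :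
    IsLocal X (diagonal d) := by
  classical
  intro σ τ
  by_cases h : σ = τ
  · subst h; simp [hd σ]
  · rw [diagonal_apply_ne _ h]
    split_ifs with h1
    · rw [diagonal_apply_ne]
      intro h2
      apply h
      funext v
      by_cases hv : v ∈ X
      · have := congrFun h2 v
        rwa [res_of_mem hv, res_of_mem hv] at this
      · exact h1 v hv
    · rfl

/-- The product of a vector on the spins in `X` and a vector on the other spins. -/
noncomputable def prodVec (X : Set V) (χ φ : (V → Fin 2) → ℂ) : (V → Fin 2) → ℂ :=
  fun σ => φ (res Xᶜ σ) * χ (res X σ)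

lemma slice_prodVec {X : Set V} {χ φ : (V → Fin 2) → ℂ} (hχ : ∀ a ∉ inside X, χ a = 0)
    {b : V → Fin 2} (hb : b ∈ inside Xᶜ) : slice X (prodVec X χ φ) b = φ b • χ := by
  funext a
  by_cases ha : a ∈ inside X
  · rw [slice_of_mem ha, prodVec, res_comb ha, res_compl_comb hb]; rfl
  · rw [slice_of_not_mem ha]; simp [hχ a ha]

lemma slice_compl_prodVec {X : Set V} {χ φ : (V → Fin 2) → ℂ} (hφ : ∀ b ∉ inside Xᶜ, φ b = 0)
    {a : V → Fin 2} (ha : a ∈ inside X) : slice Xᶜ (prodVec X χ φ) a = χ a • φ := by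
  funext b
  by_cases hb : b ∈ inside Xᶜ
  · rw [slice_of_mem hb, comb_compl, prodVec, res_comb ha, res_compl_comb hb]
    simp [mul_comm]
  · rw [slice_of_not_mem hb]; simp [hφ b hb]

end Split

/-! ## The xy-Hamiltonian in the configuration basis -/

section Model

variable {ν L N : ℕ} [NeZero L]

/-- The number of lattice spins that are up. -/
def particles (σ : Spins ν L N → Fin 2) : ℕ :=
  (Finset.univ.filter fun x : Torus ν L => σ (Sum.inl x) = 0).card

/-- The number of all spins that are up. -/
def ups (σ : Spins ν L N → Fin 2) : ℕ := (Finset.univ.filter fun v => σ v = 0).card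

/-- The hopping rates of the xy-Hamiltonian. -/
noncomputable def rate (σ τ : Spins ν L N → Fin 2) : ℝ :=
  ∑ x : Torus ν L, ∑ y : Torus ν L, if torusDist x y = 1 ∧ σ (Sum.inl x) ≠ σ (Sum.inl y) ∧
    τ = σ ∘ Equiv.swap (Sum.inl x) (Sum.inl y) then 1 / 2 else 0

/-- The hopping part of the xy-Hamiltonian. -/
noncomputable def hopSum (ν L N : ℕ) [NeZero L] : SpinOp (Spins ν L N) :=
  ∑ x : Torus ν L, ∑ y : Torus ν L, if torusDist x y = 1 then hop (Sum.inl x) (Sum.inl y) else 0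

/-- The potential energy of a configuration. -/
noncomputable def pot (u : Torus ν L → ℝ) (σ : Spins ν L N → Fin 2) : ℝ :=
  ∑ x : Torus ν L, if σ (Sum.inl x) = 0 then u x + 2 * (ν : ℝ) else 0

lemma ne_of_torusDist_eq_one {x y : Torus ν L} (h : torusDist x y = 1) : x ≠ y := by
  rintro rfl; simp [torusDist_self] at h

lemma xyHamiltonian_eq (u : Torus ν L → ℝ) :
    (xyHamiltonian u : SpinOp (Spins ν L N)) =
      diagonal (fun σ => (pot u σ : ℂ)) - hopSum ν L N := by
  have h1 : ∀ x y : Torus ν L, (if torusDist x y = 1 then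
      siteOp (V := Spins ν L N) (Sum.inl x) spin1 * siteOp (Sum.inl y) spin1
        + siteOp (Sum.inl x) spin2 * siteOp (Sum.inl y) spin2 else 0) =
      if torusDist x y = 1 then hop (Sum.inl x) (Sum.inl y) else 0 := by
    intro x y
    split_ifs with h
    · exact spin_exchange fun h' => ne_of_torusDist_eq_one h (Sum.inl_injective h')
    · rfl
  have h2 : ∑ x : Torus ν L, (u x + 2 * (ν : ℝ)) •
      ((1 / 2 : ℝ) • (1 : SpinOp (Spins ν L N)) + siteOp (Sum.inl x) spin3) =
      diagonal (fun σ => (pot u σ : ℂ)) := by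
    ext σ τ
    rw [Matrix.sum_apply, diagonal_apply]
    have h3 : ∀ x : Torus ν L, ((u x + 2 * (ν : ℝ)) • ((1 / 2 : ℝ) • (1 : SpinOp (Spins ν L N)) +
        siteOp (Sum.inl x) spin3) : SpinOp (Spins ν L N)) σ τ =
        if σ = τ then (((if σ (Sum.inl x) = 0 then u x + 2 * (ν : ℝ) else 0 : ℝ)) : ℂ) else 0 := by
      intro x
      rw [Matrix.smul_apply, Matrix.add_apply, Matrix.smul_apply, siteOp_apply]
      by_cases h : σ = τ
      · subst h
        simp only [Matrix.one_apply_eq, implies_true, if_true]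
        generalize σ (Sum.inl x) = a
        fin_cases a <;> simp [spin3] <;> ring
      · rw [Matrix.one_apply_ne h, if_neg h]
        have : (if ∀ w, w ≠ Sum.inl x → σ w = τ w then
            spin3 (σ (Sum.inl x)) (τ (Sum.inl x)) else 0) = 0 := by
          split_ifs with h4
          · have h5 : σ (Sum.inl x) ≠ τ (Sum.inl x) := by
              intro h5
              apply h
              funext w
              by_cases hw : w = Sum.inl x
              · rw [hw, h5]
              · exact h4 w hw
            revert h5
            generalize σ (Sum.inl x) = a, τ (Sum.inl x) = b
            fin_cases a <;> fin_cases b <;> simp [spin3]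
          · rfl
        rw [this]; simp
    rw [Finset.sum_congr rfl fun x _ => h3 x]
    split_ifs
    · rw [pot]; push_cast; rfl
    · simp
  rw [xyHamiltonian, h2, hopSum]
  simp only [h1]
  abel

lemma hopSum_apply (σ τ : Spins ν L N → Fin 2) : hopSum ν L N σ τ = (rate σ τ : ℂ) := by
  simp only [hopSum, rate, Matrix.sum_apply, Complex.ofReal_sum]
  refine Finset.sum_congr rfl fun x _ => Finset.sum_congr rfl fun y _ => ?_
  by_cases h : torusDist x y = 1
  · rw [if_pos h]
    simp only [h, true_and, hop, of_apply]
    split_ifs <;> simp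
  · rw [if_neg h, if_neg fun h' => h h'.1]; simp

lemma rate_nonneg (σ τ : Spins ν L N → Fin 2) : 0 ≤ rate σ τ :=
  Finset.sum_nonneg fun x _ => Finset.sum_nonneg fun y _ => by split_ifs <;> norm_num

lemma rate_comm (σ τ : Spins ν L N → Fin 2) : rate σ τ = rate τ σ := by
  have : hopSum ν L N σ τ = hopSum ν L N τ σ := by
    simp only [hopSum, Matrix.sum_apply]
    refine Finset.sum_congr rfl fun x _ => Finset.sum_congr rfl fun y _ => ?_
    split_ifs
    · exact hop_apply_comm _ _ _ _
    · rfl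
  rw [hopSum_apply, hopSum_apply] at this
  exact_mod_cast this

lemma exists_of_rate_ne_zero {σ τ : Spins ν L N → Fin 2} (h : rate σ τ ≠ 0) :
    ∃ x y : Torus ν L, torusDist x y = 1 ∧ σ (Sum.inl x) ≠ σ (Sum.inl y) ∧
      τ = σ ∘ Equiv.swap (Sum.inl x) (Sum.inl y) := by
  by_contra! h'
  apply h
  refine Finset.sum_eq_zero fun x _ => Finset.sum_eq_zero fun y _ => if_neg ?_
  rintro ⟨h1, h2, h3⟩
  exact h' x y h1 h2 h3

/-- Every contributing pair of neighbours contains exactly one particle, and each particle has at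
most `2ν` neighbours. Both orderings of a pair occur, which cancels the amplitude `1/2`. -/
lemma sum_rate_le (σ : Spins ν L N → Fin 2) : ∑ τ, rate σ τ ≤ 2 * ν * particles σ := by
  have h1 : ∑ τ, rate σ τ = ∑ x : Torus ν L, ∑ y : Torus ν L,
      if torusDist x y = 1 ∧ σ (Sum.inl x) ≠ σ (Sum.inl y) then (1 / 2 : ℝ) else 0 := by
    simp only [rate]
    rw [Finset.sum_comm]
    refine Finset.sum_congr rfl fun x _ => ?_
    rw [Finset.sum_comm]
    refine Finset.sum_congr rfl fun y _ => ?_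
    by_cases h : torusDist x y = 1 ∧ σ (Sum.inl x) ≠ σ (Sum.inl y)
    · rw [if_pos h]
      simp [h.1, h.2]
    · rw [if_neg h]
      exact Finset.sum_eq_zero fun τ _ => if_neg fun h' => h ⟨h'.1, h'.2.1⟩
  have h2 : ∀ x y : Torus ν L,
      (if torusDist x y = 1 ∧ σ (Sum.inl x) ≠ σ (Sum.inl y) then (1 / 2 : ℝ) else 0) ≤
      (1 / 2) * (if σ (Sum.inl x) = 0 then (if torusDist x y = 1 then 1 else 0) else 0) +
      (1 / 2) * (if σ (Sum.inl y) = 0 then (if torusDist y x = 1 then 1 else 0) else 0) := by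
    intro x y
    rw [torusDist_comm y x]
    by_cases h : torusDist x y = 1
    · simp only [h, true_and, if_true]
      generalize σ (Sum.inl x) = a, σ (Sum.inl y) = b
      fin_cases a <;> fin_cases b <;> norm_num
    · simp [h]
  have h3 : ∑ x : Torus ν L, ∑ y : Torus ν L,
      (if σ (Sum.inl x) = 0 then (if torusDist x y = 1 then (1 : ℝ) else 0) else 0) ≤
      2 * ν * particles σ := by
    calc _ ≤ ∑ x : Torus ν L, (if σ (Sum.inl x) = 0 then (2 * ν : ℝ) else 0) := by
          refine Finset.sum_le_sum fun x _ => ?_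
          split_ifs with h
          · have := card_neighbours_le x
            rw [← Nat.cast_le (α := ℝ)] at this
            simpa using this
          · simp
      _ = _ := by
          rw [← Finset.sum_filter, Finset.sum_const, nsmul_eq_mul, particles]; ring
  calc ∑ τ, rate σ τ ≤ ∑ x : Torus ν L, ∑ y : Torus ν L,
        ((1 / 2) * (if σ (Sum.inl x) = 0 then (if torusDist x y = 1 then (1 : ℝ) else 0) else 0) +
        (1 / 2) * (if σ (Sum.inl y) = 0 then (if torusDist y x = 1 then 1 else 0) else 0)) := by
        rw [h1]
        exact Finset.sum_le_sum fun x _ => Finset.sum_le_sum fun y _ => h2 x y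
    _ = ∑ x : Torus ν L, ∑ y : Torus ν L,
        (if σ (Sum.inl x) = 0 then (if torusDist x y = 1 then (1 : ℝ) else 0) else 0) := by
        simp only [Finset.sum_add_distrib, ← Finset.mul_sum]
        rw [Finset.sum_comm (f := fun x y : Torus ν L =>
          (if σ (Sum.inl y) = 0 then (if torusDist y x = 1 then (1 : ℝ) else 0) else 0))]
        ring
    _ ≤ _ := h3

lemma particles_le_ups (σ : Spins ν L N → Fin 2) : particles σ ≤ ups σ := by
  rw [particles, ups, ← Finset.card_image_of_injective _
    (Sum.inl_injective : Function.Injective (Sum.inl : Torus ν L → Spins ν L N))]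
  refine Finset.card_le_card fun v hv => ?_
  obtain ⟨x, hx, rfl⟩ := Finset.mem_image.1 hv
  simpa using hx

lemma ups_comp_equiv (σ : Spins ν L N → Fin 2) (e : Equiv.Perm (Spins ν L N)) :
    ups (σ ∘ e) = ups σ := by
  rw [ups, ups]
  refine Finset.card_bij (fun v _ => e v) ?_ ?_ ?_
  · intro v hv; simpa using hv
  · intro v _ w _ h; exact e.injective h
  · intro w hw; exact ⟨e.symm w, by simpa using hw, by simp⟩

lemma ups_eq_of_rate_ne_zero {σ τ : Spins ν L N → Fin 2} (h : rate σ τ ≠ 0) : ups σ = ups τ := by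
  obtain ⟨x, y, _, _, rfl⟩ := exists_of_rate_ne_zero h
  rw [ups_comp_equiv]

lemma xyHamiltonian_apply (u : Torus ν L → ℝ) (σ τ : Spins ν L N → Fin 2) :
    xyHamiltonian u σ τ = (if σ = τ then (pot u σ : ℂ) else 0) - rate σ τ := by
  rw [xyHamiltonian_eq, Matrix.sub_apply, hopSum_apply, diagonal_apply]

lemma isHermitian_xyHamiltonian (u : Torus ν L → ℝ) :
    (xyHamiltonian u : SpinOp (Spins ν L N)).IsHermitian := by
  ext σ τ
  rw [conjTranspose_apply, xyHamiltonian_apply, xyHamiltonian_apply, rate_comm τ σ]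
  by_cases h : σ = τ
  · subst h; simp
  · simp [h, Ne.symm h]

/-- The xy-Hamiltonian is nonnegative. -/
lemma form_xyHamiltonian_nonneg {u : Torus ν L → ℝ} (hu : ∀ x, 0 ≤ u x)
    (v : (Spins ν L N → Fin 2) → ℂ) : 0 ≤ form (xyHamiltonian u) v := by
  -- Diagonal dominance: the shift of the field by `2ν` pays exactly for the bound on the row sums
  -- of the hopping rates.
  have hpot : ∀ σ : Spins ν L N → Fin 2, 2 * ν * (particles σ : ℝ) ≤ pot u σ := by
    intro σ
    rw [pot, ← Finset.sum_filter, particles, mul_comm, ← nsmul_eq_mul, ← Finset.sum_const]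
    exact Finset.sum_le_sum fun x _ => by linarith [hu x]
  have h1 : ∀ σ τ : Spins ν L N → Fin 2, (if σ = τ then pot u σ * ‖v σ‖ ^ 2 else 0) -
      ((1 / 2) * (rate σ τ * ‖v σ‖ ^ 2) + (1 / 2) * (rate τ σ * ‖v τ‖ ^ 2)) ≤
      (star (v σ) * xyHamiltonian u σ τ * v τ).re := by
    intro σ τ
    rw [xyHamiltonian_apply, mul_sub, sub_mul, Complex.sub_re]
    have e1 : (star (v σ) * (if σ = τ then (pot u σ : ℂ) else 0) * v τ).re =
        if σ = τ then pot u σ * ‖v σ‖ ^ 2 else 0 := by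
      split_ifs with h
      · subst h
        have : star (v σ) * (pot u σ : ℂ) * v σ = ((pot u σ * ‖v σ‖ ^ 2 : ℝ) : ℂ) := by
          rw [mul_comm (star (v σ)), mul_assoc, Complex.star_def, Complex.conj_mul']; push_cast; rfl
        rw [this, Complex.ofReal_re]
      · simp
    have e2 : (star (v σ) * (rate σ τ : ℂ) * v τ).re ≤ rate σ τ * (‖v σ‖ * ‖v τ‖) := by
      calc _ ≤ ‖star (v σ) * (rate σ τ : ℂ) * v τ‖ := Complex.re_le_norm _
        _ = _ := by
          rw [norm_mul, norm_mul, norm_star, Complex.norm_real, Real.norm_of_nonneg (rate_nonneg _ _)]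
          ring
    have e3 : ‖v σ‖ * ‖v τ‖ ≤ (1 / 2) * ‖v σ‖ ^ 2 + (1 / 2) * ‖v τ‖ ^ 2 := by
      nlinarith [sq_nonneg (‖v σ‖ - ‖v τ‖)]
    have e4 := mul_le_mul_of_nonneg_left e3 (rate_nonneg σ τ)
    rw [e1, rate_comm τ σ]
    linarith
  rw [form_eq_sum]
  calc (0 : ℝ) ≤ ∑ σ, (pot u σ - ∑ τ, rate σ τ) * ‖v σ‖ ^ 2 := by
        refine Finset.sum_nonneg fun σ _ => mul_nonneg ?_ (sq_nonneg _)
        linarith [sum_rate_le σ, hpot σ]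
    _ = ∑ σ, ∑ τ, ((if σ = τ then pot u σ * ‖v σ‖ ^ 2 else 0) -
      ((1 / 2) * (rate σ τ * ‖v σ‖ ^ 2) + (1 / 2) * (rate τ σ * ‖v τ‖ ^ 2))) := by
        simp only [Finset.sum_sub_distrib, Finset.sum_add_distrib]
        rw [Finset.sum_comm (f := fun σ τ => (1 / 2) * (rate τ σ * ‖v τ‖ ^ 2)),
          ← Finset.sum_add_distrib, ← Finset.sum_sub_distrib]
        refine Finset.sum_congr rfl fun σ _ => ?_
        rw [← Finset.sum_add_distrib, sub_mul, Finset.sum_mul]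
        congr 1
        · simp
        · exact Finset.sum_congr rfl fun τ _ => by ring
    _ ≤ _ := Finset.sum_le_sum fun σ _ => Finset.sum_le_sum fun τ _ => h1 σ τ

/-- A perturbation at the impurity site `k`. -/
structure IsImpurity (k : Torus ν L) (W : SpinOp (Spins ν L N)) : Prop where
  herm : W.IsHermitian
  supp : IsSupportedIn (impuritySpins k) W
  ups_eq : ∀ σ τ, W σ τ ≠ 0 → ups σ = ups τ

/-- The total spin is an injective function of `ups`, so that an operator commuting with it has no
matrix elements between configurations with different numbers of spins up. -/
lemma totalSpin_eq : totalSpin (Spins ν L N) =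
    diagonal fun σ => (ups σ : ℂ) - Fintype.card (Spins ν L N) / 2 := by
  have h3 : ∀ v : Spins ν L N, siteOp v spin3 =
      diagonal fun σ => if σ v = 0 then (1 / 2 : ℂ) else -1 / 2 := by
    intro v
    ext σ τ
    rw [siteOp_apply, diagonal_apply]
    by_cases h : σ = τ
    · subst h
      simp only [implies_true, if_true]
      generalize σ v = a
      fin_cases a <;> simp [spin3]
    · rw [if_neg h]
      split_ifs with h4
      · have h5 : σ v ≠ τ v := by
          intro h5
          apply h
          funext w
          by_cases hw : w = v
          · rw [hw, h5]
          · exact h4 w hw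
        revert h5
        generalize σ v = a, τ v = b
        fin_cases a <;> fin_cases b <;> simp [spin3]
      · rfl
  rw [totalSpin]
  simp only [h3]
  ext σ τ
  rw [Matrix.sum_apply]
  simp only [diagonal_apply]
  by_cases h : σ = τ
  · subst h
    simp only [if_true]
    have : ∀ v : Spins ν L N, (if σ v = 0 then (1 / 2 : ℂ) else -1 / 2) =
        (if σ v = 0 then 1 else 0) - 1 / 2 := by
      intro v; split_ifs <;> norm_num
    simp only [this, Finset.sum_sub_distrib, ups, Finset.sum_boole, Finset.sum_const,
      Finset.card_univ, nsmul_eq_mul]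
    ring
  · simp [h]

lemma IsCoupling.isImpurity {k : Torus ν L} {W : ℝ → SpinOp (Spins ν L N)} (h : IsCoupling k W)
    {s : ℝ} (hs : s ∈ Set.Icc (0 : ℝ) 1) : IsImpurity k (W s) where
  herm := h.selfAdjoint s hs
  supp := h.support s hs
  ups_eq σ τ hW := by
    have h1 := (h.conserving s hs).eq
    rw [totalSpin_eq] at h1
    have h2 := congrFun (congrFun h1 σ) τ
    rw [mul_diagonal, diagonal_mul, mul_comm] at h2
    have h3 := mul_right_cancel₀ hW h2
    have h4 : (ups τ : ℂ) = ups σ := by linear_combination h3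
    exact_mod_cast h4.symm

namespace IsImpurity

variable {k : Torus ν L} {W : SpinOp (Spins ν L N)}

lemma eq_of_ne_zero (h : IsImpurity k W) {σ τ : Spins ν L N → Fin 2} (hW : W σ τ ≠ 0)
    {x : Torus ν L} (hx : x ≠ k) : σ (Sum.inl x) = τ (Sum.inl x) := by
  obtain ⟨B, hB⟩ := h.supp
  rw [hB] at hW
  simp only [embed, of_apply] at hW
  split_ifs at hW with h1
  · exact h1 _ hx
  · exact absurd rfl hW

lemma isHermitian_add (h : IsImpurity k W) (u : Torus ν L → ℝ) :
    (xyHamiltonian u + W).IsHermitian := (isHermitian_xyHamiltonian u).add h.herm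

lemma norm_apply_le (u : Torus ν L → ℝ) {σ τ : Spins ν L N → Fin 2} (h : σ ≠ τ)
    (hW : W σ τ = 0) : ‖(xyHamiltonian u + W : SpinOp (Spins ν L N)) σ τ‖ ≤ rate σ τ := by
  rw [Matrix.add_apply, hW, add_zero, xyHamiltonian_apply, if_neg h, zero_sub, norm_neg,
    Complex.norm_real, Real.norm_of_nonneg (rate_nonneg _ _)]

end IsImpurity

/-! ### Distance functions on configurations -/

/-- The largest distance of a particle from `k`. -/
def maxDist (k : Torus ν L) (σ : Spins ν L N → Fin 2) : ℕ :=
  Finset.univ.sup fun x : Torus ν L => if σ (Sum.inl x) = 0 then torusDist x k else 0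

/-- The largest distance of a particle from `k`, with value `M` at configurations with more
than `N` spins up. -/
def cappedDist (k : Torus ν L) (M : ℕ) (σ : Spins ν L N → Fin 2) : ℕ :=
  if ups σ ≤ N then maxDist k σ else M

lemma le_maxDist {k : Torus ν L} {σ : Spins ν L N → Fin 2} {x : Torus ν L}
    (hx : σ (Sum.inl x) = 0) : torusDist x k ≤ maxDist k σ := by
  have := Finset.le_sup (f := fun x : Torus ν L => if σ (Sum.inl x) = 0 then torusDist x k else 0)
    (Finset.mem_univ x)
  rw [if_pos hx] at this
  exact this

lemma exists_of_lt_maxDist {k : Torus ν L} {σ : Spins ν L N → Fin 2} {r : ℕ}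
    (h : r < maxDist k σ) : ∃ x, σ (Sum.inl x) = 0 ∧ r < torusDist x k := by
  obtain ⟨x, _, hx⟩ := Finset.lt_sup_iff.1 h
  by_cases h0 : σ (Sum.inl x) = 0
  · exact ⟨x, h0, by simpa [h0] using hx⟩
  · simp [h0] at hx

/-- A hop displaces a particle by at most one step. This is why all distance functions below change
by at most `1` under hopping. -/
lemma adj_swap {x y z k : Torus ν L} (h : torusDist x y = 1) :
    ∃ z', Equiv.swap (Sum.inl x : Spins ν L N) (Sum.inl y) (Sum.inl z) = Sum.inl z' ∧
      torusDist z k ≤ torusDist z' k + 1 ∧ torusDist z' k ≤ torusDist z k + 1 := by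
  have h' : torusDist y x = 1 := by rwa [torusDist_comm]
  have h1 := torusDist_le_of_adj (k := k) h
  have h2 := torusDist_le_of_adj (k := k) h'
  by_cases hx : z = x
  · subst hx; exact ⟨y, by simp, h1, h2⟩
  · by_cases hy : z = y
    · subst hy; exact ⟨x, by simp, h2, h1⟩
    · refine ⟨z, Equiv.swap_apply_of_ne_of_ne ?_ ?_, by omega, by omega⟩
      · exact fun h => hx (Sum.inl_injective h)
      · exact fun h => hy (Sum.inl_injective h)

lemma maxDist_le_of_rate_ne_zero (k : Torus ν L) {σ τ : Spins ν L N → Fin 2} (h : rate σ τ ≠ 0) :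
    maxDist k τ ≤ maxDist k σ + 1 := by
  obtain ⟨x, y, hxy, _, rfl⟩ := exists_of_rate_ne_zero h
  refine Finset.sup_le fun z _ => ?_
  split_ifs with hz
  · obtain ⟨z', h1, h2, _⟩ := adj_swap (N := N) (z := z) (k := k) hxy
    rw [Function.comp_apply, h1] at hz
    have := le_maxDist (k := k) hz
    omega
  · omega

lemma cappedDist_le_of_rate_ne_zero (k : Torus ν L) (M : ℕ) {σ τ : Spins ν L N → Fin 2}
    (h : rate σ τ ≠ 0) : cappedDist k M τ ≤ cappedDist k M σ + 1 := by
  have := maxDist_le_of_rate_ne_zero k h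
  have h2 := ups_eq_of_rate_ne_zero h
  unfold cappedDist
  split_ifs <;> omega

/-- The coupling only touches a lattice site at distance `0` and conserves the number of spins up.
Functions of the capped distance thus commute with `W`, and no bound on `W` is needed in the
localization errors. -/
lemma IsImpurity.cappedDist_eq {k : Torus ν L} {W : SpinOp (Spins ν L N)} (hW : IsImpurity k W)
    (M : ℕ) {σ τ : Spins ν L N → Fin 2} (h : W σ τ ≠ 0) : cappedDist k M σ = cappedDist k M τ := by
  have h1 : maxDist k σ = maxDist k τ := by
    refine Finset.sup_congr rfl fun x _ => ?_
    by_cases hx : x = k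
    · subst hx; simp [torusDist_self]
    · rw [hW.eq_of_ne_zero h hx]
  rw [cappedDist, cappedDist, h1, hW.ups_eq σ τ h]

/-- The distance of the particles from the sphere of radius `c` around `k`, cut off at `w`. -/
def clearance (k : Torus ν L) (w c : ℕ) (σ : Spins ν L N → Fin 2) : ℕ :=
  Finset.univ.inf' Finset.univ_nonempty fun x : Torus ν L =>
    if σ (Sum.inl x) = 0 then min w ((torusDist x k - c) + (c - torusDist x k)) else w

lemma clearance_le (k : Torus ν L) (w c : ℕ) (σ : Spins ν L N → Fin 2) : clearance k w c σ ≤ w := by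
  have := Finset.inf'_le (fun x : Torus ν L =>
    if σ (Sum.inl x) = 0 then min w ((torusDist x k - c) + (c - torusDist x k)) else w)
    (Finset.mem_univ k)
  refine this.trans ?_
  split_ifs <;> simp

lemma clearance_le_of_up {k : Torus ν L} {w c : ℕ} {σ : Spins ν L N → Fin 2} {x : Torus ν L}
    (hx : σ (Sum.inl x) = 0) : clearance k w c σ ≤ (torusDist x k - c) + (c - torusDist x k) := by
  have := Finset.inf'_le (fun x : Torus ν L =>
    if σ (Sum.inl x) = 0 then min w ((torusDist x k - c) + (c - torusDist x k)) else w)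
    (Finset.mem_univ x)
  refine this.trans ?_
  simp [hx]

lemma eq_or_exists_clearance (k : Torus ν L) (w c : ℕ) (σ : Spins ν L N → Fin 2) :
    clearance k w c σ = w ∨ ∃ x, σ (Sum.inl x) = 0 ∧
      clearance k w c σ = (torusDist x k - c) + (c - torusDist x k) ∧ clearance k w c σ < w := by
  obtain ⟨x, _, hx⟩ := Finset.exists_mem_eq_inf' (Finset.univ_nonempty (α := Torus ν L))
    (fun x : Torus ν L =>
      if σ (Sum.inl x) = 0 then min w ((torusDist x k - c) + (c - torusDist x k)) else w)
  have hx' : clearance k w c σ = _ := hx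
  split_ifs at hx' with h
  · rcases le_or_gt w ((torusDist x k - c) + (c - torusDist x k)) with h1 | h1
    · left; rw [hx', min_eq_left h1]
    · right; exact ⟨x, h, by rw [hx', min_eq_right h1.le], by rw [hx', min_eq_right h1.le]; exact h1⟩
  · left; exact hx'

lemma clearance_le_of_rate_ne_zero (k : Torus ν L) (w c : ℕ) {σ τ : Spins ν L N → Fin 2}
    (h : rate σ τ ≠ 0) : clearance k w c τ ≤ clearance k w c σ + 1 := by
  rw [rate_comm] at h
  obtain ⟨x, y, hxy, _, rfl⟩ := exists_of_rate_ne_zero h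
  rcases eq_or_exists_clearance k w c (τ ∘ Equiv.swap (Sum.inl x) (Sum.inl y)) with h1 | ⟨z, hz, h1, _⟩
  · have := clearance_le k w c τ; omega
  · obtain ⟨z', h2, h3, h4⟩ := adj_swap (N := N) (z := z) (k := k) hxy
    rw [Function.comp_apply, h2] at hz
    have := clearance_le_of_up (k := k) (w := w) (c := c) hz
    omega

/-- Since `w ≤ c`, a particle at `k` itself contributes the cut-off value `w`, the same as no
particle at all. -/
lemma IsImpurity.clearance_eq {k : Torus ν L} {W : SpinOp (Spins ν L N)} (hW : IsImpurity k W)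
    {w c : ℕ} (hc : w ≤ c) {σ τ : Spins ν L N → Fin 2} (h : W σ τ ≠ 0) :
    clearance k w c σ = clearance k w c τ := by
  refine Finset.inf'_congr _ rfl fun x _ => ?_
  by_cases hx : x = k
  · subst hx; simp [torusDist_self, hc]
  · rw [hW.eq_of_ne_zero h hx]

lemma down_of_clearance_pos {k : Torus ν L} {w c : ℕ} {σ : Spins ν L N → Fin 2}
    (h : 0 < clearance k w c σ) {x : Torus ν L} (hx : torusDist x k = c) : σ (Sum.inl x) = 1 := by
  by_contra h1
  have h0 : σ (Sum.inl x) = 0 := by omega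
  have := clearance_le_of_up (k := k) (w := w) (c := c) h0
  omega

/-- One of `N + 1` well separated spheres has full clearance. -/
lemma exists_clearance_eq (k : Torus ν L) (w p : ℕ) {σ : Spins ν L N → Fin 2} (hσ : ups σ ≤ N) :
    ∃ j ∈ Finset.range (N + 1), clearance k w (p + (2 * j + 1) * w) σ = w := by
  by_contra! h
  have h1 : ∀ j : Fin (N + 1), ∃ x, σ (Sum.inl x) = 0 ∧
      (torusDist x k - (p + (2 * j + 1) * w)) + ((p + (2 * j + 1) * w) - torusDist x k) < w := by
    intro j
    rcases eq_or_exists_clearance k w (p + (2 * j + 1) * w) σ with h2 | ⟨x, h2, h3, h4⟩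
    · exact absurd h2 (h j (Finset.mem_range.2 j.2))
    · exact ⟨x, h2, by omega⟩
  choose x hx0 hx using h1
  -- The shells of half-width `w` around the radii `p + (2j+1)w` are disjoint. If all `N + 1` were
  -- occupied, there would be `N + 1` different particles.
  have hmono : ∀ i j : Fin (N + 1), i < j → x i ≠ x j := by
    intro i j hij he
    have h2 := hx i
    have h3 := hx j
    rw [he] at h2
    have h4 : (2 * (i : ℕ) + 1) * w + 2 * w ≤ (2 * (j : ℕ) + 1) * w := by
      rw [← add_mul]
      exact Nat.mul_le_mul_right _ (by have : (i : ℕ) < j := hij; omega)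
    omega
  have hinj : Function.Injective x := by
    intro i j he
    rcases lt_trichotomy i j with h | h | h
    · exact absurd he (hmono i j h)
    · exact h
    · exact absurd he.symm (hmono j i h)
  have hcard : N + 1 ≤ particles σ := by
    have : (Finset.univ.image x).card = N + 1 := by
      rw [Finset.card_image_of_injective _ hinj]; simp
    rw [← this, particles]
    refine Finset.card_le_card fun y hy => ?_
    obtain ⟨i, _, rfl⟩ := Finset.mem_image.1 hy
    simpa using hx0 i
  have := particles_le_ups σ
  omega

end Model

/-! ## Splitting the energy at a sphere around the impurity -/

section FormLemmas

variable {Ω : Type} [Fintype Ω]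

lemma form_zero (v : Ω → ℂ) : form (0 : Matrix Ω Ω ℂ) v = 0 := by simp [form]

lemma form_sum {ι : Type*} (s : Finset ι) (M : ι → Matrix Ω Ω ℂ) (v : Ω → ℂ) :
    form (∑ i ∈ s, M i) v = ∑ i ∈ s, form (M i) v := by
  classical
  induction s using Finset.induction_on with
  | empty => simp [form_zero]
  | insert i s hi ih => rw [Finset.sum_insert hi, Finset.sum_insert hi, form_add, ih]

lemma form_smul_vec (M : Matrix Ω Ω ℂ) (c : ℂ) (v : Ω → ℂ) :
    form M (c • v) = ‖c‖ ^ 2 * form M v := by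
  have : star (c • v) ⬝ᵥ M *ᵥ (c • v) = ((‖c‖ ^ 2 : ℝ) : ℂ) * (star v ⬝ᵥ M *ᵥ v) := by
    rw [star_smul, smul_dotProduct, mulVec_smul, dotProduct_smul, smul_smul, smul_eq_mul,
      Complex.star_def, Complex.conj_mul']
    push_cast; rfl
  rw [form, this, Complex.re_ofReal_mul, form]

lemma form_diagonal_eq_zero [DecidableEq Ω] {d v : Ω → ℂ} (h : ∀ σ, v σ ≠ 0 → d σ = 0) :
    form (diagonal d) v = 0 := by
  have : diagonal d *ᵥ v = 0 := by
    funext σ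
    rw [mulVec_diagonal]
    by_cases hσ : v σ = 0
    · simp [hσ]
    · simp [h σ hσ]
  rw [form, this]; simp

end FormLemmas

section ModelSplit

variable {ν L N : ℕ} [NeZero L]

/-- The hopping between sites in `X`. -/
noncomputable def hopIn (X : Set (Spins ν L N)) : SpinOp (Spins ν L N) :=
  open Classical in ∑ x : Torus ν L, ∑ y : Torus ν L,
    if torusDist x y = 1 ∧ Sum.inl x ∈ X ∧ Sum.inl y ∈ X then hop (Sum.inl x) (Sum.inl y) else 0

/-- The hopping across the boundary of `X`. -/
noncomputable def hopCross (X : Set (Spins ν L N)) : SpinOp (Spins ν L N) :=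
  open Classical in ∑ x : Torus ν L, ∑ y : Torus ν L,
    if torusDist x y = 1 ∧ ¬(Sum.inl x ∈ X ↔ Sum.inl y ∈ X) then hop (Sum.inl x) (Sum.inl y) else 0

/-- The potential energy of the particles in `X`. -/
noncomputable def potIn (X : Set (Spins ν L N)) (u : Torus ν L → ℝ) (σ : Spins ν L N → Fin 2) : ℝ :=
  open Classical in ∑ x : Torus ν L,
    if Sum.inl x ∈ X ∧ σ (Sum.inl x) = 0 then u x + 2 * (ν : ℝ) else 0

/-- The terms of the xy-Hamiltonian in `X`. -/
noncomputable def hamIn (X : Set (Spins ν L N)) (u : Torus ν L → ℝ) : SpinOp (Spins ν L N) :=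
  diagonal (fun σ => (potIn X u σ : ℂ)) - hopIn X

lemma xyHamiltonian_split (X : Set (Spins ν L N)) (u : Torus ν L → ℝ) :
    xyHamiltonian u = hamIn X u + hamIn Xᶜ u - hopCross X := by
  classical
  have h1 : hopSum ν L N = hopIn X + hopIn Xᶜ + hopCross X := by
    simp only [hopSum, hopIn, hopCross, ← Finset.sum_add_distrib]
    refine Finset.sum_congr rfl fun x _ => Finset.sum_congr rfl fun y _ => ?_
    by_cases h : torusDist x y = 1 <;> by_cases hx : (Sum.inl x : Spins ν L N) ∈ X <;>
      by_cases hy : (Sum.inl y : Spins ν L N) ∈ X <;> simp [h, hx, hy]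
  have h2 : diagonal (fun σ : Spins ν L N → Fin 2 => (pot u σ : ℂ)) =
      diagonal (fun σ => (potIn X u σ : ℂ)) + diagonal (fun σ => (potIn Xᶜ u σ : ℂ)) := by
    rw [diagonal_add]
    congr 1
    funext σ
    rw [← Complex.ofReal_add, pot, potIn, potIn, ← Finset.sum_add_distrib]
    congr 1
    refine Finset.sum_congr rfl fun x _ => ?_
    by_cases hx : (Sum.inl x : Spins ν L N) ∈ X <;> simp [hx]
  rw [xyHamiltonian_eq, h1, h2, hamIn, hamIn]
  abel

lemma isLocal_hamIn (X : Set (Spins ν L N)) (u : Torus ν L → ℝ) : IsLocal X (hamIn X u) := by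
  classical
  rw [hamIn, sub_eq_add_neg]
  refine (isLocal_diagonal fun σ => ?_).add (IsLocal.neg ?_)
  · congr 1
    refine Finset.sum_congr rfl fun x _ => ?_
    by_cases hx : (Sum.inl x : Spins ν L N) ∈ X
    · rw [res_of_mem hx]
    · simp [hx]
  · refine IsLocal.sum _ fun x _ => IsLocal.sum _ fun y _ => ?_
    split_ifs with h
    · exact isLocal_hop h.2.1 h.2.2
    · exact isLocal_zero X

lemma form_hamIn_eq_zero {X : Set (Spins ν L N)} (u : Torus ν L → ℝ)
    {w : (Spins ν L N → Fin 2) → ℂ} (hw : ∀ σ, w σ ≠ 0 → ∀ v ∈ X, σ v = 1) :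
    form (hamIn X u) w = 0 := by
  classical
  rw [hamIn, form_sub, form_diagonal_eq_zero, hopIn, form_sum, zero_sub, neg_eq_zero]
  · refine Finset.sum_eq_zero fun x _ => ?_
    rw [form_sum]
    refine Finset.sum_eq_zero fun y _ => ?_
    split_ifs with h
    · exact form_hop_eq_zero fun σ hσ _ => by rw [hw σ hσ _ h.2.1, hw σ hσ _ h.2.2]
    · exact form_zero _
  · intro σ hσ
    rw [potIn]
    have : ∀ x : Torus ν L, (if Sum.inl x ∈ X ∧ σ (Sum.inl x) = 0 then u x + 2 * (ν : ℝ) else 0) =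
        0 := by
      intro x
      refine if_neg fun h => ?_
      have := hw σ hσ _ h.1
      rw [h.2] at this
      exact absurd this (by decide)
    simp [this]

lemma form_hopCross_eq_zero {X : Set (Spins ν L N)} {w : (Spins ν L N → Fin 2) → ℂ}
    (hw : ∀ x y, torusDist x y = 1 → (Sum.inl x : Spins ν L N) ∈ X → (Sum.inl y : Spins ν L N) ∉ X →
      ∀ σ, w σ ≠ 0 → w (σ ∘ Equiv.swap (Sum.inl x) (Sum.inl y)) ≠ 0 →
        σ (Sum.inl x) = σ (Sum.inl y)) :
    form (hopCross X) w = 0 := by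
  classical
  rw [hopCross, form_sum]
  refine Finset.sum_eq_zero fun x _ => ?_
  rw [form_sum]
  refine Finset.sum_eq_zero fun y _ => ?_
  split_ifs with h
  · refine form_hop_eq_zero fun σ hσ hσ' => ?_
    by_cases hx : (Sum.inl x : Spins ν L N) ∈ X
    · have hy : (Sum.inl y : Spins ν L N) ∉ X := fun hy => h.2 ⟨fun _ => hy, fun _ => hx⟩
      exact hw x y h.1 hx hy σ hσ hσ'
    · have hy : (Sum.inl y : Spins ν L N) ∈ X := by
        by_contra hy; exact h.2 ⟨fun h' => absurd h' hx, fun h' => absurd h' hy⟩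
      rw [Equiv.swap_comm] at hσ'
      exact (hw y x (by rw [torusDist_comm]; exact h.1) hy hx σ hσ hσ').symm
  · exact form_zero _

/-- The spins within distance `c` of the impurity site, including the impurity. -/
def spinBall (k : Torus ν L) (c : ℕ) : Set (Spins ν L N) :=
  {v | match v with
    | Sum.inl x => torusDist x k ≤ c
    | Sum.inr _ => True}

lemma inl_mem_spinBall {k x : Torus ν L} {c : ℕ} :
    (Sum.inl x : Spins ν L N) ∈ spinBall k c ↔ torusDist x k ≤ c := Iff.rfl

lemma inr_mem_spinBall {k : Torus ν L} {c : ℕ} {i : Fin N} :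
    (Sum.inr i : Spins ν L N) ∈ spinBall k c := trivial

lemma impuritySpins_subset_spinBall (k : Torus ν L) (c : ℕ) :
    (impuritySpins k : Set (Spins ν L N)) ⊆ spinBall k c := by
  rintro (x | i) h
  · have : x = k := h
    subst this
    simp [inl_mem_spinBall, torusDist_self]
  · exact inr_mem_spinBall

lemma form_hopCross_eq_zero_of_outside_down {X : Set (Spins ν L N)}
    {w : (Spins ν L N → Fin 2) → ℂ} (hw : ∀ σ, w σ ≠ 0 → ∀ v ∉ X, σ v = 1) :
    form (hopCross X) w = 0 := by
  refine form_hopCross_eq_zero fun x y hxy hx hy σ hσ => ?_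
  intro hσ'
  have h4 := hw _ hσ' _ hy
  rw [Function.comp_apply, Equiv.swap_apply_right] at h4
  rw [hw σ hσ _ hy, h4]

lemma form_hopCross_eq_zero_of_inside_down {X : Set (Spins ν L N)}
    {w : (Spins ν L N → Fin 2) → ℂ} (hw : ∀ σ, w σ ≠ 0 → ∀ x y, torusDist x y = 1 →
      (Sum.inl x : Spins ν L N) ∈ X → (Sum.inl y : Spins ν L N) ∉ X → σ (Sum.inl x) = 1) :
    form (hopCross X) w = 0 := by
  refine form_hopCross_eq_zero fun x y hxy hx hy σ hσ => ?_
  intro hσ'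
  have h4 := hw _ hσ' x y hxy hx hy
  rw [Function.comp_apply, Equiv.swap_apply_left] at h4
  rw [hw σ hσ x y hxy hx hy, h4]

/-- With no particle on the inner boundary of `X`, hopping across the boundary has no expectation: a
hop in either direction would involve such a configuration. The remaining terms are local in `X` or
in `Xᶜ`. -/
lemma form_split_set {W : SpinOp (Spins ν L N)} (u : Torus ν L → ℝ)
    {X : Set (Spins ν L N)} (hW : IsLocal X W) {v : (Spins ν L N → Fin 2) → ℂ}
    (hv : ∀ σ, v σ ≠ 0 → ∀ x y, torusDist x y = 1 →
      (Sum.inl x : Spins ν L N) ∈ X → (Sum.inl y : Spins ν L N) ∉ X → σ (Sum.inl x) = 1) :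
    form (xyHamiltonian u + W) v =
      ∑ b ∈ inside Xᶜ, form (xyHamiltonian u + W) (slice X v b) +
      ∑ a ∈ inside X, form (xyHamiltonian u) (slice Xᶜ v a) := by
  have hsplit := xyHamiltonian_split X u
  have e0 : form (xyHamiltonian u + W) v = form (hamIn X u + W) v + form (hamIn Xᶜ u) v := by
    rw [form_add, hsplit, form_sub, form_add, form_add,
      form_hopCross_eq_zero_of_inside_down hv]
    ring
  -- A slice has all spins outside of `X` down, so the terms outside and across can be added back
  -- for free.
  have e1 : ∀ b ∈ inside Xᶜ, form (hamIn X u + W) (slice X v b) =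
      form (xyHamiltonian u + W) (slice X v b) := by
    intro b _
    have hs : ∀ σ, slice X v b σ ≠ 0 → ∀ v ∉ X, σ v = 1 := fun σ hσ =>
      mem_inside.1 (mem_inside_of_slice_ne_zero hσ)
    rw [form_add, form_add, hsplit, form_sub, form_add,
      form_hopCross_eq_zero_of_outside_down hs, form_hamIn_eq_zero u (X := Xᶜ) hs]
    ring
  have e2 : ∀ a ∈ inside X, form (hamIn Xᶜ u) (slice Xᶜ v a) =
      form (xyHamiltonian u) (slice Xᶜ v a) := by
    intro a _
    have hs : ∀ σ, slice Xᶜ v a σ ≠ 0 → ∀ v ∈ X, σ v = 1 := fun σ hσ w hw =>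
      mem_inside.1 (mem_inside_of_slice_ne_zero hσ) w (by simpa using hw)
    rw [hsplit, form_sub, form_add,
      form_hopCross_eq_zero_of_inside_down fun σ hσ x _ _ hx _ => hs σ hσ _ hx,
      form_hamIn_eq_zero u (X := X) hs]
    ring
  have e3 := (isLocal_hamIn Xᶜ u).form_eq v
  rw [compl_compl] at e3
  rw [e0, ((isLocal_hamIn X u).add hW).form_eq v, e3, Finset.sum_congr rfl e1,
    Finset.sum_congr rfl e2]

/-- A vector without particles at distance `c` from `k` has no energy of interaction between the
inside and the outside of the sphere of radius `c`. -/
theorem form_split {k : Torus ν L} {W : SpinOp (Spins ν L N)} (hW : IsImpurity k W)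
    (u : Torus ν L → ℝ) (c : ℕ) {v : (Spins ν L N → Fin 2) → ℂ}
    (hv : ∀ σ, v σ ≠ 0 → ∀ x, torusDist x k = c → σ (Sum.inl x) = 1) :
    form (xyHamiltonian u + W) v =
      ∑ b ∈ inside (spinBall k c)ᶜ, form (xyHamiltonian u + W) (slice (spinBall k c) v b) +
      ∑ a ∈ inside (spinBall k c), form (xyHamiltonian u) (slice (spinBall k c)ᶜ v a) := by
  refine form_split_set u (hW.supp.isLocal (impuritySpins_subset_spinBall k c)) ?_
  intro σ hσ x y hxy hx hy
  have h2 := torusDist_le_of_adj (k := k) (x := y) (y := x) (by rwa [torusDist_comm])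
  rw [inl_mem_spinBall] at hx hy
  exact hv σ hσ x (by omega)

lemma sum_nsq_slice_compl (X : Set (Spins ν L N)) (v : (Spins ν L N → Fin 2) → ℂ) :
    ∑ a ∈ inside X, nsq (slice Xᶜ v a) = nsq v := by
  have := sum_nsq_slice Xᶜ v
  rwa [compl_compl] at this

lemma nsq_prodVec {X : Set (Spins ν L N)} {χ φ : (Spins ν L N → Fin 2) → ℂ}
    (hχ : ∀ a ∉ inside X, χ a = 0) (hφ : ∀ b ∉ inside Xᶜ, φ b = 0) :
    nsq (prodVec X χ φ) = nsq φ * nsq χ := by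
  rw [← sum_nsq_slice X]
  have : ∀ b ∈ inside Xᶜ, nsq (slice X (prodVec X χ φ) b) = ‖φ b‖ ^ 2 * nsq χ := fun b hb => by
    rw [slice_prodVec hχ hb, nsq_smul]
  rw [Finset.sum_congr rfl this, ← Finset.sum_mul, sum_inside Xᶜ (fun b => ‖φ b‖ ^ 2)
    fun b hb => by rw [hφ b hb]; simp]
  rfl

/-- The energy of a product of a vector inside of a sphere and a vector outside. -/
lemma form_prodVec {k : Torus ν L} {W : SpinOp (Spins ν L N)} (hW : IsImpurity k W)
    (u : Torus ν L → ℝ) (c : ℕ) {χ φ : (Spins ν L N → Fin 2) → ℂ}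
    (hχ : ∀ a ∉ inside (spinBall k c), χ a = 0)
    (hχ' : ∀ σ, χ σ ≠ 0 → ∀ x, torusDist x k = c → σ (Sum.inl x) = 1)
    (hφ : ∀ b ∉ inside (spinBall k c)ᶜ, φ b = 0) :
    form (xyHamiltonian u + W) (prodVec (spinBall k c) χ φ) =
      nsq φ * form (xyHamiltonian u + W) χ + nsq χ * form (xyHamiltonian u) φ := by
  rw [form_split hW u c]
  · have h1 : ∀ b ∈ inside (spinBall k c)ᶜ, form (xyHamiltonian u + W)
        (slice (spinBall k c) (prodVec (spinBall k c) χ φ) b) =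
        ‖φ b‖ ^ 2 * form (xyHamiltonian u + W) χ := fun b hb => by
      rw [slice_prodVec hχ hb, form_smul_vec]
    have h2 : ∀ a ∈ inside (spinBall k c), form (xyHamiltonian u)
        (slice (spinBall k c)ᶜ (prodVec (spinBall k c) χ φ) a) =
        ‖χ a‖ ^ 2 * form (xyHamiltonian u) φ := fun a ha => by
      rw [slice_compl_prodVec hφ ha, form_smul_vec]
    rw [Finset.sum_congr rfl h1, Finset.sum_congr rfl h2, ← Finset.sum_mul, ← Finset.sum_mul,
      sum_inside _ (fun b => ‖φ b‖ ^ 2) fun b hb => by rw [hφ b hb]; simp,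
      sum_inside _ (fun a => ‖χ a‖ ^ 2) fun a ha => by rw [hχ a ha]; simp]
    rfl
  · intro σ hσ x hx
    have h1 : χ (res (spinBall k c) σ) ≠ 0 := fun h => hσ (by simp [prodVec, h])
    have := hχ' _ h1 x hx
    rwa [res_of_mem (by rw [inl_mem_spinBall]; omega)] at this

end ModelSplit

/-! ## Ground states near the impurity -/

section Decoupling

variable {Ω : Type} [Fintype Ω]

/-- All cross terms vanish. With `A = 1` this is also the additivity of the squared norm for vectors
of disjoint support. -/
lemma form_sum_vec {ι : Type*} [Fintype ι] (A : Matrix Ω Ω ℂ) (φ : ι → Ω → ℂ)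
    (h : ∀ i j, i ≠ j → ∀ σ τ, φ i σ ≠ 0 → φ j τ ≠ 0 → A σ τ = 0) :
    form A (∑ i, φ i) = ∑ i, form A (φ i) := by
  classical
  have h1 : star (∑ i, φ i) ⬝ᵥ A *ᵥ (∑ i, φ i) = ∑ i, star (φ i) ⬝ᵥ A *ᵥ φ i := by
    rw [star_sum, mulVec_sum, sum_dotProduct]
    refine Finset.sum_congr rfl fun i _ => ?_
    rw [dotProduct_sum, Finset.sum_eq_single i]
    · intro j _ hj
      simp only [dotProduct, mulVec, Finset.mul_sum]
      refine Finset.sum_eq_zero fun σ _ => Finset.sum_eq_zero fun τ _ => ?_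
      by_cases h2 : φ i σ = 0
      · simp [h2]
      · by_cases h3 : φ j τ = 0
        · simp [h3]
        · simp [h i j hj.symm σ τ h2 h3]
    · simp
  rw [form, h1, Complex.re_sum]; rfl

lemma nsq_eq_form_one [DecidableEq Ω] (v : Ω → ℂ) : nsq v = form 1 v := by
  rw [form, one_mulVec, star_dotProduct_self, Complex.ofReal_re]

lemma form_eq_of_eigen {A : Matrix Ω Ω ℂ} {ψ : Ω → ℂ} {e : ℝ}
    (h : ∀ σ, ψ σ ≠ 0 → (A *ᵥ ψ) σ = e * ψ σ) : form A ψ = e * nsq ψ := by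
  have h1 : star ψ ⬝ᵥ A *ᵥ ψ = (e : ℂ) * (star ψ ⬝ᵥ ψ) := by
    simp only [dotProduct, Finset.mul_sum]
    refine Finset.sum_congr rfl fun σ _ => ?_
    by_cases hσ : ψ σ = 0
    · simp [hσ]
    · rw [h σ hσ]; ring
  rw [form, h1, star_dotProduct_self, ← Complex.ofReal_mul, Complex.ofReal_re]

end Decoupling

/-! ### Cutoffs around empty spheres and the near ground state -/

section Spectral

variable {ν L N : ℕ} [NeZero L]

lemma sum_rate_mul_le {σ : Spins ν L N → Fin 2} (hσ : ups σ ≤ N) {a : (Spins ν L N → Fin 2) → ℝ}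
    {A : ℝ} (hA : 0 ≤ A) (h : ∀ τ, rate σ τ ≠ 0 → a τ ≤ A) :
    ∑ τ, rate σ τ * a τ ≤ 2 * ν * N * A := by
  calc ∑ τ, rate σ τ * a τ ≤ ∑ τ, rate σ τ * A := by
        refine Finset.sum_le_sum fun τ _ => ?_
        by_cases h0 : rate σ τ = 0
        · simp [h0]
        · exact mul_le_mul_of_nonneg_left (h τ h0) (rate_nonneg _ _)
    _ = (∑ τ, rate σ τ) * A := by rw [Finset.sum_mul]
    _ ≤ 2 * ν * particles σ * A := by gcongr; exact sum_rate_le σ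
    _ ≤ _ := by
        have : (particles σ : ℝ) ≤ N := by exact_mod_cast (particles_le_ups σ).trans hσ
        gcongr

lemma abs_natCast_sub_div_le {a b : ℕ} (h1 : a ≤ b + 1) (h2 : b ≤ a + 1) {w : ℝ} (hw : 0 < w) :
    |(a : ℝ) / w - b / w| ≤ 1 / w := by
  have h1' : (a : ℝ) ≤ b + 1 := by exact_mod_cast h1
  have h2' : (b : ℝ) ≤ a + 1 := by exact_mod_cast h2
  rw [← sub_div, abs_div, abs_of_pos hw]
  gcongr
  rw [abs_le]
  constructor <;> linarith

/-- The clearance, normalized to `1`. -/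
noncomputable def clearFn (k : Torus ν L) (w c : ℕ) (σ : Spins ν L N → Fin 2) : ℝ :=
  (clearance k w c σ : ℝ) / w

lemma clearFn_sub_le (k : Torus ν L) {w : ℕ} (hw : 0 < w) (c : ℕ) {σ τ : Spins ν L N → Fin 2}
    (h : rate σ τ ≠ 0) : |clearFn k w c σ - clearFn k w c τ| ≤ 1 / w :=
  abs_natCast_sub_div_le (clearance_le_of_rate_ne_zero k w c (by rwa [rate_comm]))
    (clearance_le_of_rate_ne_zero k w c h) (by exact_mod_cast hw)

lemma clearFn_nonneg (k : Torus ν L) (w c : ℕ) (σ : Spins ν L N → Fin 2) : 0 ≤ clearFn k w c σ := by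
  unfold clearFn; positivity

lemma clearFn_le_one (k : Torus ν L) {w : ℕ} (hw : 0 < w) (c : ℕ) (σ : Spins ν L N → Fin 2) :
    clearFn k w c σ ≤ 1 := by
  rw [clearFn, div_le_one (by exact_mod_cast hw)]
  exact_mod_cast clearance_le k w c σ

lemma clearance_pos_of_clearFn_ne_zero {k : Torus ν L} {w c : ℕ} {σ : Spins ν L N → Fin 2}
    (h : clearFn k w c σ ≠ 0) : 0 < clearance k w c σ := by
  by_contra h'
  have : clearance k w c σ = 0 := by omega
  simp [clearFn, this] at h

lemma one_le_sum_clearFn_sq (k : Torus ν L) {w : ℕ} (hw : 0 < w) (p : ℕ)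
    {σ : Spins ν L N → Fin 2} (hσ : ups σ ≤ N) :
    1 ≤ ∑ j ∈ Finset.range (N + 1), clearFn k w (p + (2 * j + 1) * w) σ ^ 2 := by
  obtain ⟨j, hj, h⟩ := exists_clearance_eq k w p hσ
  refine le_trans ?_ (Finset.single_le_sum
    (f := fun j => clearFn k w (p + (2 * j + 1) * w) σ ^ 2) (fun i _ => sq_nonneg _) hj)
  have hw' : (w : ℝ) ≠ 0 := by exact_mod_cast hw.ne'
  simp [clearFn, h, hw']

/-- Localization of a ground state among the configurations with at most `N` spins up
near the impurity. -/
lemma exists_near_groundState {k : Torus ν L} {W : SpinOp (Spins ν L N)} (hW : IsImpurity k W)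
    {u : Torus ν L → ℝ} (hu : ∀ x, 0 ≤ u x) {w : ℕ} (hw : 0 < w) {δ : ℝ}
    (hδ : (N + 1) * (2 * ν * N) / (2 * w ^ 2) < δ) :
    ∃ ε : ℝ, (∀ φ : (Spins ν L N → Fin 2) → ℂ, (∀ σ, φ σ ≠ 0 → ups σ ≤ N) →
        ε * nsq φ ≤ form (xyHamiltonian u + W) φ) ∧
      ∃ c ≤ (2 * N + 1) * w, ∃ χ : (Spins ν L N → Fin 2) → ℂ, χ ≠ 0 ∧
        (∀ a ∉ inside (spinBall k c), χ a = 0) ∧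
        (∀ σ, χ σ ≠ 0 → ∀ x, torusDist x k = c → σ (Sum.inl x) = 1) ∧
        form (xyHamiltonian u + W) χ ≤ (ε + δ) * nsq χ := by
  set H : SpinOp (Spins ν L N) := xyHamiltonian u + W with hH
  have hHh : H.IsHermitian := hW.isHermitian_add u
  have hne : ({σ | ups σ ≤ N} : Set (Spins ν L N → Fin 2)).Nonempty :=
    ⟨fun _ => 1, by simp [ups]⟩
  obtain ⟨ε, ψ, hψ0, hψ1, hψe, hε⟩ := exists_groundState hHh _ hne
  refine ⟨ε, fun φ hφ => hε φ fun σ hσ => by_contra fun h => hσ (hφ σ h), ?_⟩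
  have hψu : ∀ σ, ψ σ ≠ 0 → ups σ ≤ N := fun σ h => by
    by_contra h'; exact h (hψ0 σ h')
  -- Cutoffs to configurations avoiding the sphere of radius `(2j+1)w`. Their slope under hopping is
  -- `1/w`, and at each configuration that matters one of them equals `1`.
  let f : ℕ → (Spins ν L N → Fin 2) → ℝ := fun j => clearFn k w ((2 * j + 1) * w)
  have hwr : (0 : ℝ) < w := by exact_mod_cast hw
  have hform : ∀ j, form H (mulFn (f j) ψ) ≤
      ε * nsq (mulFn (f j) ψ) + (2 * ν * N) / (2 * w ^ 2) := by
    intro j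
    have h1 := form_mulFn_le hHh rate_nonneg rate_comm (f := f j) (v := ψ) (e := ε) ?_ ?_
    · refine h1.trans ?_
      gcongr
      calc (1 / 2) * ∑ σ, (∑ τ, rate σ τ * (f j σ - f j τ) ^ 2) * ‖ψ σ‖ ^ 2
          ≤ (1 / 2) * ∑ σ, (2 * ν * N * (1 / w) ^ 2) * ‖ψ σ‖ ^ 2 := by
            gcongr (1 / 2) * ?_
            refine Finset.sum_le_sum fun σ _ => ?_
            by_cases h0 : ψ σ = 0
            · simp [h0]
            · gcongr
              refine sum_rate_mul_le (hψu σ h0) (by positivity) fun τ hτ => ?_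
              exact sq_le_sq' (neg_le_of_abs_le (clearFn_sub_le k hw _ hτ))
                (le_of_abs_le (clearFn_sub_le k hw _ hτ))
        _ = (2 * ν * N) / (2 * w ^ 2) := by
            rw [← Finset.mul_sum]
            have : ∑ σ, ‖ψ σ‖ ^ 2 = 1 := hψ1
            rw [this]; field_simp
    · intro σ τ hστ
      refine IsImpurity.norm_apply_le u (fun h => hστ (by rw [h])) ?_
      by_contra hne
      apply hστ
      simp only [f, clearFn]
      rw [hW.clearance_eq (w := w) (by nlinarith) hne]
    · intro σ _ hσ
      exact hψe σ (hψu σ hσ)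
  have hsum : 1 ≤ ∑ j ∈ Finset.range (N + 1), nsq (mulFn (f j) ψ) := by
    simp only [nsq_mulFn]
    rw [Finset.sum_comm, ← hψ1, nsq]
    refine Finset.sum_le_sum fun σ _ => ?_
    rw [← Finset.sum_mul]
    by_cases h0 : ψ σ = 0
    · simp [h0]
    · have := one_le_sum_clearFn_sq k hw 0 (hψu σ h0)
      simp only [zero_add] at this
      exact le_mul_of_one_le_left (by positivity) this
  have hδ0 : 0 < δ := lt_of_le_of_lt (by positivity) hδ
  -- The localization errors add up to less than `δ` and the squared norms to at least `1`, so some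
  -- cutoff raises the energy per norm by less than `δ`.
  obtain ⟨j, hj, hlt⟩ : ∃ j ∈ Finset.range (N + 1), form H (mulFn (f j) ψ) <
      (ε + δ) * nsq (mulFn (f j) ψ) := by
    refine Finset.exists_lt_of_sum_lt ?_
    calc ∑ j ∈ Finset.range (N + 1), form H (mulFn (f j) ψ)
        ≤ ∑ j ∈ Finset.range (N + 1), (ε * nsq (mulFn (f j) ψ) + (2 * ν * N) / (2 * w ^ 2)) :=
          Finset.sum_le_sum fun j _ => hform j
      _ = ε * ∑ j ∈ Finset.range (N + 1), nsq (mulFn (f j) ψ) +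
          (N + 1) * (2 * ν * N) / (2 * w ^ 2) := by
          rw [Finset.sum_add_distrib, ← Finset.mul_sum, Finset.sum_const, Finset.card_range,
            nsmul_eq_mul]
          push_cast; ring
      _ < ε * ∑ j ∈ Finset.range (N + 1), nsq (mulFn (f j) ψ) + δ := by gcongr
      _ ≤ _ := by rw [← Finset.mul_sum]; nlinarith
  set c := (2 * j + 1) * w with hc
  have hcle : c ≤ (2 * N + 1) * w := by
    rw [hc]; gcongr; have := Finset.mem_range.1 hj; omega
  set v := mulFn (f j) ψ with hv
  have hvc : ∀ σ, v σ ≠ 0 → ∀ x, torusDist x k = c → σ (Sum.inl x) = 1 := by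
    intro σ hσ x hx
    have : clearFn k w c σ ≠ 0 := fun h => hσ (by simp [hv, mulFn, f, ← hc, h])
    exact down_of_clearance_pos (clearance_pos_of_clearFn_ne_zero this) hx
  have hsp := form_split hW u c hvc
  -- The outside energy is nonnegative and can be dropped; then some slice inside the ball is at
  -- least as good as the whole vector.
  have h2 : 0 ≤ ∑ a ∈ inside (spinBall k c), form (xyHamiltonian u) (slice (spinBall k c)ᶜ v a) :=
    Finset.sum_nonneg fun a _ => form_xyHamiltonian_nonneg hu _
  obtain ⟨b, hb, hlt'⟩ : ∃ b ∈ inside (spinBall k c)ᶜ, form H (slice (spinBall k c) v b) <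
      (ε + δ) * nsq (slice (spinBall k c) v b) := by
    refine Finset.exists_lt_of_sum_lt ?_
    rw [← Finset.mul_sum, sum_nsq_slice]
    linarith
  refine ⟨c, hcle, slice (spinBall k c) v b, ?_, fun a ha => slice_of_not_mem ha, ?_, hlt'.le⟩
  · intro h0
    rw [h0] at hlt'
    simp [form, nsq] at hlt'
  · intro σ hσ x hx
    have hin := mem_inside_of_slice_ne_zero hσ
    rw [slice_of_mem hin] at hσ
    have := hvc _ hσ x hx
    rwa [comb_of_mem (by rw [inl_mem_spinBall]; omega)] at this

end Spectral

/-! ## The vacuum sector -/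

section Vacuum

variable {ν L N : ℕ} [NeZero L]

lemma particles_eq_zero_iff {σ : Spins ν L N → Fin 2} :
    particles σ = 0 ↔ ∀ x : Torus ν L, σ (Sum.inl x) = 1 := by
  rw [particles, Finset.card_eq_zero, Finset.filter_eq_empty_iff]
  constructor
  · intro h x
    have := h (Finset.mem_univ x)
    omega
  · intro h x _ h'
    rw [h x] at h'
    exact absurd h' (by decide)

lemma card_vacuum :
    (Finset.univ.filter fun σ : Spins ν L N → Fin 2 => particles σ = 0).card = 2 ^ N := by
  rw [show (2 : ℕ) ^ N = Fintype.card (Fin N → Fin 2) by simp, ← Finset.card_univ]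
  refine Finset.card_bij' (fun σ _ => fun i => σ (Sum.inr i)) (fun τ _ => Sum.elim (fun _ => 1) τ)
    (fun _ _ => Finset.mem_univ _) ?_ ?_ ?_
  · intro τ _
    simp [particles_eq_zero_iff]
  · intro σ hσ
    rw [Finset.mem_filter, particles_eq_zero_iff] at hσ
    ext (x | i)
    · simp [hσ.2 x]
    · rfl
  · intro τ _
    rfl

lemma rate_eq_zero_of_particles {σ : Spins ν L N → Fin 2} (h : particles σ = 0)
    (τ : Spins ν L N → Fin 2) : rate σ τ = 0 := by
  have h1 := sum_rate_le σ
  rw [h, Nat.cast_zero, mul_zero] at h1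
  have h2 := Finset.single_le_sum (f := fun τ => rate σ τ) (fun τ _ => rate_nonneg σ τ)
    (Finset.mem_univ τ)
  exact le_antisymm (h2.trans h1) (rate_nonneg _ _)

lemma xyHamiltonian_apply_vacuum (u : Torus ν L → ℝ) {σ : Spins ν L N → Fin 2}
    (h : particles σ = 0) (τ : Spins ν L N → Fin 2) : xyHamiltonian u τ σ = 0 := by
  rw [xyHamiltonian_apply, rate_comm, rate_eq_zero_of_particles h]
  have : pot u σ = 0 := Finset.sum_eq_zero fun x _ => by
    rw [if_neg]
    rw [particles_eq_zero_iff.1 h x]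
    decide
  split_ifs with h1
  · rw [h1, this]; simp
  · simp

lemma coef_single {Ω : Type} [Fintype Ω] [DecidableEq Ω] {A : Matrix Ω Ω ℂ} (E : EigenBasis A)
    (σ i : Ω) : E.coef (Pi.single σ 1) i = star (E.vec i σ) := by
  simp [EigenBasis.coef]

variable {u : Torus ν L → ℝ} {P : SpinOp (Spins ν L N)} {m g : ℝ}

lemma top_nonneg (hu : ∀ x, 0 ≤ u x) (E : LowSector (xyHamiltonian u) P m g) : 0 ≤ m := by
  obtain ⟨i, _, hi⟩ := E.attained
  have h := form_xyHamiltonian_nonneg hu (E.vec i)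
  rwa [form_eq_of_eigen (e := m), E.nsq_vec, mul_one] at h
  intro σ _
  rw [E.eig, hi]; rfl

/-- Vacuum configurations lie in the kernel of the Hamiltonian, whereas eigenvectors above the gap
have positive eigenvalue, hence they are orthogonal. -/
lemma vec_eq_zero_of_vacuum (hu : ∀ x, 0 ≤ u x) (hg : 0 < g)
    (E : LowSector (xyHamiltonian u) P m g) {i : Spins ν L N → Fin 2} (hi : i ∉ E.idx)
    {σ : Spins ν L N → Fin 2} (hσ : particles σ = 0) : E.vec i σ = 0 := by
  have h1 := E.coef_mulVec (Pi.single σ 1) i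
  have h2 : xyHamiltonian u *ᵥ Pi.single σ 1 = 0 := by
    ext τ
    simp [xyHamiltonian_apply_vacuum u hσ]
  rw [h2, coef_single] at h1
  have h3 : (0 : ℝ) < E.val i := by
    have := E.le_val i hi; have := top_nonneg hu E; linarith
  have h4 : (E.val i : ℂ) * star (E.vec i σ) = 0 := by
    rw [← h1]; simp [EigenBasis.coef]
  rcases mul_eq_zero.1 h4 with h5 | h5
  · exact absurd (by exact_mod_cast h5) h3.ne'
  · exact star_eq_zero.1 h5

/-- The low-lying eigenvectors have total weight `2^N`. Each of the `2^N` vacuum configurations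
already takes up weight `1`, since it expands in these eigenvectors only, so no weight is left
elsewhere. -/
lemma vec_eq_zero_of_not_vacuum (hu : ∀ x, 0 ≤ u x) (hg : 0 < g)
    (E : LowSector (xyHamiltonian u) P m g) (hr : P.rank = 2 ^ N)
    {i : Spins ν L N → Fin 2} (hi : i ∈ E.idx) {τ : Spins ν L N → Fin 2} (hτ : particles τ ≠ 0) :
    E.vec i τ = 0 := by
  have h1 : ∑ i ∈ E.idx, ∑ σ, ‖E.vec i σ‖ ^ 2 = 2 ^ N := by
    have : ∀ i, ∑ σ, ‖E.vec i σ‖ ^ 2 = 1 := fun i => E.nsq_vec i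
    simp only [this]
    rw [Finset.sum_const, E.card_idx, hr]; simp
  have h2 : ∑ i ∈ E.idx, ∑ σ with particles σ = 0, ‖E.vec i σ‖ ^ 2 = 2 ^ N := by
    rw [Finset.sum_comm]
    have : ∀ σ : Spins ν L N → Fin 2, particles σ = 0 → ∑ i ∈ E.idx, ‖E.vec i σ‖ ^ 2 = 1 := by
      intro σ hσ
      rw [Finset.sum_subset (Finset.subset_univ E.idx)
        (fun i _ hi => by rw [vec_eq_zero_of_vacuum hu hg E hi hσ]; simp)]
      have h3 := E.nsq_eq (Pi.single σ 1)
      simp only [coef_single, norm_star] at h3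
      rw [← h3, nsq, Finset.sum_eq_single σ]
      · simp
      · intro τ _ h; simp [h]
      · simp
    rw [Finset.sum_congr rfl fun σ hσ => this σ (Finset.mem_filter.1 hσ).2, Finset.sum_const,
      card_vacuum]
    simp
  have h3 : ∑ i ∈ E.idx, ∑ σ with ¬ particles σ = 0, ‖E.vec i σ‖ ^ 2 = 0 := by
    have : ∀ i, ∑ σ with ¬ particles σ = 0, ‖E.vec i σ‖ ^ 2 = ∑ σ, ‖E.vec i σ‖ ^ 2 -
        ∑ σ with particles σ = 0, ‖E.vec i σ‖ ^ 2 := by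
      intro i
      rw [← Finset.sum_filter_add_sum_filter_not Finset.univ (fun σ => particles σ = 0)]
      ring
    simp only [this, Finset.sum_sub_distrib, h1, h2, sub_self]
  rw [Finset.sum_eq_zero_iff_of_nonneg fun i _ => Finset.sum_nonneg fun σ _ => by positivity] at h3
  have h4 := h3 i hi
  rw [Finset.sum_eq_zero_iff_of_nonneg fun σ _ => by positivity] at h4
  simpa using h4 τ (by simpa using hτ)

/-- Without coupling the low-lying sector is the vacuum sector. -/
lemma proj_eq_vacuum (hu : ∀ x, 0 ≤ u x) (hg : 0 < g)
    (E : LowSector (xyHamiltonian u) P m g) (hr : P.rank = 2 ^ N) :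
    P = diagonal fun σ => if particles σ = 0 then 1 else 0 := by
  ext τ σ
  have h1 : P τ σ = (P *ᵥ Pi.single σ 1) τ := by simp
  have h2 : P *ᵥ Pi.single σ 1 = if particles σ = 0 then Pi.single σ 1 else 0 := by
    refine E.ext_coef fun i => ?_
    rw [E.coef_proj]
    split_ifs with h3 h4 h4
    · rfl
    · rw [coef_single, vec_eq_zero_of_not_vacuum hu hg E hr h3 h4]
      simp [EigenBasis.coef]
    · rw [coef_single, vec_eq_zero_of_vacuum hu hg E h3 h4]; simp
    · simp [EigenBasis.coef]
  rw [h1, h2, diagonal_apply]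
  by_cases h : τ = σ
  · subst h
    by_cases h3 : particles τ = 0 <;> simp [h3]
  · split_ifs <;> simp [h]

lemma top_eq_zero (hu : ∀ x, 0 ≤ u x) (hg : 0 < g)
    (E : LowSector (xyHamiltonian u) P m g) (hr : P.rank = 2 ^ N) : m = 0 := by
  obtain ⟨i, hi, hm⟩ := E.attained
  have h1 : xyHamiltonian u *ᵥ E.vec i = 0 := by
    ext τ
    refine Finset.sum_eq_zero fun σ _ => ?_
    change xyHamiltonian u τ σ * E.vec i σ = 0
    by_cases h : particles σ = 0
    · rw [xyHamiltonian_apply_vacuum u h, zero_mul]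
    · rw [vec_eq_zero_of_not_vacuum hu hg E hr hi h, mul_zero]
  have h2 : form (xyHamiltonian u) (E.vec i) = m * nsq (E.vec i) :=
    form_eq_of_eigen fun σ _ => by rw [E.eig, hm]; rfl
  rw [E.nsq_vec, mul_one, form, h1] at h2
  simpa using h2.symm

/-- The gap above the vacuum sector. -/
lemma gap_le_form (hu : ∀ x, 0 ≤ u x) (hg : 0 < g)
    (E : LowSector (xyHamiltonian u) P m g) (hr : P.rank = 2 ^ N)
    {v : (Spins ν L N → Fin 2) → ℂ} (hv : ∀ σ, particles σ = 0 → v σ = 0) :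
    g * nsq v ≤ form (xyHamiltonian u) v := by
  have h := E.le_form (v := v) fun i hi => Finset.sum_eq_zero fun σ _ => by
    by_cases h0 : particles σ = 0
    · rw [hv σ h0, mul_zero]
    · rw [Pi.star_apply, vec_eq_zero_of_not_vacuum hu hg E hr hi h0, star_zero, zero_mul]
  rwa [top_eq_zero hu hg E hr, zero_add] at h

end Vacuum

/-! ## Forbidden annuli -/

section Path

variable {ν L N : ℕ} [NeZero L]

/-- A path of impurity couplings along which the low-lying sector stays gapped. -/
structure IsGappedPath (k : Torus ν L) (u : Torus ν L → ℝ) (g : ℝ)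
    (W P : ℝ → SpinOp (Spins ν L N)) (m : ℝ → ℝ) : Prop where
  gap_pos : 0 < g
  field_nonneg : ∀ x, 0 ≤ u x
  continuousOn : ContinuousOn W (Set.Icc 0 1)
  start : W 0 = 0
  impurity : ∀ s ∈ Set.Icc (0 : ℝ) 1, IsImpurity k (W s)
  sector : ∀ s ∈ Set.Icc (0 : ℝ) 1, Nonempty (LowSector (xyHamiltonian u + W s) (P s) (m s) g)
  rank_eq : ∀ s ∈ Set.Icc (0 : ℝ) 1, (P s).rank = 2 ^ N

/-- The impurity spins are down, and there are particles, all at distance in `(p, q]` from `k`. -/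
structure InAnnulus (k : Torus ν L) (p q : ℕ) (σ : Spins ν L N → Fin 2) : Prop where
  down : ∀ i, σ (Sum.inr i) = 1
  exists_up : ∃ x, σ (Sum.inl x) = 0
  lt : ∀ x, σ (Sum.inl x) = 0 → p < torusDist x k
  le : ∀ x, σ (Sum.inl x) = 0 → torusDist x k ≤ q

lemma InAnnulus.outside {k : Torus ν L} {p q c : ℕ} {σ : Spins ν L N → Fin 2}
    (h : InAnnulus k p q σ) (hc : c ≤ p) : σ ∈ inside (spinBall k c)ᶜ := by
  rw [mem_inside]
  rintro (x | i) hv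
  · rw [Set.notMem_compl_iff, inl_mem_spinBall] at hv
    by_contra h1
    have := h.lt x (by omega)
    omega
  · exact h.down i

lemma prodVec_apply_ne_zero {V : Type} [Fintype V] [DecidableEq V] {X : Set V}
    {χ φ : (V → Fin 2) → ℂ} {σ : V → Fin 2} (h : prodVec X χ φ σ ≠ 0) : φ (res Xᶜ σ) ≠ 0 := by
  intro h0
  exact h (by simp [prodVec, h0])

lemma res_compl_spinBall {k x : Torus ν L} {c : ℕ} (h : c < torusDist x k)
    (σ : Spins ν L N → Fin 2) : res (spinBall k c)ᶜ σ (Sum.inl x) = σ (Sum.inl x) :=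
  res_of_mem (by rw [Set.mem_compl_iff, inl_mem_spinBall]; omega)

/-- Operators of finite range do not couple particles in different annuli. -/
lemma decoupled_annuli {k : Torus ν L} {W : SpinOp (Spins ν L N)} (hW : IsImpurity k W)
    (u : Torus ν L → ℝ) {c p q p' q' : ℕ} (hc : c < p)
    (hpq : q < p' ∨ q' < p) {σ τ : Spins ν L N → Fin 2}
    (hσ : InAnnulus k p q (res (spinBall k c)ᶜ σ))
    (hτ : InAnnulus k p' q' (res (spinBall k c)ᶜ τ)) :
    σ ≠ τ ∧ (xyHamiltonian u + W : SpinOp (Spins ν L N)) σ τ = 0 := by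
  obtain ⟨x, hx⟩ := hσ.exists_up
  have h1 := hσ.lt x hx
  have h2 := hσ.le x hx
  rw [res_compl_spinBall (by omega)] at hx
  -- A particle of `τ` within one step of `x` lies beyond `c`, because `c < p < torusDist x k`, so
  -- it is visible in the restriction. It must then lie in the other annulus, which by strictness is
  -- at least two steps away.
  have key : ∀ z, τ (Sum.inl z) = 0 → torusDist x k ≤ torusDist z k + 1 →
      torusDist z k ≤ torusDist x k + 1 → False := by
    intro z hz h3 h4
    have h5 : res (spinBall k c)ᶜ τ (Sum.inl z) = 0 := by
      rw [res_compl_spinBall (by omega), hz]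
    have := hτ.lt z h5
    have := hτ.le z h5
    omega
  have hne : σ ≠ τ := by
    rintro rfl
    exact key x hx (by omega) (by omega)
  refine ⟨hne, ?_⟩
  have hWz : W σ τ = 0 := by
    by_contra h0
    have hxk : x ≠ k := by rintro rfl; simp [torusDist_self] at h1
    exact key x (by rw [← hW.eq_of_ne_zero h0 hxk, hx]) (by omega) (by omega)
  have hR : rate σ τ = 0 := by
    by_contra h0
    rw [rate_comm] at h0
    obtain ⟨y, z, hyz, _, rfl⟩ := exists_of_rate_ne_zero h0
    obtain ⟨x', h3, h4, h5⟩ := adj_swap (N := N) (z := x) (k := k) hyz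
    rw [Function.comp_apply, h3] at hx
    exact key x' hx h4 h5
  rw [Matrix.add_apply, hWz, xyHamiltonian_apply, if_neg hne, hR]
  simp

namespace IsGappedPath

variable {k : Torus ν L} {u : Torus ν L → ℝ} {g : ℝ} {W P : ℝ → SpinOp (Spins ν L N)} {m : ℝ → ℝ}

/-- Among sufficiently many annuli there is one in which particles are energetically
forbidden along the whole path. -/
lemma exists_forbidden_annulus (h : IsGappedPath k u g W P m) {w : ℕ} (hw : 0 < w)
    (hδ : (N + 1) * (2 * ν * N) / (2 * w ^ 2) < g / 8) (p q : ℕ → ℕ)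
    (hp : ∀ i, (2 * N + 1) * w < p i) (hpq : ∀ i j, i < j → q i < p j) :
    ∃ ε : ℝ → ℝ, (∀ s ∈ Set.Icc (0 : ℝ) 1, ∀ φ : (Spins ν L N → Fin 2) → ℂ,
        (∀ σ, φ σ ≠ 0 → ups σ ≤ N) → ε s * nsq φ ≤ form (xyHamiltonian u + W s) φ) ∧
      ∃ i < 2 ^ N + 1, ∀ s ∈ Set.Icc (0 : ℝ) 1, ∀ φ : (Spins ν L N → Fin 2) → ℂ,
        (∀ σ, φ σ ≠ 0 → InAnnulus k (p i) (q i) σ) →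
        (m s - ε s + 3 * g / 4) * nsq φ ≤ form (xyHamiltonian u) φ := by
  have h1 := fun s (hs : s ∈ Set.Icc (0 : ℝ) 1) =>
    exists_near_groundState (h.impurity s hs) h.field_nonneg hw hδ
  choose! ε hε c hc χ hχ0 hχi hχc hχ using h1
  refine ⟨ε, hε, ?_⟩
  by_contra! hcon
  have hcon' : ∀ i : Fin (2 ^ N + 1), _ := fun i => hcon i i.2
  choose t ht φ hφ hlt using hcon'
  -- The low-energy states in the annuli belong to different times, but their energy involves only
  -- the time-independent `H`. At the time that maximizes `m - ε` all of them satisfy the bound.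
  obtain ⟨i₀, hi₀⟩ := Finite.exists_max fun i => m (t i) - ε (t i)
  set s := t i₀ with hs_def
  have hs : s ∈ Set.Icc (0 : ℝ) 1 := ht i₀
  obtain ⟨E⟩ := h.sector s hs
  have hcp : ∀ i, c s < p i := fun i => (hc s hs).trans_lt (hp i)
  have hφ0 : ∀ i, 0 < nsq (φ i) := by
    intro i
    refine nsq_pos fun h0 => ?_
    have := hlt i
    rw [h0] at this
    simp [form, nsq] at this
  have hφo : ∀ i, ∀ b ∉ inside (spinBall k (c s))ᶜ, φ i b = 0 := fun i b hb => by
    by_contra h0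
    exact hb ((hφ i b h0).outside (hcp i).le)
  set X : Set (Spins ν L N) := spinBall k (c s)
  set Φ : Fin (2 ^ N + 1) → (Spins ν L N → Fin 2) → ℂ := fun i => prodVec X (χ s) (φ i)
  have hχp : 0 < nsq (χ s) := nsq_pos (hχ0 s hs)
  have hΦn : ∀ i, nsq (Φ i) = nsq (φ i) * nsq (χ s) := fun i => nsq_prodVec (hχi s hs) (hφo i)
  have hΦf : ∀ i, form (xyHamiltonian u + W s) (Φ i) ≤ (m s + 7 * g / 8) * nsq (Φ i) := by
    intro i
    rw [hΦn, form_prodVec (h.impurity s hs) u (c s) (hχi s hs) (hχc s hs) (hφo i)]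
    have e1 : form (xyHamiltonian u) (φ i) ≤ (m s - ε s + 3 * g / 4) * nsq (φ i) := by
      refine (hlt i).le.trans ?_
      have := hi₀ i
      have := (hφ0 i).le
      gcongr ?_ * _
      linarith
    have e2 := mul_le_mul_of_nonneg_left (hχ s hs) (hφ0 i).le
    have e3 := mul_le_mul_of_nonneg_left e1 hχp.le
    nlinarith
  -- There is one product state more than the rank, so some combination is orthogonal to the low
  -- sector and has energy at least `m + g` per norm. As the annuli are decoupled, its energy is
  -- also at most `m + 7g/8` per norm, namely `(ε + g/8) + (m - ε + 3g/4)`.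
  obtain ⟨z, hz, hzc⟩ := E.exists_combination Φ E.idx (by rw [E.card_idx, h.rank_eq s hs]; simp)
  have hsep : ∀ i j, i ≠ j → ∀ σ τ, (z i • Φ i) σ ≠ 0 → (z j • Φ j) τ ≠ 0 →
      σ ≠ τ ∧ (xyHamiltonian u + W s : SpinOp (Spins ν L N)) σ τ = 0 := by
    intro i j hij σ τ hσ hτ
    have a1 := hφ i _ (prodVec_apply_ne_zero (right_ne_zero_of_mul hσ))
    have a2 := hφ j _ (prodVec_apply_ne_zero (right_ne_zero_of_mul hτ))
    refine decoupled_annuli (h.impurity s hs) u (hcp i) ?_ a1 a2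
    rcases lt_or_gt_of_ne hij with h2 | h2
    · exact Or.inl (hpq i j h2)
    · exact Or.inr (hpq j i h2)
  have hform := form_sum_vec (xyHamiltonian u + W s) (fun i => z i • Φ i)
    fun i j hij σ τ hσ hτ => (hsep i j hij σ τ hσ hτ).2
  have hnsq : nsq (∑ i, z i • Φ i) = ∑ i, nsq (z i • Φ i) := by
    simp only [nsq_eq_form_one]
    exact form_sum_vec 1 (fun i => z i • Φ i)
      fun i j hij σ τ hσ hτ => Matrix.one_apply_ne (hsep i j hij σ τ hσ hτ).1
  have hlow := E.le_form hzc
  have hup : form (xyHamiltonian u + W s) (∑ i, z i • Φ i) ≤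
      (m s + 7 * g / 8) * nsq (∑ i, z i • Φ i) := by
    rw [hform, hnsq, Finset.mul_sum]
    refine Finset.sum_le_sum fun i _ => ?_
    rw [form_smul_vec, nsq_smul]
    have := mul_le_mul_of_nonneg_left (hΦf i) (sq_nonneg ‖z i‖)
    linarith
  have hpos : 0 < nsq (∑ i, z i • Φ i) := by
    obtain ⟨i, hi⟩ := Function.ne_iff.1 hz
    rw [hnsq]
    refine Finset.sum_pos' (fun i _ => nsq_nonneg _) ⟨i, Finset.mem_univ i, ?_⟩
    rw [nsq_smul, hΦn]
    have : 0 < ‖z i‖ := norm_pos_iff.2 hi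
    have := hφ0 i
    positivity
  have := h.gap_pos
  nlinarith

end IsGappedPath

end Path

/-! ## The energy barrier -/

section Barrier

variable {ν L N : ℕ} [NeZero L]

lemma continuousOn_of_le_add {α : Type*} [SeminormedAddCommGroup α] {W : ℝ → α} {I : Set ℝ}
    (hW : ContinuousOn W I) {f : ℝ → ℝ} (h : ∀ s ∈ I, ∀ t ∈ I, f t ≤ f s + ‖W t - W s‖) :
    ContinuousOn f I := by
  intro s hs
  have h1 : Filter.Tendsto (fun t => ‖W t - W s‖) (nhdsWithin s I) (nhds 0) := by
    have := ((hW s hs).tendsto.sub_const (W s)).norm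
    simpa using this
  rw [ContinuousWithinAt, tendsto_iff_dist_tendsto_zero]
  refine squeeze_zero' (Filter.Eventually.of_forall fun t => dist_nonneg) ?_ h1
  filter_upwards [self_mem_nhdsWithin] with t ht
  have h2 := h s hs t ht
  have h3 := h t ht s hs
  rw [norm_sub_rev] at h3
  rw [Real.dist_eq, abs_le]
  constructor <;> linarith

lemma ups_le_of_vacuum {σ : Spins ν L N → Fin 2} (h : particles σ = 0) : ups σ ≤ N := by
  rw [ups]
  refine (Finset.card_le_card (t := Finset.univ.map ⟨Sum.inr, Sum.inr_injective⟩) ?_).trans ?_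
  · rintro (x | i) hv
    · rw [Finset.mem_filter, particles_eq_zero_iff.1 h x] at hv
      exact absurd hv.2 (by decide)
    · simp
  · rw [Finset.card_map, Finset.card_univ, Fintype.card_fin]

lemma particles_ne_zero_of_cappedDist_pos {k : Torus ν L} {M : ℕ} {σ : Spins ν L N → Fin 2}
    (h : 0 < cappedDist k M σ) : particles σ ≠ 0 := by
  intro h0
  rw [cappedDist, if_pos (ups_le_of_vacuum h0)] at h
  obtain ⟨x, hx, _⟩ := exists_of_lt_maxDist h
  rw [particles_eq_zero_iff.1 h0 x] at hx
  exact absurd hx (by decide)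

lemma ups_le_ups_comb {X : Set (Spins ν L N)} {a b : Spins ν L N → Fin 2} (ha : a ∈ inside X) :
    ups a ≤ ups (comb X a b) := by
  refine Finset.card_le_card fun v hv => ?_
  rw [Finset.mem_filter] at hv ⊢
  refine ⟨hv.1, ?_⟩
  by_cases h : v ∈ X
  · rw [comb_of_mem h, hv.2]
  · rw [mem_inside.1 ha v h] at hv
    exact absurd hv.2 (by decide)

lemma cappedDist_eq_of_rate_ne_zero {k : Torus ν L} {M : ℕ} {σ τ : Spins ν L N → Fin 2}
    (hσ : ¬ ups σ ≤ N) (h : rate σ τ ≠ 0) : cappedDist k M τ = cappedDist k M σ := by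
  rw [cappedDist, cappedDist, if_neg hσ, if_neg (by rwa [← ups_eq_of_rate_ne_zero h])]

/-- A sum of hopping terms over a function of the capped distance. -/
lemma sum_rate_cappedDist_le (k : Torus ν L) (M : ℕ) {a : (Spins ν L N → Fin 2) → ℝ} {A : ℝ}
    (hA : 0 ≤ A) (σ : Spins ν L N → Fin 2) (h : ∀ τ, rate σ τ ≠ 0 → a τ ≤ A)
    (h0 : ∀ τ, ups τ = ups σ → cappedDist k M τ = cappedDist k M σ → ¬ ups σ ≤ N → a τ = 0) :
    ∑ τ, rate σ τ * a τ ≤ 2 * ν * N * A := by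
  by_cases hσ : ups σ ≤ N
  · exact sum_rate_mul_le hσ hA h
  -- With more than `N` spins up there is no uniform bound on the number of particles, but hopping
  -- leaves the capped value `M` unchanged and the function vanishes.
  · rw [Finset.sum_eq_zero]
    · positivity
    · intro τ _
      by_cases hr : rate σ τ = 0
      · rw [hr, zero_mul]
      · rw [h0 τ (ups_eq_of_rate_ne_zero hr).symm (cappedDist_eq_of_rate_ne_zero hσ hr) hσ,
          mul_zero]

/-- A cutoff function growing from `0` to `1` at capped distances between `l` and `l + w`. -/
noncomputable def farFn (k : Torus ν L) (M l w : ℕ) (σ : Spins ν L N → Fin 2) : ℝ :=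
  (min w (cappedDist k M σ - l) : ℕ) / w

lemma farFn_nonneg (k : Torus ν L) (M l w : ℕ) (σ : Spins ν L N → Fin 2) :
    0 ≤ farFn k M l w σ := by
  unfold farFn; positivity

lemma farFn_le_one (k : Torus ν L) (M l : ℕ) {w : ℕ} (hw : 0 < w) (σ : Spins ν L N → Fin 2) :
    farFn k M l w σ ≤ 1 := by
  rw [farFn, div_le_one (by exact_mod_cast hw)]
  exact_mod_cast min_le_left _ _

lemma lt_of_farFn_ne_zero {k : Torus ν L} {M l w : ℕ} {σ : Spins ν L N → Fin 2}
    (h : farFn k M l w σ ≠ 0) : l < cappedDist k M σ := by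
  by_contra h'
  exact h (by simp [farFn, Nat.sub_eq_zero_of_le (not_lt.1 h')])

lemma farFn_eq_one {k : Torus ν L} {M l w : ℕ} (hw : 0 < w) {σ : Spins ν L N → Fin 2}
    (h : l + w ≤ cappedDist k M σ) : farFn k M l w σ = 1 := by
  rw [farFn, min_eq_left (by omega), div_self (by exact_mod_cast hw.ne')]

lemma farFn_sub_le (k : Torus ν L) (M l : ℕ) {w : ℕ} (hw : 0 < w) {σ τ : Spins ν L N → Fin 2}
    (h : rate σ τ ≠ 0) : |farFn k M l w σ - farFn k M l w τ| ≤ 1 / w := by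
  have h1 := cappedDist_le_of_rate_ne_zero k M h
  have h2 := cappedDist_le_of_rate_ne_zero k M (by rwa [rate_comm] at h)
  exact abs_natCast_sub_div_le (by omega) (by omega) (by exact_mod_cast hw)

namespace IsGappedPath

variable {k : Torus ν L} {u : Torus ν L → ℝ} {g : ℝ} {W P : ℝ → SpinOp (Spins ν L N)} {m : ℝ → ℝ}

/-- Particles at large distance from the impurity cost energy, if intermediate distances are
forbidden. -/
lemma le_form_of_near (h : IsGappedPath k u g W P m) {s : ℝ} (hs : s ∈ Set.Icc (0 : ℝ) 1)
    {w p q c : ℕ} {ε b : ℝ}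
    (hε : ∀ φ : (Spins ν L N → Fin 2) → ℂ, (∀ σ, φ σ ≠ 0 → ups σ ≤ N) →
      ε * nsq φ ≤ form (xyHamiltonian u + W s) φ)
    (hb : ∀ φ : (Spins ν L N → Fin 2) → ℂ, (∀ σ, φ σ ≠ 0 → InAnnulus k p q σ) →
      b * nsq φ ≤ form (xyHamiltonian u) φ)
    (hpc : p ≤ c) {v : (Spins ν L N → Fin 2) → ℂ}
    (hv : ∀ σ, v σ ≠ 0 → ups σ ≤ N ∧ c < maxDist k σ ∧ maxDist k σ ≤ q ∧ 0 < clearance k w c σ) :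
    (ε + b) * nsq v ≤ form (xyHamiltonian u + W s) v := by
  rw [form_split (h.impurity s hs) u c fun σ hσ x hx => down_of_clearance_pos (hv σ hσ).2.2.2 hx]
  set X : Set (Spins ν L N) := spinBall k c
  rw [add_mul]
  refine add_le_add ?_ ?_
  -- Inside the sphere there are at most `N` spins up, so the energy is at least `ε`.
  · rw [← sum_nsq_slice X v, Finset.mul_sum]
    refine Finset.sum_le_sum fun β _ => hε _ fun α hα => ?_
    have hin := mem_inside_of_slice_ne_zero hα
    rw [slice_of_mem hin] at hα
    exact (ups_le_ups_comb hin).trans (hv _ hα).1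
  -- Outside there is a particle, since `c < maxDist`, and all of them lie in the annulus.
  · rw [← sum_nsq_slice_compl X v, Finset.mul_sum]
    refine Finset.sum_le_sum fun α _ => hb _ fun β hβ => ?_
    have hin := mem_inside_of_slice_ne_zero hβ
    rw [slice_of_mem hin] at hβ
    obtain ⟨_, h2, h3, _⟩ := hv _ hβ
    have hlt : ∀ x, β (Sum.inl x) = 0 → c < torusDist x k := by
      intro x hx
      by_contra h4
      rw [mem_inside.1 hin (Sum.inl x) (by
        rw [Set.notMem_compl_iff, inl_mem_spinBall]; omega)] at hx
      exact absurd hx (by decide)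
    have hcomb : ∀ x, c < torusDist x k → comb Xᶜ β α (Sum.inl x) = β (Sum.inl x) := fun x hx =>
      comb_of_mem (by rw [Set.mem_compl_iff, inl_mem_spinBall]; omega)
    refine ⟨fun i => mem_inside.1 hin _ (by rw [Set.notMem_compl_iff]; exact inr_mem_spinBall),
      ?_, fun x hx => hpc.trans_lt (hlt x hx), fun x hx => ?_⟩
    · obtain ⟨x, hx, hd⟩ := exists_of_lt_maxDist h2
      exact ⟨x, by rwa [hcomb x hd] at hx⟩
    · refine (le_maxDist ?_).trans h3
      rw [hcomb x (hlt x hx), hx]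

/-- An eigenvalue in the middle of the gap cannot have an eigenvector far from the impurity. -/
lemma no_crossing (h : IsGappedPath k u g W P m) {s : ℝ} (hs : s ∈ Set.Icc (0 : ℝ) 1)
    {w p q l M : ℕ} (hw : 0 < w) (hgw : 32 * (N + 1) * (2 * ν * N) < g * w) {ε : ℝ}
    (hl : l = p + (2 * N + 2) * w) (hq : l + w ≤ q) (hM : l + w ≤ M)
    (hε : ∀ φ : (Spins ν L N → Fin 2) → ℂ, (∀ σ, φ σ ≠ 0 → ups σ ≤ N) →
      ε * nsq φ ≤ form (xyHamiltonian u + W s) φ)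
    (hb : ∀ φ : (Spins ν L N → Fin 2) → ℂ, (∀ σ, φ σ ≠ 0 → InAnnulus k p q σ) →
      (m s - ε + 3 * g / 4) * nsq φ ≤ form (xyHamiltonian u) φ)
    {ψ : (Spins ν L N → Fin 2) → ℂ} {e : ℝ} (he : e = m s + g / 2)
    (hψ1 : nsq ψ = 1) (hψ0 : ∀ σ, ¬ l < cappedDist k M σ → ψ σ = 0)
    (hψ : ∀ σ, l < cappedDist k M σ → ((xyHamiltonian u + W s) *ᵥ ψ) σ = e * ψ σ) : False := by
  obtain ⟨E⟩ := h.sector s hs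
  have hW := h.impurity s hs
  have hg := h.gap_pos
  have hwr : (1 : ℝ) ≤ w := by exact_mod_cast hw
  set D : ℝ := 2 * ν * N with hD
  have hD0 : 0 ≤ D := by positivity
  set H : SpinOp (Spins ν L N) := xyHamiltonian u + W s with hH
  have hHh : H.IsHermitian := hW.isHermitian_add u
  set J := farFn (N := N) k M l w with hJ
  have hJW : ∀ σ τ, W s σ τ ≠ 0 → J σ = J τ := fun σ τ h0 => by
    simp only [hJ, farFn, hW.cappedDist_eq M h0]
  have hJc : ∀ σ τ, cappedDist k M τ = cappedDist k M σ → J σ = J τ := fun σ τ h0 => by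
    simp only [hJ, farFn, h0]
  have hDw : 32 * D < g * w := by nlinarith [hgw, mul_nonneg (Nat.cast_nonneg (α := ℝ) N) hD0]
  have hgw0 : 0 < g * w := by positivity
  -- `ψ` solves the eigenvalue equation only beyond `l`, but `J` is supported there. So `J ψ` is an
  -- approximate eigenvector of the full `H`, with energy in the middle of the gap and residual at
  -- most `D/w`.
  have far : nsq (mulFn J ψ) < 1 / 4 := by
    have h1 := nsq_residual_le (H := H) rate_nonneg rate_comm (f := J) (v := ψ) (e := e)
      (K := D * (1 / w))
      (fun σ τ hne => IsImpurity.norm_apply_le u (fun h0 => hne (by rw [h0]))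
        (by_contra fun h0 => hne (hJW σ τ h0)))
      (fun σ hσ => hψ σ (lt_of_farFn_ne_zero hσ))
      (fun σ => sum_rate_cappedDist_le k M (by positivity) σ (fun τ hτ => farFn_sub_le k M l hw hτ)
        fun τ _ hc _ => by rw [hJc σ τ hc, sub_self, abs_zero])
    have h2 := E.gap_le_residual he hg.le (mulFn J ψ)
    have h3 := h2.trans h1
    rw [hψ1, mul_one] at h3
    have h4 : D * (1 / w) < g / 32 := by
      rw [mul_one_div, div_lt_div_iff₀ (by linarith) (by norm_num)]
      linarith
    have h5 : 0 ≤ D * (1 / w) := by positivity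
    have h6 : (D * (1 / w)) ^ 2 < (g / 32) ^ 2 := by gcongr
    by_contra h7
    push Not at h7
    nlinarith [mul_le_mul_of_nonneg_left h7 (sq_nonneg (g / 2)), sq_pos_of_pos hg]
  have near : nsq (mulFn (fun σ => 1 - J σ) ψ) < 1 / 4 := by
    -- The near part is localized further to configurations with an empty sphere between the radii
    -- `p` and `l`. There `le_form_of_near` gives energy at least `m + 3g/4`, above `e = m + g/2`.
    let f : ℕ → (Spins ν L N → Fin 2) → ℝ := fun j σ =>
      (1 - J σ) * clearFn k w (p + (2 * j + 1) * w) σ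
    have hJ0 : ∀ σ, ¬ ups σ ≤ N → J σ = 1 := fun σ hσ =>
      farFn_eq_one hw (by rw [cappedDist, if_neg hσ]; exact hM)
    have hlow : ∀ j ∈ Finset.range (N + 1),
        (m s + 3 * g / 4) * nsq (mulFn (f j) ψ) ≤ form H (mulFn (f j) ψ) := by
      intro j hj
      have hj' : j ≤ N := by have := Finset.mem_range.1 hj; omega
      have h1 := h.le_form_of_near hs (w := w) (c := p + (2 * j + 1) * w) hε hb (by omega)
        (v := mulFn (f j) ψ) ?_
      · rw [show ε + (m s - ε + 3 * g / 4) = m s + 3 * g / 4 by ring] at h1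
        exact h1
      · intro σ hσ
        have hf : f j σ ≠ 0 := fun h0 => hσ (by simp [mulFn, h0])
        have hψσ : ψ σ ≠ 0 := right_ne_zero_of_mul hσ
        have hJ1 : J σ ≠ 1 := fun h0 => hf (by simp [f, h0])
        have hups : ups σ ≤ N := by_contra fun h0 => hJ1 (hJ0 σ h0)
        have hc1 : l < cappedDist k M σ := by_contra fun h0 => hψσ (hψ0 σ h0)
        have hc2 : cappedDist k M σ < l + w := by
          by_contra h0; exact hJ1 (farFn_eq_one hw (not_lt.1 h0))
        rw [cappedDist, if_pos hups] at hc1 hc2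
        have hcl : p + (2 * j + 1) * w ≤ l := by
          rw [hl]; gcongr; omega
        exact ⟨hups, by omega, by omega,
          clearance_pos_of_clearFn_ne_zero (right_ne_zero_of_mul hf)⟩
    -- Both factors of `f j` have slope `1/w`, so the product has slope at most `2/w` and the error
    -- is `(1/2) D (2/w)²`.
    have hup : ∀ j, form H (mulFn (f j) ψ) ≤ e * nsq (mulFn (f j) ψ) + 2 * D / w ^ 2 := by
      intro j
      have h1 := form_mulFn_le hHh rate_nonneg rate_comm (f := f j) (v := ψ) (e := e)
        (fun σ τ hne => IsImpurity.norm_apply_le u (fun h0 => hne (by rw [h0]))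
          (by_contra fun h0 => hne (by
            simp only [f, clearFn]
            rw [hJW σ τ h0, hW.clearance_eq (by nlinarith) h0])))
        (fun σ _ hσ => hψ σ (by_contra fun h0 => hσ (hψ0 σ h0)))
      refine h1.trans ?_
      gcongr
      calc (1 / 2) * ∑ σ, (∑ τ, rate σ τ * (f j σ - f j τ) ^ 2) * ‖ψ σ‖ ^ 2
          ≤ (1 / 2) * ∑ σ, (D * (2 / w) ^ 2) * ‖ψ σ‖ ^ 2 := by
            gcongr (1 / 2) * ?_
            refine Finset.sum_le_sum fun σ _ => ?_
            gcongr
            refine sum_rate_cappedDist_le k M (by positivity) σ (fun τ hτ => ?_)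
              fun τ hu _ hσ => ?_
            · have a1 := farFn_sub_le k M l hw hτ
              have a2 := clearFn_sub_le k hw (p + (2 * j + 1) * w) hτ
              have a3 := clearFn_nonneg k w (p + (2 * j + 1) * w) σ
              have a4 := clearFn_le_one k hw (p + (2 * j + 1) * w) σ
              have a5 := farFn_nonneg k M l w τ
              have a6 := farFn_le_one k M l hw τ
              rw [← sq_abs]
              have a7 : f j σ - f j τ = -(J σ - J τ) * clearFn k w (p + (2 * j + 1) * w) σ +
                  (1 - J τ) * (clearFn k w (p + (2 * j + 1) * w) σ -
                    clearFn k w (p + (2 * j + 1) * w) τ) := by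
                simp only [f]; ring
              have a8 : |f j σ - f j τ| ≤ 1 / w * 1 + 1 * (1 / w) := by
                rw [a7]
                refine (abs_add_le _ _).trans ?_
                rw [abs_mul, abs_mul, abs_neg]
                gcongr
                · rwa [abs_of_nonneg a3]
                · rw [abs_of_nonneg (by linarith)]; linarith
              gcongr
              exact a8.trans_eq (by ring)
            · simp [f, hJ0 σ hσ, hJ0 τ (by rwa [hu])]
        _ = 2 * D / w ^ 2 := by
            rw [← Finset.mul_sum]
            have : ∑ σ, ‖ψ σ‖ ^ 2 = 1 := hψ1
            rw [this]; field_simp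
    have hsum : nsq (mulFn (fun σ => 1 - J σ) ψ) ≤
        ∑ j ∈ Finset.range (N + 1), nsq (mulFn (f j) ψ) := by
      simp only [nsq_mulFn]
      rw [Finset.sum_comm]
      refine Finset.sum_le_sum fun σ _ => ?_
      rw [← Finset.sum_mul]
      gcongr
      by_cases hσ : ups σ ≤ N
      · simp only [f, mul_pow]
        rw [← Finset.mul_sum]
        exact le_mul_of_one_le_right (sq_nonneg _) (one_le_sum_clearFn_sq k hw p hσ)
      · simp [f, hJ0 σ hσ]
    have hj : ∀ j ∈ Finset.range (N + 1), nsq (mulFn (f j) ψ) ≤ 8 * D / (g * w ^ 2) := by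
      intro j hj
      have h1 := (hlow j hj).trans (hup j)
      rw [he] at h1
      rw [le_div_iff₀ (by positivity)]
      have h2 : g / 4 * nsq (mulFn (f j) ψ) ≤ 2 * D / w ^ 2 := by linarith
      rw [le_div_iff₀ (by positivity)] at h2
      linarith
    refine (hsum.trans (Finset.sum_le_sum hj)).trans_lt ?_
    rw [Finset.sum_const, Finset.card_range, nsmul_eq_mul, ← mul_div_assoc,
      div_lt_div_iff₀ (by positivity) (by norm_num)]
    push_cast
    nlinarith [mul_le_mul_of_nonneg_left hwr hgw0.le]
  have hsplit : ψ = mulFn (fun σ => 1 - J σ) ψ + mulFn J ψ := by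
    ext σ
    simp only [mulFn, Pi.add_apply]
    push_cast; ring
  have hle := sqrt_nsq_add_le (mulFn (fun σ => 1 - J σ) ψ) (mulFn J ψ)
  rw [← hsplit, hψ1, Real.sqrt_one] at hle
  have e1 : √(nsq (mulFn (fun σ => 1 - J σ) ψ)) < 1 / 2 := by
    rw [Real.sqrt_lt' (by norm_num)]; linarith
  have e2 : √(nsq (mulFn J ψ)) < 1 / 2 := by
    rw [Real.sqrt_lt' (by norm_num)]; linarith
  linarith

lemma continuousOn_top (h : IsGappedPath k u g W P m) : ContinuousOn m (Set.Icc 0 1) := by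
  refine continuousOn_of_le_add h.continuousOn fun s hs t ht => ?_
  obtain ⟨E⟩ := h.sector s hs
  obtain ⟨E'⟩ := h.sector t ht
  have := E.top_le E' h.gap_pos.le (by rw [h.rank_eq s hs, h.rank_eq t ht])
  rwa [add_sub_add_left_eq_sub] at this

lemma sector_zero (h : IsGappedPath k u g W P m) :
    Nonempty (LowSector (xyHamiltonian u) (P 0) (m 0) g) := by
  have := h.sector 0 (by simp)
  rwa [h.start, add_zero] at this

/-- The energy barrier for particles far from the impurity. -/
lemma barrier (h : IsGappedPath k u g W P m) {w p q l M : ℕ} (hw : 0 < w)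
    (hgw : 32 * (N + 1) * (2 * ν * N) < g * w) {ε : ℝ → ℝ}
    (hl : l = p + (2 * N + 2) * w) (hq : l + w ≤ q) (hM : l + w ≤ M)
    (hε : ∀ s ∈ Set.Icc (0 : ℝ) 1, ∀ φ : (Spins ν L N → Fin 2) → ℂ,
      (∀ σ, φ σ ≠ 0 → ups σ ≤ N) → ε s * nsq φ ≤ form (xyHamiltonian u + W s) φ)
    (hb : ∀ s ∈ Set.Icc (0 : ℝ) 1, ∀ φ : (Spins ν L N → Fin 2) → ℂ,
      (∀ σ, φ σ ≠ 0 → InAnnulus k p q σ) →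
      (m s - ε s + 3 * g / 4) * nsq φ ≤ form (xyHamiltonian u) φ)
    {s : ℝ} (hs : s ∈ Set.Icc (0 : ℝ) 1) {φ : (Spins ν L N → Fin 2) → ℂ}
    (hφ : ∀ σ, φ σ ≠ 0 → l < cappedDist k M σ) :
    (m s + g / 2) * nsq φ ≤ form (xyHamiltonian u + W s) φ := by
  set S : Set (Spins ν L N → Fin 2) := {σ | l < cappedDist k M σ} with hS
  by_cases hne : S.Nonempty
  swap
  · have : φ = 0 := by
      ext σ
      by_contra h0
      exact hne ⟨σ, hφ σ h0⟩
    simp [this, form, nsq]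
  have hex := fun t (ht : t ∈ Set.Icc (0 : ℝ) 1) =>
    exists_groundState ((h.impurity t ht).isHermitian_add u) S hne
  choose! e ψ hψ0 hψ1 hψe hψ using hex
  -- Variational principle: the minimizer at one time is a trial vector at the other.
  have hcont : ContinuousOn e (Set.Icc 0 1) := by
    refine continuousOn_of_le_add h.continuousOn fun t ht t' ht' => ?_
    have h1 := hψ t' ht' (ψ t) (hψ0 t ht)
    rw [hψ1 t ht, mul_one] at h1
    have h2 : form (xyHamiltonian u + W t) (ψ t) = e t * nsq (ψ t) :=
      form_eq_of_eigen fun σ hσ => hψe t ht σ (by_contra fun h0 => hσ (hψ0 t ht σ h0))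
    rw [hψ1 t ht, mul_one] at h2
    have h3 : form (xyHamiltonian u + W t') (ψ t) =
        form (xyHamiltonian u + W t) (ψ t) + form (W t' - W t) (ψ t) := by
      rw [← form_add]; congr 1; abel
    have h4 := le_of_abs_le (abs_form_le (W t' - W t) (ψ t))
    rw [hψ1 t ht, mul_one] at h4
    linarith
  have h00 : (0 : ℝ) ∈ Set.Icc (0 : ℝ) 1 := by simp
  obtain ⟨E₀⟩ := h.sector_zero
  have hr0 := h.rank_eq 0 h00
  -- Configurations beyond `l` are not vacuum, and without coupling `m 0 = 0`.
  have hstart : g ≤ e 0 - m 0 := by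
    have h1 := gap_le_form h.field_nonneg h.gap_pos E₀ hr0 (v := ψ 0) fun σ hσ => by
      by_contra h0
      have h2 : l < cappedDist k M σ := by_contra fun h3 => h0 (hψ0 0 h00 σ h3)
      exact particles_ne_zero_of_cappedDist_pos (k := k) (M := M) (by omega) hσ
    have h2 : form (xyHamiltonian u + W 0) (ψ 0) = e 0 * nsq (ψ 0) :=
      form_eq_of_eigen fun σ hσ => hψe 0 h00 σ (by_contra fun h0 => hσ (hψ0 0 h00 σ h0))
    rw [h.start, add_zero, hψ1 0 h00, mul_one] at h2
    rw [hψ1 0 h00, mul_one] at h1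
    rw [top_eq_zero h.field_nonneg h.gap_pos E₀ hr0]
    linarith
  have hg := h.gap_pos
  -- Otherwise `e - m` takes the value `g/2` at some earlier time, where `no_crossing` applies.
  have key : m s + g / 2 ≤ e s := by
    by_contra! hlt
    have hsub : Set.Icc (0 : ℝ) s ⊆ Set.Icc 0 1 := Set.Icc_subset_Icc le_rfl hs.2
    obtain ⟨t, ht, hte⟩ := intermediate_value_Icc' hs.1
      ((hcont.sub h.continuousOn_top).mono hsub)
      (show g / 2 ∈ Set.Icc (e s - m s) (e 0 - m 0) from ⟨by linarith, by linarith⟩)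
    have ht' := hsub ht
    exact h.no_crossing ht' hw hgw hl hq hM (hε t ht') (hb t ht')
      (show e t = m t + g / 2 by simp only [Pi.sub_apply] at hte; linarith) (hψ1 t ht')
      (fun σ hσ => hψ0 t ht' σ hσ) (fun σ hσ => hψe t ht' σ hσ)
  refine le_trans (mul_le_mul_of_nonneg_right key (nsq_nonneg φ))
    (hψ s hs φ fun σ hσ => by_contra fun h0 => hσ (hφ σ h0))

end IsGappedPath

end Barrier

/-! ## Exponential localization -/

section Agmon

variable {ν L N : ℕ} [NeZero L]

lemma sqrt_nsq_sum_le {Ω : Type} {ι : Type*} [Fintype Ω] (s : Finset ι) (v : ι → Ω → ℂ) :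
    √(nsq (∑ i ∈ s, v i)) ≤ ∑ i ∈ s, √(nsq (v i)) := by
  classical
  induction s using Finset.induction_on with
  | empty => simp [nsq]
  | insert a s ha ih =>
    rw [Finset.sum_insert ha, Finset.sum_insert ha]
    exact (sqrt_nsq_add_le _ _).trans (by gcongr)

lemma abs_exp_sub_exp_le {μ : ℝ} (hμ : 0 ≤ μ) {a b : ℕ} (h1 : a ≤ b + 1) (h2 : b ≤ a + 1) :
    |Real.exp (μ * a) - Real.exp (μ * b)| ≤ (Real.exp μ - 1) * Real.exp (μ * a) := by
  have h1' : (a : ℝ) ≤ b + 1 := by exact_mod_cast h1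
  have h2' : (b : ℝ) ≤ a + 1 := by exact_mod_cast h2
  have e1 : Real.exp (μ * a) ≤ Real.exp μ * Real.exp (μ * b) := by
    rw [← Real.exp_add]; gcongr; nlinarith
  have e2 : Real.exp (μ * b) ≤ Real.exp μ * Real.exp (μ * a) := by
    rw [← Real.exp_add]; gcongr; nlinarith
  have e3 : 1 ≤ Real.exp μ := Real.one_le_exp hμ
  have e4 := Real.exp_pos (μ * a)
  have e5 := Real.exp_pos (μ * b)
  rw [abs_le]
  constructor
  · linarith
  · by_cases h : Real.exp (μ * a) ≤ Real.exp (μ * b)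
    · nlinarith
    · push Not at h
      nlinarith

/-- The projection onto the configurations with a particle at distance more than `R` from `k`. -/
noncomputable def farProj (k : Torus ν L) (R : ℕ) : SpinOp (Spins ν L N) :=
  open Classical in
  diagonal fun σ => if ∃ x, R < torusDist x k ∧ σ (Sum.inl x) = 0 then 1 else 0

lemma nsq_farProj_mulVec (k : Torus ν L) (R : ℕ) (v : (Spins ν L N → Fin 2) → ℂ) {f : _ → ℝ}
    {c : ℝ} (hc : 0 ≤ c)
    (hf : ∀ σ : Spins ν L N → Fin 2, (∃ x, R < torusDist x k ∧ σ (Sum.inl x) = 0) → c ≤ f σ) :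
    c ^ 2 * nsq (farProj k R *ᵥ v) ≤ nsq (mulFn f v) := by
  classical
  rw [nsq_mulFn, nsq, Finset.mul_sum]
  refine Finset.sum_le_sum fun σ _ => ?_
  rw [farProj, mulVec_diagonal]
  split_ifs with h
  · rw [one_mul]
    gcongr
    exact hf σ h
  · simp
    positivity

namespace IsGappedPath

variable {k : Torus ν L} {u : Torus ν L → ℝ} {g : ℝ} {W P : ℝ → SpinOp (Spins ν L N)} {m : ℝ → ℝ}

/-- Exponential decay of the low-lying eigenvectors beyond the barrier. -/
lemma nsq_farProj_vec_le (h : IsGappedPath k u g W P m) {l M R : ℕ} {μ : ℝ} (hμ : 0 < μ)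
    (hμg : 2 * ν * N * (Real.exp μ - 1) ^ 2 ≤ g / 8) (hM : R + 1 ≤ M)
    {s : ℝ} (hs : s ∈ Set.Icc (0 : ℝ) 1)
    (hbar : ∀ φ : (Spins ν L N → Fin 2) → ℂ, (∀ σ, φ σ ≠ 0 → l < cappedDist k M σ) →
      (m s + g / 2) * nsq φ ≤ form (xyHamiltonian u + W s) φ)
    (E : LowSector (xyHamiltonian u + W s) (P s) (m s) g) {i : Spins ν L N → Fin 2}
    (hi : i ∈ E.idx) :
    √(nsq (farProj k R *ᵥ E.vec i)) ≤ 2 * Real.exp (-(μ * (R - l))) := by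
  have hW := h.impurity s hs
  have hg := h.gap_pos
  set ψ := E.vec i with hψ
  have hψ1 : nsq ψ = 1 := E.nsq_vec i
  let d : (Spins ν L N → Fin 2) → ℕ := fun σ => cappedDist k M σ - l
  -- Subtracting `1` makes the exponential weight vanish up to distance `l`, so that the weighted
  -- eigenvector obeys the barrier without a separate cutoff.
  let f : (Spins ν L N → Fin 2) → ℝ := fun σ => Real.exp (μ * d σ) - 1
  have hf0 : ∀ σ, f σ ≠ 0 → l < cappedDist k M σ := by
    intro σ hσ
    by_contra h0
    exact hσ (by simp [f, d, Nat.sub_eq_zero_of_le (not_lt.1 h0)])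
  have hform := form_mulFn_le (hW.isHermitian_add u) rate_nonneg rate_comm (f := f) (v := ψ)
    (e := E.val i)
    (fun σ τ hne => IsImpurity.norm_apply_le u (fun h0 => hne (by rw [h0]))
      (by_contra fun h0 => hne (by simp only [f, d, hW.cappedDist_eq M h0])))
    (fun σ _ _ => by rw [hψ, E.eig]; rfl)
  have hlow := hbar (mulFn f ψ) fun σ hσ => hf0 σ fun h0 => hσ (by simp [mulFn, h0])
  have herr : (1 / 2) * ∑ σ, (∑ τ, rate σ τ * (f σ - f τ) ^ 2) * ‖ψ σ‖ ^ 2 ≤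
      g / 8 * (nsq (mulFn f ψ) + 1) := by
    rw [show nsq (mulFn f ψ) + 1 = nsq (mulFn f ψ) + nsq ψ by rw [hψ1], nsq_mulFn, nsq, ← Finset.sum_add_distrib, Finset.mul_sum, Finset.mul_sum]
    refine Finset.sum_le_sum fun σ _ => ?_
    have h1 : ∑ τ, rate σ τ * (f σ - f τ) ^ 2 ≤
        2 * ν * N * ((Real.exp μ - 1) * Real.exp (μ * d σ)) ^ 2 := by
      refine sum_rate_cappedDist_le k M (by positivity) σ (fun τ hτ => ?_) fun τ _ hc _ => ?_
      · have h2 := cappedDist_le_of_rate_ne_zero k M hτ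
        have h3 := cappedDist_le_of_rate_ne_zero k M (by rwa [rate_comm] at hτ)
        rw [← sq_abs, show f σ - f τ = Real.exp (μ * d σ) - Real.exp (μ * d τ) by simp only [f]; ring]
        gcongr
        exact abs_exp_sub_exp_le hμ.le (by simp only [d]; omega) (by simp only [d]; omega)
      · simp [f, d, hc]
    have h2 : 2 * ν * N * ((Real.exp μ - 1) * Real.exp (μ * d σ)) ^ 2 ≤
        g / 8 * (f σ + 1) ^ 2 := by
      rw [mul_pow, ← mul_assoc]
      simp only [f, sub_add_cancel]
      gcongr
    have h3 : (f σ + 1) ^ 2 ≤ 2 * (f σ ^ 2 + 1) := by nlinarith [sq_nonneg (f σ - 1)]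
    have h4 : ∑ τ, rate σ τ * (f σ - f τ) ^ 2 ≤ g / 8 * (2 * (f σ ^ 2 + 1)) :=
      h1.trans (h2.trans (by gcongr))
    have h5 := mul_le_mul_of_nonneg_right h4 (sq_nonneg ‖ψ σ‖)
    linarith
  -- The barrier gives energy at least `m + g/2`, while the eigenvalue is at most `m` and the error
  -- costs `g/8` of the squared norm plus `g/8`.
  have hle : nsq (mulFn f ψ) ≤ 1 := by
    have h1 := mul_le_mul_of_nonneg_right (E.val_le i hi) (nsq_nonneg (mulFn f ψ))
    have h2 := nsq_nonneg (mulFn f ψ)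
    nlinarith
  have hle2 : nsq (mulFn (fun σ => f σ + 1) ψ) ≤ 4 := by
    have h1 : nsq (mulFn (fun σ => f σ + 1) ψ) ≤ 2 * (nsq (mulFn f ψ) + nsq ψ) := by
      rw [nsq_mulFn, nsq_mulFn, nsq, ← Finset.sum_add_distrib, Finset.mul_sum]
      refine Finset.sum_le_sum fun σ _ => ?_
      have h3 : (f σ + 1) ^ 2 ≤ 2 * (f σ ^ 2 + 1) := by nlinarith [sq_nonneg (f σ - 1)]
      nlinarith [mul_le_mul_of_nonneg_right h3 (sq_nonneg ‖ψ σ‖)]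
    linarith
  have h1 := nsq_farProj_mulVec k R ψ (f := fun σ => f σ + 1) (c := Real.exp (μ * (R - l)))
    (Real.exp_pos _).le (by
      rintro σ ⟨x, hx, hσ⟩
      simp only [f, sub_add_cancel]
      gcongr
      have h2 : R + 1 ≤ cappedDist k M σ := by
        rw [cappedDist]
        split_ifs
        · have := le_maxDist (k := k) hσ; omega
        · exact hM
      have h3 : R ≤ d σ + l := by simp only [d]; omega
      have h4 : (R : ℝ) ≤ d σ + l := by exact_mod_cast h3
      linarith)
  have h2 := h1.trans hle2
  refine Real.sqrt_le_iff.2 ⟨by positivity, ?_⟩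
  rw [mul_pow, Real.exp_neg, inv_pow, ← div_eq_mul_inv, le_div_iff₀ (by positivity)]
  linarith

end IsGappedPath

/-- The low-lying sector is exponentially localized near the impurity. -/
theorem exists_localization (ν N : ℕ) {g : ℝ} (hg : 0 < g) :
    ∃ C μ : ℝ, 0 < C ∧ 0 < μ ∧ ∀ (L : ℕ) [NeZero L] (k : Torus ν L) (u : Torus ν L → ℝ)
      (W P : ℝ → SpinOp (Spins ν L N)) (m : ℝ → ℝ), IsGappedPath k u g W P m →
      ∀ s ∈ Set.Icc (0 : ℝ) 1, ∀ R : ℕ, ‖farProj k R * P s‖ ≤ C * Real.exp (-(μ * R)) := by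
  set D : ℝ := 2 * ν * N with hD
  have hD0 : 0 ≤ D := by positivity
  -- The cutoff width depends on `ν`, `N` and `g` only; it makes all localization errors small
  -- compared with the gap.
  obtain ⟨w, hw⟩ := exists_nat_gt (32 * (N + 1) * D / g)
  have hwr : (0 : ℝ) < w := lt_of_le_of_lt (by positivity) hw
  have hw0 : 0 < w := by exact_mod_cast hwr
  have hw1 : (1 : ℝ) ≤ w := by exact_mod_cast hw0
  rw [div_lt_iff₀ hg, mul_comm (w : ℝ)] at hw
  have hδ : (N + 1) * D / (2 * w ^ 2) < g / 8 := by
    rw [div_lt_div_iff₀ (by positivity) (by norm_num)]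
    have : g * w ≤ g * w ^ 2 := by gcongr; nlinarith
    have : 0 ≤ (N + 1) * D := by positivity
    nlinarith
  obtain ⟨μ, hμ, hμg⟩ : ∃ μ : ℝ, 0 < μ ∧ D * (Real.exp μ - 1) ^ 2 ≤ g / 8 := by
    have hc : Filter.Tendsto (fun μ : ℝ => D * (Real.exp μ - 1) ^ 2) (nhdsWithin 0 (Set.Ioi 0))
        (nhds 0) := by
      have : Continuous fun μ : ℝ => D * (Real.exp μ - 1) ^ 2 := by fun_prop
      have := (this.tendsto 0).mono_left (nhdsWithin_le_nhds (s := Set.Ioi 0))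
      simpa using this
    have h1 := hc.eventually (ge_mem_nhds (show (0 : ℝ) < g / 8 by positivity))
    obtain ⟨μ, h2, h3⟩ := (h1.and self_mem_nhdsWithin).exists
    exact ⟨μ, h3, h2⟩
  -- Each annulus needs `(2N+2)w` for the `N + 1` shells below `l`, and another `w` for the cutoff
  -- `J` to rise. The last `w` separates it from the next annulus.
  let b : ℕ := (2 * N + 4) * w
  let p : ℕ → ℕ := fun i => (i + 1) * b
  let q : ℕ → ℕ := fun i => p i + (2 * N + 3) * w
  let l : ℕ → ℕ := fun i => p i + (2 * N + 2) * w
  refine ⟨2 ^ N * (2 * Real.exp (μ * l (2 ^ N))), μ, by positivity, hμ, ?_⟩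
  intro L _ k u W P m h s hs R
  obtain ⟨ε, hε, i, hi, hb⟩ := h.exists_forbidden_annulus hw0 hδ p q
    (fun i => by
      simp only [p, b]
      have : (2 * N + 1) * w < (2 * N + 4) * w := by gcongr; omega
      exact this.trans_le (Nat.le_mul_of_pos_left _ (by omega)))
    (fun i j hij => by
      have h1 : p (i + 1) ≤ p j := by simp only [p]; gcongr; omega
      have h2 : q i < p (i + 1) := by
        simp only [p, q, b]
        nlinarith
      exact h2.trans_le h1)
  obtain ⟨E⟩ := h.sector s hs
  have hli : l i ≤ l (2 ^ N) := by
    simp only [l, p]; gcongr; omega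
  -- The forbidden annulus does not depend on the cap, so the cap may be chosen after `R`. It must
  -- exceed `R` for configurations with too many spins up to count as far.
  have hbar := fun φ => h.barrier (M := l i + w + R + 1) hw0 hw (l := l i) (p := p i) (q := q i)
    rfl (by simp only [l, q]; apply le_of_eq; ring) (by omega) hε hb hs (φ := φ)
  have hvec : ∀ j ∈ E.idx, √(nsq (farProj k R *ᵥ E.vec j)) ≤
      2 * Real.exp (μ * l (2 ^ N)) * Real.exp (-(μ * R)) := by
    intro j hj
    refine (h.nsq_farProj_vec_le hμ hμg (by omega) hs hbar E hj).trans ?_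
    rw [mul_assoc, ← Real.exp_add]
    gcongr
    have : (l i : ℝ) ≤ l (2 ^ N) := by exact_mod_cast hli
    nlinarith
  refine opNorm_le_of_nsq _ (by positivity) fun v => ?_
  have hcoef : ∀ j, ‖E.coef v j‖ ≤ √(nsq v) := by
    intro j
    refine Real.le_sqrt_of_sq_le ?_
    rw [E.nsq_eq]
    exact Finset.single_le_sum (f := fun j => ‖E.coef v j‖ ^ 2) (fun _ _ => sq_nonneg _)
      (Finset.mem_univ j)
  have h1 : √(nsq ((farProj k R * P s) *ᵥ v)) ≤
      2 ^ N * (2 * Real.exp (μ * l (2 ^ N))) * Real.exp (-(μ * R)) * √(nsq v) := by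
    rw [← mulVec_mulVec, E.proj_eq, mulVec_sum]
    refine (sqrt_nsq_sum_le _ _).trans ?_
    calc ∑ j ∈ E.idx, √(nsq (farProj k R *ᵥ (E.coef v j • E.vec j)))
        ≤ ∑ j ∈ E.idx, √(nsq v) * (2 * Real.exp (μ * l (2 ^ N)) * Real.exp (-(μ * R))) := by
          refine Finset.sum_le_sum fun j hj => ?_
          rw [mulVec_smul, nsq_smul, Real.sqrt_mul (sq_nonneg _), Real.sqrt_sq (norm_nonneg _)]
          exact mul_le_mul (hcoef j) (hvec j hj) (Real.sqrt_nonneg _) (Real.sqrt_nonneg _)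
      _ = _ := by
          rw [Finset.sum_const, E.card_idx, h.rank_eq s hs, nsmul_eq_mul]
          push_cast; ring
  rw [← Real.sqrt_le_sqrt_iff (by have := nsq_nonneg v; positivity),
    Real.sqrt_mul (sq_nonneg _), Real.sqrt_sq (by positivity)]
  exact h1

end Agmon

/-! ## Local spectral flow -/

section AlmostProjection

variable {Ω : Type} [Fintype Ω] [DecidableEq Ω]

/-- A Hermitian matrix that is nearly idempotent is near a projection. -/
lemma exists_proj_of_almost_idem {b : Matrix Ω Ω ℂ} (hb : bᴴ = b) {δ : ℝ} (hδ0 : 0 ≤ δ)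
    (hδ : δ ≤ 3 / 16) (h : ‖b - b * b‖ ≤ δ) :
    ∃ p, SplitsAt (-b) p (-1 / 2) (1 / 2) ∧ ‖b - p‖ ≤ 2 * δ := by
  classical
  let E := EigenBasis.ofHermitian (show b.IsHermitian from hb)
  have hval : ∀ i, |E.val i - E.val i * E.val i| ≤ δ := by
    intro i
    have h1 := nsq_mulVec_le (b - b * b) (E.vec i)
    have h2 : (b - b * b) *ᵥ E.vec i =
        ((E.val i - E.val i * E.val i : ℝ) : ℂ) • E.vec i := by
      rw [sub_mulVec, ← mulVec_mulVec, E.eig, mulVec_smul, E.eig, smul_smul, ← sub_smul]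
      push_cast; rfl
    rw [h2, nsq_smul, E.nsq_vec, Complex.norm_real, mul_one, mul_one] at h1
    exact (abs_le_of_sq_le_sq' h1 (norm_nonneg _)).2.trans h
  -- Since `x - x² = 3/16` at `1/4` and `3/4`, no eigenvalue lies strictly between these, whence a
  -- gap of size `1/2` around `1/2`. The sign of `b` is reversed because `SplitsAt` projects onto
  -- the lower part.
  let K : Finset Ω := Finset.univ.filter fun i => 1 / 2 < E.val i
  have hK : ∀ i ∈ K, 3 / 4 ≤ E.val i := by
    intro i hi
    have h1 : 1 / 2 < E.val i := (Finset.mem_filter.1 hi).2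
    have h2 := abs_le.1 (hval i)
    nlinarith [h2.1, h2.2]
  have hK' : ∀ i ∉ K, E.val i ≤ 1 / 4 := by
    intro i hi
    have h1 : E.val i ≤ 1 / 2 := by simpa [K] using hi
    have h2 := abs_le.1 (hval i)
    nlinarith [h2.1, h2.2]
  let p : Matrix Ω Ω ℂ := ∑ i ∈ K, vecMulVec (E.vec i) (star (E.vec i))
  have hp : ∀ v, p *ᵥ v = ∑ i, (if i ∈ K then E.coef v i else 0) • E.vec i := by
    intro v
    simp only [p, sum_mulVec, vecMulVec_mulVec, ite_smul, zero_smul]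
    rw [Finset.sum_ite_mem, Finset.univ_inter]
    refine Finset.sum_congr rfl fun i _ => ?_
    simp [EigenBasis.coef]
  have hc : ∀ v i, E.coef (p *ᵥ v) i = if i ∈ K then E.coef v i else 0 := fun v i => by
    rw [hp, E.coef_sum]
  have hext : ∀ A B : Matrix Ω Ω ℂ, (∀ v, A *ᵥ v = B *ᵥ v) → A = B := fun A B hAB =>
    Matrix.toLin'.injective (LinearMap.ext fun v => by simpa using hAB v)
  refine ⟨p, ⟨?_, ?_, ?_, by rw [conjTranspose_neg, hb], ?_, ?_⟩, ?_⟩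
  · simp [p, conjTranspose_sum, conjTranspose_vecMulVec]
  · refine hext _ _ fun v => E.ext_coef fun i => ?_
    rw [← mulVec_mulVec, hc, hc]
    split_ifs <;> rfl
  · rw [neg_mul, mul_neg]
    congr 1
    refine hext _ _ fun v => E.ext_coef fun i => ?_
    rw [← mulVec_mulVec, ← mulVec_mulVec, hc, E.coef_mulVec, E.coef_mulVec, hc]
    split_ifs <;> simp
  · intro v hv
    have h1 : 3 / 4 * nsq v ≤ form b v := by
      rw [E.form_eq, E.nsq_eq, Finset.mul_sum]
      refine Finset.sum_le_sum fun i _ => ?_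
      by_cases hi : i ∈ K
      · gcongr; exact hK i hi
      · have := hc v i
        rw [hv, if_neg hi] at this
        simp [this]
    have h2 : form (-b) v = -form b v := by simp [form, neg_mulVec]
    rw [h2]; linarith
  · intro v hv
    have h1 : form b v ≤ 1 / 4 * nsq v := by
      rw [E.form_eq, E.nsq_eq, Finset.mul_sum]
      refine Finset.sum_le_sum fun i _ => ?_
      by_cases hi : i ∈ K
      · have := hc v i
        rw [hv, if_pos hi] at this
        have h0 : E.coef v i = 0 := by rw [← this]; simp [EigenBasis.coef]
        simp [h0]
      · gcongr; exact hK' i hi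
    have h2 : form (-b) v = -form b v := by simp [form, neg_mulVec]
    rw [h2]; linarith
  · refine opNorm_le_of_nsq _ (by positivity) fun v => ?_
    rw [E.nsq_eq, E.nsq_eq v, Finset.mul_sum]
    refine Finset.sum_le_sum fun i _ => ?_
    have h1 : E.coef ((b - p) *ᵥ v) i =
        ((E.val i - if i ∈ K then 1 else 0 : ℝ) : ℂ) * E.coef v i := by
      rw [sub_mulVec, E.coef_sub, E.coef_mulVec, hc]
      split_ifs <;> push_cast <;> ring
    rw [h1, norm_mul, mul_pow, Complex.norm_real]
    gcongr
    have h2 := abs_le.1 (hval i)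
    rw [Real.norm_eq_abs, abs_le]
    split_ifs with hi
    · have := hK i hi
      constructor <;> nlinarith [h2.1, h2.2]
    · have := hK' i hi
      constructor <;> nlinarith [h2.1, h2.2]

lemma norm_le_one_of_proj {P : Matrix Ω Ω ℂ} (hP : Pᴴ = P) (hi : P * P = P) : ‖P‖ ≤ 1 :=
  opNorm_le_of_nsq _ zero_le_one fun v => by
    rw [one_pow, one_mul]; exact nsq_proj_le hP hi v

end AlmostProjection

/-! ### Operators on a subset of the spins and compression to it -/

section Embedding

variable {V : Type} [Fintype V] [DecidableEq V] (X : Set V) [Fintype X]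

open Classical in
lemma embed_apply (B : SpinOp X) (σ τ : V → Fin 2) :
    embed X B σ τ = if ∀ v, v ∉ X → σ v = τ v then B (fun v => σ v) (fun v => τ v) else 0 := by
  simp only [embed, of_apply]
  congr

lemma embed_one : embed X (1 : SpinOp X) = 1 := by
  ext σ τ
  rw [embed_apply, one_apply, one_apply]
  by_cases h : σ = τ
  · simp [h]
  · rw [if_neg h]
    split_ifs with h1 h2
    · exfalso
      apply h
      ext v
      by_cases hv : v ∈ X
      · exact congrArg Fin.val (congrFun h2 ⟨v, hv⟩)
      · rw [h1 v hv]
    · rfl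
    · rfl

lemma embed_star (B : SpinOp X) : star (embed X B) = embed X (star B) := by
  ext σ τ
  rw [star_apply, embed_apply, embed_apply, star_apply]
  by_cases h : ∀ v, v ∉ X → σ v = τ v
  · rw [if_pos h, if_pos fun v hv => (h v hv).symm]
  · rw [if_neg h, if_neg fun h' => h fun v hv => (h' v hv).symm, star_zero]

/-- After splitting the configurations into their parts in and outside of `X`, the embedding is the
Kronecker product with `1`. -/
lemma embed_mul (A B : SpinOp X) : embed X (A * B) = embed X A * embed X B := by
  classical
  let e := Equiv.piEquivPiSubtypeProd (· ∈ X) (fun _ : V => Fin 2)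
  have h : ∀ C : SpinOp X, embed X C =
      (kroneckerMap (· * ·) C (1 : Matrix ({v // v ∉ X} → Fin 2) _ ℂ)).submatrix e e := by
    intro C
    ext σ τ
    rw [embed_apply, submatrix_apply, kroneckerMap_apply, one_apply]
    by_cases h1 : ∀ v, v ∉ X → σ v = τ v
    · rw [if_pos h1, if_pos (by ext v; simp [e, h1 v v.2])]
      simp [e]
    · rw [if_neg h1, if_neg, mul_zero]
      intro h2
      exact h1 fun v hv => congrFun h2 ⟨v, hv⟩
  rw [h A, h B, h (A * B), submatrix_mul_equiv, ← mul_kronecker_mul, Matrix.one_mul]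

/-- The embedding of the operators on the spins in `X`, as a linear map. -/
noncomputable def embedLin : SpinOp X →ₗ[ℂ] SpinOp V where
  toFun := embed X
  map_add' A B := by
    ext σ τ
    simp only [embed_apply, Matrix.add_apply]
    split_ifs <;> simp
  map_smul' c A := by
    ext σ τ
    simp only [embed_apply, Matrix.smul_apply, RingHom.id_apply]
    split_ifs <;> simp

/-- The inclusion of the spins in `X`, with all other spins down. -/
noncomputable def incl : Matrix (V → Fin 2) (X → Fin 2) ℂ :=
  open Classical in
  Matrix.of fun σ c => if (∀ v, v ∉ X → σ v = 1) ∧ (fun v : X => σ v) = c then 1 else 0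

/-- The projection onto the configurations with a spin up outside of `X`. -/
noncomputable def outProj : SpinOp V :=
  open Classical in diagonal fun σ => if ∃ v, v ∉ X ∧ σ v = 0 then 1 else 0

lemma incl_mul_conjTranspose : incl X * (incl X)ᴴ = 1 - outProj X := by
  classical
  ext σ τ
  rw [Matrix.mul_apply, Matrix.sub_apply, outProj, diagonal_apply, one_apply]
  simp only [incl, of_apply, conjTranspose_apply]
  by_cases h : ∀ v, v ∉ X → σ v = 1
  · have h1 : ¬ ∃ v, v ∉ X ∧ σ v = 0 := by
      rintro ⟨v, hv, h0⟩
      rw [h v hv] at h0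
      exact absurd h0 (by decide)
    rw [if_neg h1, Finset.sum_eq_single fun v : X => σ v]
    · by_cases hστ : σ = τ
      · subst hστ; simp [eq_true h]
      · have : ¬ ((∀ v, v ∉ X → τ v = 1) ∧ (fun v : X => τ v) = fun v : X => σ v) := by
          rintro ⟨h2, h3⟩
          apply hστ
          ext v
          by_cases hv : v ∈ X
          · exact congrArg Fin.val (congrFun h3 ⟨v, hv⟩).symm
          · rw [h v hv, h2 v hv]
        rw [if_neg this, if_neg hστ]; simp
    · intro c _ hc
      rw [if_neg fun h2 => hc h2.2.symm, zero_mul]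
    · simp
  · have h1 : ∃ v, v ∉ X ∧ σ v = 0 := by
      push Not at h
      obtain ⟨v, hv, h0⟩ := h
      exact ⟨v, hv, by omega⟩
    rw [if_pos h1, sub_self, Finset.sum_eq_zero]
    intro c _
    rw [if_neg fun h2 => h h2.1, zero_mul]

/-- The isometry `incl` intertwines the operators on `X` with their embeddings. This lets the local
flow act on projections of the form `incl * p * inclᴴ`. -/
lemma embed_mul_incl (B : SpinOp X) : embed X B * incl X = incl X * B := by
  classical
  ext σ c
  rw [Matrix.mul_apply, Matrix.mul_apply]
  let τ : V → Fin 2 := fun v => if hv : v ∈ X then c ⟨v, hv⟩ else 1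
  have hτX : (fun v : X => τ v) = c := by ext v; simp [τ]
  have hτ : ∀ v, v ∉ X → τ v = 1 := fun v hv => by simp [τ, hv]
  rw [Finset.sum_eq_single τ]
  · have h1 : incl X τ c = 1 := by rw [incl, of_apply, if_pos ⟨hτ, hτX⟩]
    rw [h1, mul_one, embed_apply]
    by_cases h : ∀ v, v ∉ X → σ v = 1
    · rw [if_pos fun v hv => by rw [h v hv, hτ v hv], hτX,
        Finset.sum_eq_single fun v : X => σ v]
      · simp [incl, eq_true h]
      · intro d _ hd
        rw [incl, of_apply, if_neg fun h2 => hd h2.2.symm, zero_mul]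
      · simp
    · rw [if_neg fun h2 => h fun v hv => by rw [h2 v hv, hτ v hv], Finset.sum_eq_zero]
      intro d _
      rw [incl, of_apply, if_neg fun h2 => h h2.1, zero_mul]
  · intro ρ _ hρ
    rw [incl, of_apply, if_neg, mul_zero]
    rintro ⟨h1, h2⟩
    apply hρ
    ext v
    by_cases hv : v ∈ X
    · have := congrFun (h2.trans hτX.symm) ⟨v, hv⟩
      exact congrArg Fin.val this
    · rw [h1 v hv, hτ v hv]
  · simp

lemma conjTranspose_mul_incl : (incl X)ᴴ * incl X = 1 := by
  classical
  ext c d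
  rw [Matrix.mul_apply, one_apply]
  simp only [incl, of_apply, conjTranspose_apply]
  let τ : V → Fin 2 := fun v => if hv : v ∈ X then c ⟨v, hv⟩ else 1
  have hτX : (fun v : X => τ v) = c := by ext v; simp [τ]
  have hτ : ∀ v, v ∉ X → τ v = 1 := fun v hv => by simp [τ, hv]
  rw [Finset.sum_eq_single τ]
  · rw [if_pos ⟨hτ, hτX⟩, hτX]
    simp [eq_true hτ]
  · intro ρ _ hρ
    rw [if_neg, star_zero, zero_mul]
    rintro ⟨h1, h2⟩
    apply hρ
    ext v
    by_cases hv : v ∈ X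
    · have := congrFun (h2.trans hτX.symm) ⟨v, hv⟩
      exact congrArg Fin.val this
    · rw [h1 v hv, hτ v hv]
  · simp

lemma norm_incl_le : ‖incl X‖ ≤ 1 := by
  have h := l2_opNorm_conjTranspose_mul_self (incl X)
  rw [conjTranspose_mul_incl] at h
  have h1 : ‖(1 : SpinOp X)‖ ≤ 1 := norm_le_one_of_proj conjTranspose_one (Matrix.one_mul 1)
  nlinarith [norm_nonneg (incl X)]

lemma norm_incl_conj_le (B : SpinOp X) : ‖incl X * B * (incl X)ᴴ‖ ≤ ‖B‖ := by
  have h1 := norm_incl_le X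
  calc ‖incl X * B * (incl X)ᴴ‖ ≤ ‖incl X‖ * ‖B‖ * ‖(incl X)ᴴ‖ :=
        (l2_opNorm_mul _ _).trans (by gcongr; exact l2_opNorm_mul _ _)
    _ ≤ 1 * ‖B‖ * 1 := by rw [l2_opNorm_conjTranspose]; gcongr
    _ = ‖B‖ := by ring

lemma norm_conj_incl_le (B : SpinOp V) : ‖(incl X)ᴴ * B * incl X‖ ≤ ‖B‖ := by
  have h1 := norm_incl_le X
  calc ‖(incl X)ᴴ * B * incl X‖ ≤ ‖(incl X)ᴴ‖ * ‖B‖ * ‖incl X‖ :=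
        (l2_opNorm_mul _ _).trans (by gcongr; exact l2_opNorm_mul _ _)
    _ ≤ 1 * ‖B‖ * 1 := by rw [l2_opNorm_conjTranspose]; gcongr
    _ = ‖B‖ := by ring

lemma outProj_conjTranspose : (outProj X)ᴴ = outProj X := by
  rw [outProj, diagonal_conjTranspose]
  congr 1
  ext σ
  simp only [Pi.star_apply]
  split_ifs <;> simp

/-- Compression of operators to the spins in `X`, with all other spins down. -/
noncomputable def compressLin : SpinOp V →ₗ[ℝ] SpinOp X where
  toFun A := (incl X)ᴴ * A * incl X
  map_add' A B := by rw [Matrix.mul_add, Matrix.add_mul]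
  map_smul' c A := by rw [Matrix.mul_smul, Matrix.smul_mul]; rfl

/-- A smooth path of projections that nearly live on the spins in `X`, and do so initially, nearly
follows a flow generated on these spins. -/
theorem exists_local_spectralFlow {P : ℝ → SpinOp V} {ε : ℝ} (hε : ε ≤ 3 / 16)
    (hP : ContDiffOn ℝ ∞ P (Set.Icc 0 1)) (hh : ∀ s ∈ Set.Icc (0 : ℝ) 1, (P s)ᴴ = P s)
    (hi : ∀ s ∈ Set.Icc (0 : ℝ) 1, P s * P s = P s)
    (hX : ∀ s ∈ Set.Icc (0 : ℝ) 1, ‖outProj X * P s‖ ≤ ε) (hX0 : outProj X * P 0 = 0) :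
    ∃ G U : ℝ → SpinOp V,
      ContDiffOn ℝ ∞ G (Set.Icc 0 1) ∧ ContDiffOn ℝ ∞ U (Set.Icc 0 1) ∧ U 0 = 1 ∧
      ∀ s ∈ Set.Icc (0 : ℝ) 1, IsSelfAdjoint (G s) ∧ U s ∈ unitary (SpinOp V) ∧
        IsSupportedIn X (G s) ∧ IsSupportedIn X (U s) ∧
        HasDerivWithinAt U (Complex.I • (G s * U s)) (Set.Icc 0 1) s ∧
        ‖P s - U s * P 0 * star (U s)‖ ≤ 4 * ε := by
  set J := incl X with hJ
  set Q : SpinOp V := outProj X with hQ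
  have hJJ : J * Jᴴ = 1 - Q := incl_mul_conjTranspose X
  let b : ℝ → SpinOp X := fun s => Jᴴ * P s * J
  have hbh : ∀ s ∈ Set.Icc (0 : ℝ) 1, (b s)ᴴ = b s := by
    intro s hs
    simp only [b, conjTranspose_mul, conjTranspose_conjTranspose, hh s hs, Matrix.mul_assoc]
  -- The failure of the compression to be idempotent comes only from the weight of `P s` outside of
  -- `X`.
  have hbb : ∀ s ∈ Set.Icc (0 : ℝ) 1, b s - b s * b s = Jᴴ * (P s * (Q * P s)) * J := by
    intro s hs
    have e1 : b s * b s = Jᴴ * (P s * (1 - Q) * P s) * J := by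
      rw [← hJJ]; simp only [b, Matrix.mul_assoc]
    have e2 : P s * (1 - Q) * P s = P s - P s * (Q * P s) := by
      rw [Matrix.mul_sub, Matrix.sub_mul, Matrix.mul_one, hi s hs, Matrix.mul_assoc]
    rw [e1, e2, Matrix.mul_sub, Matrix.sub_mul]
    simp [b]
  have hPn : ∀ s ∈ Set.Icc (0 : ℝ) 1, ‖P s‖ ≤ 1 := fun s hs =>
    norm_le_one_of_proj (hh s hs) (hi s hs)
  have hbn : ∀ s ∈ Set.Icc (0 : ℝ) 1, ‖b s - b s * b s‖ ≤ ‖Q * P s‖ := by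
    intro s hs
    rw [hbb s hs]
    refine (norm_conj_incl_le X _).trans ((l2_opNorm_mul _ _).trans ?_)
    exact mul_le_of_le_one_left (norm_nonneg _) (hPn s hs)
  have h00 : (0 : ℝ) ∈ Set.Icc (0 : ℝ) 1 := by simp
  have hex := fun s (hs : s ∈ Set.Icc (0 : ℝ) 1) => exists_proj_of_almost_idem (hbh s hs)
    (norm_nonneg (Q * P s)) ((hX s hs).trans hε) (hbn s hs)
  choose! p hps hpb using hex
  -- The distance from `b` to `p` is controlled by `‖Q * P s‖` rather than by the uniform `ε`, so it
  -- vanishes initially. Exactness here is what makes the flow of `P 0` equal to `J * p s * Jᴴ`.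
  have hp0 : p 0 = b 0 := by
    have h1 := hpb 0 h00
    rw [hX0, norm_zero, mul_zero] at h1
    exact (sub_eq_zero.1 (norm_le_zero_iff.1 h1)).symm
  have hbs : ContDiffOn ℝ ∞ b (Set.Icc 0 1) :=
    (LinearMap.toContinuousLinearMap (compressLin X)).contDiff.comp_contDiffOn hP
  have hpsm : ContDiffOn ℝ ∞ p (Set.Icc 0 1) :=
    contDiffOn_proj (A := fun s => -b s) (t := fun _ => -1 / 2) (g := 1 / 2) (by norm_num)
      hbs.neg continuousOn_const hps
  obtain ⟨G', U', hG', hU', hU0, hGU⟩ := exists_spectralFlow hpsm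
    (fun s hs => (hps s hs).proj_herm) (fun s hs => (hps s hs).idem)
  let Λ : SpinOp X →L[ℝ] SpinOp V :=
    LinearMap.toContinuousLinearMap ((embedLin X).restrictScalars ℝ)
  refine ⟨fun s => embed X (G' s), fun s => embed X (U' s), Λ.contDiff.comp_contDiffOn hG',
    Λ.contDiff.comp_contDiffOn hU', by simp only [hU0, embed_one], fun s hs => ?_⟩
  obtain ⟨hGs, hUs, hd, hfl⟩ := hGU s hs
  refine ⟨?_, ?_, ⟨_, rfl⟩, ⟨_, rfl⟩, ?_, ?_⟩
  · rw [IsSelfAdjoint, embed_star, hGs.star_eq]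
  · rw [Unitary.mem_iff] at hUs ⊢
    rw [embed_star, ← embed_mul, ← embed_mul, hUs.1, hUs.2, embed_one]
    exact ⟨rfl, rfl⟩
  · have h1 := Λ.hasFDerivAt.comp_hasDerivWithinAt s hd
    have h2 : Λ (Complex.I • (G' s * U' s)) =
        Complex.I • (embed X (G' s) * embed X (U' s)) := by
      rw [← embed_mul]
      exact (embedLin X).map_smul _ _
    rw [h2] at h1
    exact h1
  · have hP0 : P 0 = J * p 0 * Jᴴ := by
      have e1 : (1 - Q) * P 0 = P 0 := by rw [Matrix.sub_mul, hX0, sub_zero, Matrix.one_mul]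
      have e2 : P 0 * (1 - Q) = P 0 := by
        have := congrArg conjTranspose e1
        rwa [conjTranspose_mul, conjTranspose_sub, conjTranspose_one, hQ, outProj_conjTranspose,
          hh 0 h00] at this
      have e3 : J * p 0 * Jᴴ = (J * Jᴴ) * P 0 * (J * Jᴴ) := by
        rw [hp0]; simp only [b, Matrix.mul_assoc]
      rw [e3, hJJ, e1, e2]
    have hUP : embed X (U' s) * P 0 * star (embed X (U' s)) = J * p s * Jᴴ := by
      have e1 : Jᴴ * star (embed X (U' s)) = star (U' s) * Jᴴ := by
        have := congrArg conjTranspose (embed_mul_incl X (U' s))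
        rw [conjTranspose_mul, conjTranspose_mul] at this
        exact this
      calc embed X (U' s) * P 0 * star (embed X (U' s))
          = (embed X (U' s) * J) * p 0 * (Jᴴ * star (embed X (U' s))) := by
            rw [hP0]; simp only [Matrix.mul_assoc]
        _ = J * (U' s * p 0 * star (U' s)) * Jᴴ := by
            rw [e1, embed_mul_incl X (U' s)]; simp only [hJ, Matrix.mul_assoc]
        _ = _ := by rw [← hfl]
    -- Three errors: two from removing the outside on either side of `P s`, each at most `ε`, and
    -- `2ε` from replacing `b s` by `p s`.
    have hPQ : P s - J * p s * Jᴴ =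
        Q * P s + (1 - Q) * (P s * Q) + J * (b s - p s) * Jᴴ := by
      have e1 : J * b s * Jᴴ = (1 - Q) * P s * (1 - Q) := by
        rw [← hJJ]; simp only [b, Matrix.mul_assoc]
      rw [Matrix.mul_sub J, Matrix.sub_mul (J * b s), e1]
      noncomm_ring
    have hQn : ‖(1 : SpinOp V) - Q‖ ≤ 1 := by
      rw [← hJJ]
      refine (l2_opNorm_mul _ _).trans ?_
      rw [l2_opNorm_conjTranspose]
      nlinarith [norm_incl_le X, norm_nonneg J]
    have hn1 : ‖P s * Q‖ = ‖Q * P s‖ := by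
      rw [← l2_opNorm_conjTranspose, conjTranspose_mul, hh s hs, hQ, outProj_conjTranspose]
    have hXs := hX s hs
    rw [hUP, hPQ]
    calc ‖Q * P s + (1 - Q) * (P s * Q) + J * (b s - p s) * Jᴴ‖
        ≤ ‖Q * P s‖ + ‖(1 - Q) * (P s * Q)‖ + ‖J * (b s - p s) * Jᴴ‖ := norm_add₃_le
      _ ≤ ε + 1 * ε + 2 * ε := by
          refine add_le_add (add_le_add hXs ?_) ?_
          · refine (l2_opNorm_mul _ _).trans ?_
            rw [hn1]
            gcongr
          · refine (norm_incl_conj_le X _).trans ((hpb s hs).trans ?_)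
            gcongr
      _ = 4 * ε := by ring

end Embedding

/-! ### The fattenings of the impurity and the path of spectral projections -/

section Flow

variable {ν L N : ℕ} [NeZero L] {k : Torus ν L} {u : Torus ν L → ℝ} {g : ℝ}
  {W P : ℝ → SpinOp (Spins ν L N)}

lemma outProj_fattening_top (k : Torus ν L) :
    outProj (fattening k ⊤ : Set (Spins ν L N)) = 0 := by
  have h : ∀ v, v ∈ (fattening k ⊤ : Set (Spins ν L N)) := by
    rintro (x | i)
    · exact le_top (a := (torusDist x k : ℝ≥0∞))
    · trivial
  simp [outProj, h]

lemma outProj_fattening (k : Torus ν L) {l : ℝ≥0∞} (hl : l ≠ ⊤) :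
    outProj (fattening k l : Set (Spins ν L N)) = farProj k ⌊l.toReal⌋₊ := by
  have h : ∀ σ : Spins ν L N → Fin 2, (∃ v, v ∉ (fattening k l : Set (Spins ν L N)) ∧ σ v = 0) ↔
      ∃ x, ⌊l.toReal⌋₊ < torusDist x k ∧ σ (Sum.inl x) = 0 := by
    intro σ
    have hx : ∀ x : Torus ν L, (Sum.inl x : Spins ν L N) ∉ (fattening k l : Set (Spins ν L N)) ↔
        ⌊l.toReal⌋₊ < torusDist x k := by
      intro x
      change ¬ ((torusDist x k : ℝ≥0∞) ≤ l) ↔ _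
      -- Distances are integers, so exceeding `l` is the same as exceeding its floor.
      rw [not_le, Nat.floor_lt ENNReal.toReal_nonneg, ← ENNReal.toReal_natCast,
        ENNReal.toReal_lt_toReal hl (ENNReal.natCast_ne_top _)]
    constructor
    · rintro ⟨x | i, hv, h0⟩
      · exact ⟨x, (hx x).1 hv, h0⟩
      · exact absurd trivial hv
    · rintro ⟨x, h1, h0⟩
      exact ⟨_, (hx x).2 h1, h0⟩
  simp only [outProj, farProj, h]

/-- The vacuum may have impurity spins up, but these belong to every fattening of `k`. -/
lemma outProj_fattening_mul_vacuum (k : Torus ν L) (l : ℝ≥0∞) :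
    outProj (fattening k l : Set (Spins ν L N)) *
      diagonal (fun σ => if particles σ = 0 then 1 else 0) = 0 := by
  rw [outProj, diagonal_mul_diagonal, ← diagonal_zero]
  congr 1
  ext σ
  by_cases h : particles σ = 0
  · rw [if_neg, zero_mul]
    rintro ⟨x | i, hv, h0⟩
    · rw [particles_eq_zero_iff.1 h x] at h0
      exact absurd h0 (by decide)
    · exact absurd trivial hv
  · rw [if_neg h, mul_zero]

/-- The path of spectral projections belonging to gapped low-lying sectors. -/
lemma exists_isGappedPath (hg : 0 < g) (hu : ∀ x, 0 ≤ u x) (hW : IsCoupling k W)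
    {σin : ℝ → Set ℝ} (h : ∀ s ∈ Set.Icc (0 : ℝ) 1,
      IsGappedLowSector (xyHamiltonian u + W s) g (σin s) ∧
      IsSpectralProjection (xyHamiltonian u + W s) (σin s) (P s) ∧ (P s).rank = 2 ^ N) :
    ∃ m, IsGappedPath k u g W P m := by
  have hex := fun s (hs : s ∈ Set.Icc (0 : ℝ) 1) =>
    exists_lowSector ((hW.isImpurity hs).isHermitian_add u) (h s hs).1 (h s hs).2.1
      (by rw [(h s hs).2.2]; positivity)
  choose! m hm using hex
  exact ⟨m, hg, hu, hW.smooth.continuousOn, hW.start, fun s hs => hW.isImpurity hs, hm,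
    fun s hs => (h s hs).2.2⟩

/-- The sector is split off at the middle of the gap, `m s + g/2`, which varies continuously by
Weyl's inequality. -/
lemma contDiffOn_spectralProjection {m : ℝ → ℝ} (hm : IsGappedPath k u g W P m)
    (hW : IsCoupling k W) (hh : ∀ s ∈ Set.Icc (0 : ℝ) 1, (P s)ᴴ = P s)
    (hi : ∀ s ∈ Set.Icc (0 : ℝ) 1, P s * P s = P s) : ContDiffOn ℝ ∞ P (Set.Icc 0 1) := by
  refine contDiffOn_proj (A := fun s => xyHamiltonian u + W s) (t := fun s => m s + g / 2)
    hm.gap_pos (contDiffOn_const.add hW.smooth) (hm.continuousOn_top.add continuousOn_const)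
    fun s hs => ?_
  obtain ⟨E⟩ := hm.sector s hs
  refine ⟨hh s hs, hi s hs, E.comm, (hm.impurity s hs).isHermitian_add u, fun v hv => ?_,
    fun v hv => ?_⟩
  · rw [add_sub_cancel_right]; exact E.form_le hv
  · rw [add_assoc, add_halves]; exact E.le_form' hv

lemma isSupportedIn_zero {V : Type} (X : Set V) : IsSupportedIn X (0 : SpinOp V) :=
  ⟨0, by ext σ τ; simp [embed]⟩

lemma isSupportedIn_one {V : Type} [Fintype V] [DecidableEq V] (X : Set V) :
    IsSupportedIn X (1 : SpinOp V) := by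
  classical
  exact ⟨1, (embed_one X).symm⟩

end Flow

end XYImpurity

/-! ### Assembly of the theorem -/

theorem proposition5p1 (ν N : ℕ) (g : ℝ) (hg : 0 < g) :
    ∃ C μ' : ℝ, 0 < C ∧ 0 < μ' ∧
      ∀ (L : ℕ) [NeZero L] (k : XYImpurity.Torus ν L)
        (u : XYImpurity.Torus ν L → ℝ) (γ : ℝ), 0 < γ → (∀ x, γ ≤ u x) →
      ∀ W : ℝ → XYImpurity.SpinOp (XYImpurity.Spins ν L N), XYImpurity.IsCoupling k W →
      ∀ (σin : ℝ → Set ℝ) (P : ℝ → XYImpurity.SpinOp (XYImpurity.Spins ν L N)),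
        (∀ s ∈ Set.Icc (0 : ℝ) 1,
          XYImpurity.IsGappedLowSector (XYImpurity.xyHamiltonian u + W s) g (σin s) ∧
          XYImpurity.IsSpectralProjection (XYImpurity.xyHamiltonian u + W s) (σin s) (P s) ∧
          (P s).rank = 2 ^ N) →
      ∀ l : ℝ≥0∞, ∃ G U : ℝ → XYImpurity.SpinOp (XYImpurity.Spins ν L N),
        ContDiffOn ℝ ∞ G (Set.Icc 0 1) ∧ ContDiffOn ℝ ∞ U (Set.Icc 0 1) ∧
        U 0 = 1 ∧
        ∀ s ∈ Set.Icc (0 : ℝ) 1,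
          IsSelfAdjoint (G s) ∧ U s ∈ unitary (XYImpurity.SpinOp (XYImpurity.Spins ν L N)) ∧
          XYImpurity.IsSupportedIn (XYImpurity.fattening k l) (G s) ∧
          XYImpurity.IsSupportedIn (XYImpurity.fattening k l) (U s) ∧
          -Complex.I • derivWithin U (Set.Icc 0 1) s = G s * U s ∧
          ‖P s - U s * P 0 * star (U s)‖ ≤ C * XYImpurity.expDecay μ' l := by
  classical
  open XYImpurity Matrix in
  obtain ⟨C, μ, hC, hμ, hloc⟩ := exists_localization ν N hg
  -- The factor `11` serves both cases: `4ε ≤ 11ε` if `ε ≤ 3/16`, and `11ε > 2` otherwise. The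
  -- factor `exp μ` pays for rounding `l` down to an integer.
  refine ⟨11 * (C * Real.exp μ), μ, by positivity, hμ, ?_⟩
  intro L _ k u γ hγ hu W hW σin P h l
  obtain ⟨m, hm⟩ := exists_isGappedPath hg (fun x => hγ.le.trans (hu x)) hW h
  have hh : ∀ s ∈ Set.Icc (0 : ℝ) 1, (P s)ᴴ = P s := fun s hs => (h s hs).2.1.selfAdjoint
  have hi : ∀ s ∈ Set.Icc (0 : ℝ) 1, P s * P s = P s := fun s hs => (h s hs).2.1.idempotent
  have h00 : (0 : ℝ) ∈ Set.Icc (0 : ℝ) 1 := by simp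
  obtain ⟨E₀⟩ := hm.sector_zero
  have hvac := proj_eq_vacuum hm.field_nonneg hg E₀ (hm.rank_eq 0 h00)
  obtain ⟨ε, hεl, hε⟩ : ∃ ε : ℝ, 11 * ε ≤ 11 * (C * Real.exp μ) * expDecay μ l ∧
      ∀ s ∈ Set.Icc (0 : ℝ) 1,
        ‖outProj (fattening k l : Set (Spins ν L N)) * P s‖ ≤ ε := by
    by_cases hl : l = ⊤
    · refine ⟨0, ?_, fun s _ => ?_⟩
      · rw [expDecay, if_pos hl]; simp
      · rw [hl, outProj_fattening_top]; simp
    · refine ⟨C * Real.exp (-(μ * ⌊l.toReal⌋₊)), ?_, fun s hs => ?_⟩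
      · rw [expDecay, if_neg hl]
        have h1 : Real.exp (-(μ * ⌊l.toReal⌋₊)) ≤ Real.exp μ * Real.exp (-(μ * l.toReal)) := by
          rw [← Real.exp_add]
          gcongr
          nlinarith [Nat.lt_floor_add_one l.toReal]
        nlinarith [mul_le_mul_of_nonneg_left h1 hC.le]
      · rw [outProj_fattening k hl]
        exact hloc L k u W P m hm s hs _
  have hε0 : 0 ≤ ε := (norm_nonneg _).trans (hε 0 h00)
  by_cases hsmall : ε ≤ 3 / 16
  · obtain ⟨G, U, hG, hU, hU0, hGU⟩ := exists_local_spectralFlow (fattening k l) hsmall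
      (contDiffOn_spectralProjection hm hW hh hi) hh hi hε
      (by rw [hvac]; exact outProj_fattening_mul_vacuum k l)
    refine ⟨G, U, hG, hU, hU0, fun s hs => ?_⟩
    obtain ⟨h1, h2, h3, h4, h5, h6⟩ := hGU s hs
    refine ⟨h1, h2, h3, h4, ?_, h6.trans (by linarith)⟩
    rw [h5.derivWithin (uniqueDiffOn_Icc zero_lt_one s hs), smul_smul, neg_mul, Complex.I_mul_I,
      neg_neg, one_smul]
  -- For small `l` the trivial flow suffices, as two projections differ by at most `2` in norm.
  · refine ⟨fun _ => 0, fun _ => 1, contDiffOn_const, contDiffOn_const, rfl, fun s hs => ?_⟩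
    refine ⟨IsSelfAdjoint.zero _, one_mem _, isSupportedIn_zero _, isSupportedIn_one _, ?_, ?_⟩
    · rw [derivWithin_fun_const]; simp
    · push Not at hsmall
      rw [star_one, mul_one, one_mul]
      have h1 := norm_le_one_of_proj (hh s hs) (hi s hs)
      have h2 := norm_le_one_of_proj (hh 0 h00) (hi 0 h00)
      have h3 := norm_sub_le (P s) (P 0)
      linarith
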